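/- Let $m\ge 2$ and $1\le d\le m$ be integers, let $(\xi_i)_{i\ge 1}$ be an i.i.d. sequence of random variables with values in a measurable space $(S,\mathcal S)$, and let $1<r\le 2$. Let $(\mathbb B,\|\cdot\|)$ be a real separable Banach space which is $r$-smooth, i.e. there is an equivalent norm $\|\cdot\|'$ on $\mathbb B$ with $$\sup_{t>0}\ \sup_{\|x\|'=\|y\|'=1}\frac{\|x+ty\|'+\|x-ty\|'-2}{t^r}<\infty .$$ Let $h\colon S^m\to\mathbb B$ be measurable and symmetric (invariant under permutations of its $m$ arguments), and suppose that $h$ is degenerate of order $d$: $h(\xi_1,\dots,\xi_m)$ is integrable, $$\mathbb E[h(\xi_1,\dots,\xi_m)\mid \xi_1,\dots,\xi_{d-1}]=0\ \text{ a.s.}\qquad\text{and}\qquad \mathbb E\big\|\mathbb E[h(\xi_1,\dots,\xi_m)\mid \xi_1,\dots,\xi_d]\big\|\neq 0$$ (for $d=1$ the first condition reads $\mathbb E[h(\xi_1,\dots,\xi_m)]=0$). For $1\le j\le m$ let $$H_{j,r}:=\big(\mathbb E[\|h(\xi_1,\dots,\xi_m)\|^r\mid \xi_1,\dots,\xi_j]\big)^{1/r}\in[0,\infty].$$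 Let $0<\alpha<(r-1)d/r$ and let $\gamma>-1$ be real. Suppose that for every $j\in\{1,\dots,m\}$, $$H_{j,r}\in\mathbb L^{q(d,j,\gamma,r)},\qquad q(d,j,\gamma,r):=\frac{\gamma+j+1}{\max\{d,j\}\frac{r-1}{r}-\alpha+\frac jr}.$$ Then for every $\varepsilon>0$, $$\sum_{N=1}^\infty N^\gamma\,\mathbb P\Big(\sup_{n\ge \max\{N,m\}} n^\alpha\binom nm^{-1}\|U_{m,n}(h)\|>\varepsilon\Big)<\infty,\qquad U_{m,n}(h)=\sum_{1\le i_1<\dots<i_m\le n}h(\xi_{i_1},\dots,\xi_{i_m}).$$ -/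

import Mathlib

open MeasureTheory ProbabilityTheory
open scoped ENNReal

noncomputable section

namespace UStat

/-- A real normed space is `r`-smooth (`1 < r ≤ 2`) if it has an equivalent norm `N` with
`sup_{t > 0} sup_{N x = N y = 1} (N (x + t y) + N (x - t y) - 2) / t ^ r < ∞`. -/
def IsSmoothSpace (B : Type*) [NormedAddCommGroup B] [NormedSpace ℝ B] (r : ℝ) : Prop :=
  1 < r ∧ r ≤ 2 ∧
    ∃ N : Seminorm ℝ B,
      (∃ c C : ℝ, 0 < c ∧ 0 < C ∧ ∀ x, c * ‖x‖ ≤ N x ∧ N x ≤ C * ‖x‖) ∧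
      ∃ K : ℝ, ∀ t : ℝ, 0 < t → ∀ x y : B, N x = 1 → N y = 1 →
        (N (x + t • y) + N (x - t • y) - 2) / t ^ r ≤ K

/-- The kernel is invariant under every permutation of its arguments. -/
def IsSymmKernel {S B : Type*} {m : ℕ} (h : (Fin m → S) → B) : Prop :=
  ∀ (σ : Equiv.Perm (Fin m)) (x : Fin m → S), h (fun k => x (σ k)) = h x

/-- The vector `(ξ_1, …, ξ_k)`; the sequence is indexed from `0`, so that `ξ i` stands for
`ξ_{i+1}`. -/
def initial {Ω S : Type*} (ξ : ℕ → Ω → S) (k : ℕ) (ω : Ω) : Fin k → S :=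
  fun l => ξ l ω

/-- The `σ`-algebra generated by `ξ_1, …, ξ_k` (trivial for `k = 0`). -/
abbrev sigmaInitial {Ω S : Type*} [MeasurableSpace S] (ξ : ℕ → Ω → S) (k : ℕ) :
    MeasurableSpace Ω :=
  MeasurableSpace.comap (initial ξ k) inferInstance

/-- The kernel `h` is degenerate of order `d` with respect to `ξ`: `h (ξ_1, …, ξ_m)` is
integrable, `E[h (ξ_1, …, ξ_m) | ξ_1, …, ξ_{d-1}] = 0` a.s. and
`E ‖E[h (ξ_1, …, ξ_m) | ξ_1, …, ξ_d]‖ ≠ 0`. Meaningful for `1 ≤ d ≤ m`. -/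
def IsDegenerateOfOrder {Ω S B : Type*} [MeasurableSpace Ω] [MeasurableSpace S]
    [NormedAddCommGroup B] [NormedSpace ℝ B] [CompleteSpace B]
    (P : Measure Ω) (ξ : ℕ → Ω → S) {m : ℕ} (h : (Fin m → S) → B) (d : ℕ) : Prop :=
  Integrable (fun ω => h (initial ξ m ω)) P ∧
    P[fun ω => h (initial ξ m ω) | sigmaInitial ξ (d - 1)] =ᵐ[P] 0 ∧
    ∫ ω, ‖(P[fun ω => h (initial ξ m ω) | sigmaInitial ξ d]) ω‖ ∂P ≠ 0

/-- `H_{j,r} = (E[‖h (ξ_1, …, ξ_m)‖ ^ r | ξ_1, …, ξ_j]) ^ (1 / r)`, where the conditional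
expectation of a nonnegative random variable takes values in `[0, ∞]`. -/
def condMoment {Ω S B : Type*} [MeasurableSpace Ω] [MeasurableSpace S]
    [NormedAddCommGroup B] (P : Measure Ω) (ξ : ℕ → Ω → S) {m : ℕ} (h : (Fin m → S) → B)
    (r : ℝ) (j : ℕ) (ω : Ω) : ℝ≥0∞ :=
  ((P⁻[fun ω => ‖h (initial ξ m ω)‖ₑ ^ r | sigmaInitial ξ j]) ω) ^ (1 / r)

/-- The exponent `q (d, j, γ, r)`; `α` is an argument as well. -/
def momentExponent (α : ℝ) (d j : ℕ) (γ r : ℝ) : ℝ :=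
  (γ + j + 1) / ((max d j : ℕ) * ((r - 1) / r) - α + j / r)

open scoped Classical in
/-- The index set of strictly increasing `m`-tuples of elements of `{0, …, n - 1}`. -/
def incIndices (m n : ℕ) : Finset (Fin m → Fin n) :=
  Finset.univ.filter fun i => StrictMono i

/-- The `U`-statistic `U_{m,n}(h) = ∑_{1 ≤ i_1 < ⋯ < i_m ≤ n} h (ξ_{i_1}, …, ξ_{i_m})`. -/
def uStat {Ω S B : Type*} [AddCommMonoid B] (ξ : ℕ → Ω → S) {m : ℕ}
    (h : (Fin m → S) → B) (n : ℕ) (ω : Ω) : B :=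
  ∑ i ∈ incIndices m n, h (fun l => ξ (i l) ω)

end UStat

end

/-!
A smooth norm satisfies a two-point inequality with exponent `r`, and hence the martingale type `r`
inequality for predictable sums. Let a path of kernel sums cross from the level `l` to the level
`2 * l`. Its increments at time `j` are kernel sums of lower order, with the new observation as the
first variable of the kernel, so unless one of these increments or their conditional means is large,
the sum of the centred increments during the passage has size comparable to `l`. Applying the
martingale inequality to this sum bounds the tail of the maximum at `2 * l` by a small multiple of
the tail at `l`, plus tails for three kernels with one variable less: the first variable is moved to
the parameters (size of an increment), absorbed in the `L^r` norm (conditional `r`-th moment of the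
centred increments), or integrated out (conditional mean).

Summing over dyadic levels absorbs the multiple of the tail at `l`, and iterating removes all the
variables. If `a` of them are absorbed in the norm, `c` are integrated out and `j` become
parameters, what remains is a series of tails of the conditional `L^r` norm given `j` variables.
Degeneracy makes it vanish unless enough variables were frozen or absorbed, and in the other cases
the exponent `q(d, j, γ, r)` is what its convergence requires.

If `q(d, 1, γ, r) < r`, the kernel need not have a moment of order `r`. The iteration then stops at
kernels of order one, whose first variable is truncated at the level in question; degeneracy turns
the mean of the truncated kernel into the mean of the discarded part, which is small.
-/

namespace UStat

/-! ### Smooth norms -/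

section TwoPoint

theorem one_add_rpow_le {p r : ℝ} (hp : -1 ≤ p) (hr : 1 ≤ r) (hr2 : r ≤ 2) :
    (1 + p) ^ r ≤ 1 + r * p + p ^ 2 := by
  have h0 : 0 ≤ 1 + p := by linarith
  have hsplit : (1 + p) ^ r = (1 + p) * (1 + p) ^ (r - 1) := by
    rw [mul_comm, ← Real.rpow_add_one' h0 (by linarith), sub_add_cancel]
  have hbernoulli : (1 + p) ^ (r - 1) ≤ 1 + (r - 1) * p :=
    rpow_one_add_le_one_add_mul_self hp (by linarith) (by linarith)
  calc (1 + p) ^ r ≤ (1 + p) * (1 + (r - 1) * p) := by rw [hsplit]; gcongr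
    _ ≤ 1 + r * p + p ^ 2 := by nlinarith [sq_nonneg p]

theorem rpow_add_rpow_le_of_add_le {a b s K r : ℝ} (hr : 1 ≤ r) (hr2 : r ≤ 2) (ha0 : 0 ≤ a)
    (hb0 : 0 ≤ b) (hs0 : 0 < s) (hs1 : s ≤ 1) (ha : a ≤ 1 + s) (hb : b ≤ 1 + s)
    (hab : 2 ≤ a + b) (habK : a + b - 2 ≤ K * s ^ r) :
    a ^ r + b ^ r ≤ 2 + (2 * K + 2) * s ^ r := by
  have hsr : s ^ 2 ≤ s ^ r := by
    rw [← Real.rpow_natCast]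
    exact Real.rpow_le_rpow_of_exponent_ge hs0 hs1 (by simpa using hr2)
  have pa := one_add_rpow_le (p := a - 1) (by linarith) hr hr2
  have pb := one_add_rpow_le (p := b - 1) (by linarith) hr hr2
  rw [add_sub_cancel] at pa pb
  have qa : (a - 1) ^ 2 ≤ s ^ 2 := by nlinarith
  have qb : (b - 1) ^ 2 ≤ s ^ 2 := by nlinarith
  have hlin : r * (a + b - 2) ≤ 2 * (K * s ^ r) := mul_le_mul hr2 habK (by linarith) (by norm_num)
  linarith

variable {E : Type*} [AddCommGroup E] [Module ℝ E] (N : Seminorm ℝ E) {r K : ℝ}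

theorem seminorm_rpow_le_four_mul {x y : E} (h : N x ≤ 2 * N y) (hr : 0 ≤ r) (hr2 : r ≤ 2) :
    N x ^ r ≤ 4 * N y ^ r :=
  calc N x ^ r ≤ (2 * N y) ^ r := Real.rpow_le_rpow (apply_nonneg N x) h hr
    _ = 2 ^ r * N y ^ r := Real.mul_rpow (by norm_num) (apply_nonneg N y)
    _ ≤ 2 ^ (2 : ℝ) * N y ^ r := by
        have := Real.rpow_nonneg (apply_nonneg N y) r
        gcongr
        norm_num
    _ = 4 * N y ^ r := by norm_num

variable {N} in
/-- The two-point inequality for unit vectors is homogeneous of degree `r`, so it suffices to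
scale the larger of the two vectors to norm one. -/
theorem seminorm_rpow_two_point_of_lt (hr : 1 ≤ r) (hr2 : r ≤ 2)
    (hsmooth : ∀ t : ℝ, 0 < t → ∀ x y : E, N x = 1 → N y = 1 →
      N (x + t • y) + N (x - t • y) - 2 ≤ K * t ^ r) {x y : E} (hy : 0 < N y) (hyx : N y < N x) :
    N (x + y) ^ r + N (x - y) ^ r ≤ 2 * N x ^ r + (2 * K + 2) * N y ^ r := by
  have hx : 0 < N x := hy.trans hyx
  set s := N y / N x
  have hs0 : 0 < s := div_pos hy hx
  set x' := (N x)⁻¹ • x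
  set y' := (N y)⁻¹ • y
  have hunit : ∀ z : E, 0 < N z → N ((N z)⁻¹ • z) = 1 := fun z hz => by
    rw [map_smul_eq_mul, Real.norm_of_nonneg (by positivity), inv_mul_cancel₀ hz.ne']
  have hx' : N x' = 1 := hunit x hx
  have hy' : N y' = 1 := hunit y hy
  have hsy : N (s • y') = s := by
    rw [map_smul_eq_mul, hy', Real.norm_of_nonneg hs0.le, mul_one]
  have hxx' : N x • x' = x := smul_inv_smul₀ hx.ne' x
  have hyy' : N x • s • y' = y := by
    rw [smul_smul, mul_div_cancel₀ _ hx.ne', smul_inv_smul₀ hy.ne']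
  have hscale : ∀ z : E, N (N x • z) ^ r = N x ^ r * N z ^ r := fun z => by
    rw [map_smul_eq_mul, Real.norm_of_nonneg hx.le, Real.mul_rpow hx.le (apply_nonneg N z)]
  have hadd : N (x' + s • y') ≤ 1 + s := by
    simpa only [hx', hsy] using map_add_le_add N x' (s • y')
  have hsub : N (x' - s • y') ≤ 1 + s := by
    simpa only [hx', hsy] using map_sub_le_add N x' (s • y')
  have htwo : 2 ≤ N (x' + s • y') + N (x' - s • y') := by
    have h := map_add_le_add N (x' + s • y') (x' - s • y')
    rwa [add_add_sub_cancel, ← two_smul ℝ x', map_smul_eq_mul, hx', mul_one,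
      Real.norm_of_nonneg zero_le_two] at h
  have key := rpow_add_rpow_le_of_add_le hr hr2 (apply_nonneg N _) (apply_nonneg N _) hs0
    ((div_le_one hx).2 hyx.le) hadd hsub htwo (hsmooth s hs0 x' y' hx' hy')
  calc N (x + y) ^ r + N (x - y) ^ r
      = N x ^ r * (N (x' + s • y') ^ r + N (x' - s • y') ^ r) := by
        rw [mul_add, ← hscale, ← hscale, smul_add, smul_sub, hxx', hyy']
    _ ≤ N x ^ r * (2 + (2 * K + 2) * s ^ r) := by gcongr
    _ = 2 * N x ^ r + (2 * K + 2) * N y ^ r := by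
        rw [Real.div_rpow hy.le hx.le]
        have := (Real.rpow_pos_of_pos hx r).ne'
        field_simp

variable {N} in
theorem seminorm_rpow_two_point (hr : 1 ≤ r) (hr2 : r ≤ 2) (hK : 0 ≤ K)
    (hsmooth : ∀ t : ℝ, 0 < t → ∀ x y : E, N x = 1 → N y = 1 →
      N (x + t • y) + N (x - t • y) - 2 ≤ K * t ^ r) (x y : E) :
    N (x + y) ^ r + N (x - y) ^ r ≤ 2 * N x ^ r + (2 * K + 8) * N y ^ r := by
  have hr0 : 0 ≤ r := by linarith
  have hxr : 0 ≤ N x ^ r := Real.rpow_nonneg (apply_nonneg N x) r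
  have hyr : 0 ≤ N y ^ r := Real.rpow_nonneg (apply_nonneg N y) r
  have hadd := map_add_le_add N x y
  have hsub := map_sub_le_add N x y
  have hKy := mul_nonneg hK hyr
  rcases le_or_gt (N x) (N y) with hxy | hyx
  · have hadd4 := seminorm_rpow_le_four_mul N (y := y) (hadd.trans (by linarith)) hr0 hr2
    have hsub4 := seminorm_rpow_le_four_mul N (y := y) (hsub.trans (by linarith)) hr0 hr2
    linarith
  rcases (apply_nonneg N y).eq_or_lt with hy | hy
  · have haddr := Real.rpow_le_rpow (apply_nonneg N _) (hadd.trans_eq (by rw [← hy, add_zero])) hr0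
    have hsubr := Real.rpow_le_rpow (apply_nonneg N _) (hsub.trans_eq (by rw [← hy, add_zero])) hr0
    linarith
  · linarith [seminorm_rpow_two_point_of_lt hr hr2 hsmooth hy hyx]

theorem convexOn_seminorm_rpow (hr : 1 ≤ r) : ConvexOn ℝ Set.univ fun x => N x ^ r := by
  refine ⟨convex_univ, fun x _ y _ a b ha hb hab => ?_⟩
  calc N (a • x + b • y) ^ r ≤ (a • N x + b • N y) ^ r :=
        Real.rpow_le_rpow (apply_nonneg N _) (N.convexOn.2 trivial trivial ha hb hab) (by linarith)
    _ ≤ a • N x ^ r + b • N y ^ r :=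
        (convexOn_rpow hr).2 (apply_nonneg N x) (apply_nonneg N y) ha hb hab

end TwoPoint

theorem memLp_ofReal_of_lintegral_ne_top {Z B : Type*} [MeasurableSpace Z]
    {μ : Measure Z} [NormedAddCommGroup B] {r : ℝ} (hr : 0 < r) {V : Z → B}
    (hV : AEStronglyMeasurable V μ) (hfin : ∫⁻ z, ‖V z‖ₑ ^ r ∂μ ≠ ∞) :
    MemLp V (ENNReal.ofReal r) μ := by
  refine ⟨hV, ?_⟩
  rw [eLpNorm_eq_lintegral_rpow_enorm_toReal (by simpa using hr) (by simp),
    ENNReal.toReal_ofReal hr.le]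
  exact ENNReal.rpow_lt_top_of_nonneg (by positivity) hfin

section NormedSpace

variable {B : Type*} [NormedAddCommGroup B] [NormedSpace ℝ B]

theorem IsSmoothSpace.exists_seminorm_two_point {r : ℝ} (hB : IsSmoothSpace B r) :
    ∃ N : Seminorm ℝ B,
      (∃ c C : ℝ, 0 < c ∧ 0 < C ∧ ∀ x, c * ‖x‖ ≤ N x ∧ N x ≤ C * ‖x‖) ∧
      ∃ K : ℝ, 0 < K ∧ ∀ x y : B, N (x + y) ^ r + N (x - y) ^ r ≤ 2 * N x ^ r + K * N y ^ r := by
  obtain ⟨hr1, hr2, N, hN, K, hK⟩ := hB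
  refine ⟨N, hN, 2 * max K 0 + 8, by positivity,
    seminorm_rpow_two_point hr1.le hr2 (le_max_right _ _) fun t ht x y hx hy => ?_⟩
  have htr := Real.rpow_pos_of_pos ht r
  calc N (x + t • y) + N (x - t • y) - 2 ≤ K * t ^ r :=
        (div_le_iff₀ htr).1 (hK t ht x y hx hy)
    _ ≤ max K 0 * t ^ r := by gcongr; exact le_max_left _ _

theorem continuous_of_le_mul_norm {N : Seminorm ℝ B} {C : ℝ} (hN : ∀ x, N x ≤ C * ‖x‖) :
    Continuous N := by
  refine Seminorm.continuous_of_continuousAt_zero ?_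
  rw [ContinuousAt, map_zero]
  refine squeeze_zero (fun x => apply_nonneg N x) hN ?_
  have : Continuous fun x : B => C * ‖x‖ := by fun_prop
  simpa using this.tendsto 0

section Centred

variable {Z : Type*} [MeasurableSpace Z] {μ : Measure Z} {r C K : ℝ} {N : Seminorm ℝ B}

theorem seminorm_rpow_le_mul_norm_rpow (hr : 0 ≤ r) (hC : 0 ≤ C) (hN : ∀ x, N x ≤ C * ‖x‖)
    (x : B) : N x ^ r ≤ C ^ r * ‖x‖ ^ r := by
  rw [← Real.mul_rpow hC (norm_nonneg x)]
  exact Real.rpow_le_rpow (apply_nonneg N x) (hN x) hr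

theorem integrable_seminorm_rpow (hr : 0 < r) (hC : 0 ≤ C) (hN : ∀ x, N x ≤ C * ‖x‖) {W : Z → B}
    (hW : MemLp W (ENNReal.ofReal r) μ) : Integrable (fun z => N (W z) ^ r) μ := by
  have hnorm := hW.integrable_norm_rpow (by simpa using hr) (by simp)
  rw [ENNReal.toReal_ofReal hr.le] at hnorm
  refine (hnorm.const_mul (C ^ r)).mono' (((continuous_of_le_mul_norm hN).rpow_const
    fun _ => Or.inr hr.le).comp_aestronglyMeasurable hW.1) (.of_forall fun z => ?_)
  rw [Real.norm_of_nonneg (Real.rpow_nonneg (apply_nonneg N _) _)]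
  exact seminorm_rpow_le_mul_norm_rpow hr.le hC hN _

theorem lintegral_seminorm_rpow_le (hr : 0 ≤ r) (hC : 0 ≤ C) (hN : ∀ x, N x ≤ C * ‖x‖)
    (W : Z → B) :
    ∫⁻ z, ENNReal.ofReal (N (W z) ^ r) ∂μ ≤ ENNReal.ofReal (C ^ r) * ∫⁻ z, ‖W z‖ₑ ^ r ∂μ := by
  rw [← lintegral_const_mul' _ _ ENNReal.ofReal_ne_top]
  refine lintegral_mono fun z => ?_
  rw [← ofReal_norm, ENNReal.ofReal_rpow_of_nonneg (norm_nonneg _) hr,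
    ← ENNReal.ofReal_mul (by positivity)]
  exact ENNReal.ofReal_le_ofReal (seminorm_rpow_le_mul_norm_rpow hr hC hN _)

variable [IsProbabilityMeasure μ]

theorem eLpNorm'_sub_integral_le (hr : 1 ≤ r) {V : Z → B} (hV : AEStronglyMeasurable V μ) :
    eLpNorm' (fun z => V z - ∫ w, V w ∂μ) r μ ≤ 2 * eLpNorm' V r μ := by
  set e := ∫ w, V w ∂μ
  have hmean : eLpNorm' (fun _ : Z => e) r μ ≤ eLpNorm' V r μ :=
    calc eLpNorm' (fun _ : Z => e) r μ = ‖e‖ₑ := by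
          rw [eLpNorm'_const _ (by linarith)]; simp
      _ ≤ ∫⁻ z, ‖V z‖ₑ ∂μ := enorm_integral_le_lintegral_enorm _
      _ = eLpNorm' V 1 μ := by simp [eLpNorm']
      _ ≤ eLpNorm' V r μ := eLpNorm'_le_eLpNorm'_of_exponent_le one_pos hr μ hV
  have htri := eLpNorm'_add_le hV (aestronglyMeasurable_const (b := e)).neg hr
  rw [eLpNorm'_neg, ← sub_eq_add_neg] at htri
  calc eLpNorm' (V - fun _ => e) r μ ≤ eLpNorm' V r μ + eLpNorm' V r μ := htri.trans (by gcongr)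
    _ = 2 * eLpNorm' V r μ := (two_mul _).symm

variable [CompleteSpace B]

/-- By Jensen's inequality the reflected average of `N (a - W) ^ r` is at least `N a ^ r`, so the
two-point inequality bounds the other one. -/
theorem integral_seminorm_add_centred_le (hr : 1 ≤ r) (hC : 0 ≤ C) (hN : ∀ x, N x ≤ C * ‖x‖)
    (hNK : ∀ x y : B, N (x + y) ^ r + N (x - y) ^ r ≤ 2 * N x ^ r + K * N y ^ r)
    (a : B) {W : Z → B} (hW : MemLp W (ENNReal.ofReal r) μ) (hW0 : ∫ z, W z ∂μ = 0) :
    ∫ z, N (a + W z) ^ r ∂μ ≤ N a ^ r + K * ∫ z, N (W z) ^ r ∂μ := by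
  have hr0 : 0 < r := by linarith
  have hint : ∀ {f : Z → B}, MemLp f (ENNReal.ofReal r) μ → Integrable (fun z => N (f z) ^ r) μ :=
    integrable_seminorm_rpow hr0 hC hN
  have hadd := hint ((memLp_const a).add hW)
  have hsub := hint ((memLp_const a).sub hW)
  have hle : 1 ≤ ENNReal.ofReal r := by simpa using hr
  have jensen : N a ^ r ≤ ∫ z, N (a - W z) ^ r ∂μ := by
    have hmean : ∫ z, (a - W z) ∂μ = a := by
      rw [integral_sub (integrable_const _) (hW.integrable hle), hW0]
      simp
    have h := (convexOn_seminorm_rpow N hr).map_integral_le (μ := μ) (f := fun z => a - W z)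
      ((continuous_of_le_mul_norm hN).rpow_const fun _ => Or.inr hr0.le).continuousOn
      isClosed_univ (by simp) (((memLp_const a).sub hW).integrable hle) hsub
    rwa [hmean] at h
  have hmono : ∫ z, (N (a + W z) ^ r + N (a - W z) ^ r) ∂μ ≤
      ∫ z, (2 * N a ^ r + K * N (W z) ^ r) ∂μ :=
    integral_mono (hadd.add hsub) ((integrable_const _).add ((hint hW).const_mul K))
      fun z => hNK a (W z)
  have hleft : ∫ z, (N (a + W z) ^ r + N (a - W z) ^ r) ∂μ =
      ∫ z, N (a + W z) ^ r ∂μ + ∫ z, N (a - W z) ^ r ∂μ := integral_add hadd hsub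
  have hright : ∫ z, (2 * N a ^ r + K * N (W z) ^ r) ∂μ =
      2 * N a ^ r + K * ∫ z, N (W z) ^ r ∂μ := by
    rw [integral_add (integrable_const _) ((hint hW).const_mul K), integral_const,
      integral_const_mul, probReal_univ, one_smul]
  linarith

theorem lintegral_seminorm_add_centred_le (hr : 1 ≤ r) (hC : 0 < C) (hN : ∀ x, N x ≤ C * ‖x‖)
    (hK : 0 < K) (hNK : ∀ x y : B, N (x + y) ^ r + N (x - y) ^ r ≤ 2 * N x ^ r + K * N y ^ r)
    (a : B) {V : Z → B} (hV : AEStronglyMeasurable V μ) :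
    ∫⁻ z, ENNReal.ofReal (N (a + (V z - ∫ w, V w ∂μ)) ^ r) ∂μ ≤
      ENNReal.ofReal (N a ^ r) + ENNReal.ofReal (K * (2 * C) ^ r) * ∫⁻ z, ‖V z‖ₑ ^ r ∂μ := by
  have hr0 : 0 < r := by linarith
  by_cases hfin : ∫⁻ z, ‖V z‖ₑ ^ r ∂μ = ∞
  · rw [hfin, ENNReal.mul_top (by simpa using by positivity)]
    simp
  set e := ∫ w, V w ∂μ with he
  have hVr : MemLp V (ENNReal.ofReal r) μ := memLp_ofReal_of_lintegral_ne_top hr0 hV hfin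
  have hVe : MemLp (fun z => V z - e) (ENNReal.ofReal r) μ := hVr.sub (memLp_const e)
  have hVe0 : ∫ z, (V z - e) ∂μ = 0 := by
    rw [integral_sub (hVr.integrable (by simpa using hr)) (integrable_const _)]
    simp [he]
  have hnn : ∀ f : Z → B, 0 ≤ᵐ[μ] fun z => N (f z) ^ r := fun f =>
    .of_forall fun z => Real.rpow_nonneg (apply_nonneg N _) _
  have hcentred : ∫⁻ z, ENNReal.ofReal (N (V z - e) ^ r) ∂μ ≤
      ENNReal.ofReal ((2 * C) ^ r) * ∫⁻ z, ‖V z‖ₑ ^ r ∂μ :=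
    calc _ ≤ ENNReal.ofReal (C ^ r) * eLpNorm' (fun z => V z - e) r μ ^ r := by
          rw [← lintegral_rpow_enorm_eq_rpow_eLpNorm' hr0]
          exact lintegral_seminorm_rpow_le hr0.le hC.le hN _
      _ ≤ ENNReal.ofReal (C ^ r) * (2 * eLpNorm' V r μ) ^ r := by
          gcongr; exact eLpNorm'_sub_integral_le hr hV
      _ = ENNReal.ofReal ((2 * C) ^ r) * ∫⁻ z, ‖V z‖ₑ ^ r ∂μ := by
          rw [ENNReal.mul_rpow_of_nonneg _ _ hr0.le, ← lintegral_rpow_enorm_eq_rpow_eLpNorm' hr0,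
            ← mul_assoc, ← ENNReal.ofReal_ofNat 2, ENNReal.ofReal_rpow_of_nonneg zero_le_two hr0.le,
            ← ENNReal.ofReal_mul (by positivity), mul_comm (C ^ r),
            ← Real.mul_rpow zero_le_two hC.le]
  calc ∫⁻ z, ENNReal.ofReal (N (a + (V z - e)) ^ r) ∂μ
      = ENNReal.ofReal (∫ z, N (a + (V z - e)) ^ r ∂μ) :=
        (ofReal_integral_eq_lintegral_ofReal
          (integrable_seminorm_rpow hr0 hC.le hN ((memLp_const a).add hVe)) (hnn _)).symm
    _ ≤ ENNReal.ofReal (N a ^ r + K * ∫ z, N (V z - e) ^ r ∂μ) :=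
        ENNReal.ofReal_le_ofReal (integral_seminorm_add_centred_le hr hC.le hN hNK a hVe hVe0)
    _ = ENNReal.ofReal (N a ^ r) +
          ENNReal.ofReal K * ∫⁻ z, ENNReal.ofReal (N (V z - e) ^ r) ∂μ := by
        rw [ENNReal.ofReal_add (Real.rpow_nonneg (apply_nonneg N _) _)
          (mul_nonneg hK.le (integral_nonneg_of_ae (hnn _))), ENNReal.ofReal_mul hK.le,
          ofReal_integral_eq_lintegral_ofReal (integrable_seminorm_rpow hr0 hC.le hN hVe) (hnn _)]
    _ ≤ _ := by
        rw [ENNReal.ofReal_mul hK.le, mul_assoc]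
        gcongr

end Centred

end NormedSpace

/-! ### Martingale transforms of an i.i.d. sequence -/

/-- The law of an i.i.d. sequence with marginal `μ`. -/
noncomputable abbrev seqLaw {S : Type*} [MeasurableSpace S] (μ : Measure S) : Measure (ℕ → S) :=
  Measure.infinitePi fun _ => μ

section SeqLaw

variable {S : Type*} [MeasurableSpace S] (μ : Measure S) [IsProbabilityMeasure μ]

theorem measurePreserving_seq_comp {ι : Type*} [Fintype ι] {I : ι → ℕ}
    (hI : Function.Injective I) :
    MeasurePreserving (fun x : ℕ → S => fun i => x (I i)) (seqLaw μ)
      (Measure.pi fun _ : ι => μ) :=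
  ⟨by fun_prop, by rw [Measure.map_infinitePi_infinitePi_of_inj hI, Measure.infinitePi_eq_pi]⟩

theorem measurePreserving_update (n : ℕ) :
    MeasurePreserving (fun p : (ℕ → S) × S => Function.update p.1 n p.2)
      ((seqLaw μ).prod μ) (seqLaw μ) := by
  refine ⟨measurable_update', Measure.eq_infinitePi _ fun s t ht => ?_⟩
  rw [Measure.map_apply measurable_update' (MeasurableSet.pi s.countable_toSet fun i _ => ht i)]
  by_cases hn : n ∈ s
  · have hpre : ((fun p : (ℕ → S) × S => Function.update p.1 n p.2) ⁻¹' (Set.pi s t)) =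
        (Set.pi (s.erase n) t) ×ˢ (t n) := by
      ext ⟨x, z⟩
      simp only [Set.mem_preimage, Set.mem_pi, Finset.mem_coe, Set.mem_prod, Finset.mem_erase]
      refine ⟨fun h => ⟨fun i hi => ?_, ?_⟩, fun h i hi => ?_⟩
      · simpa only [Function.update_of_ne hi.1] using h i hi.2
      · simpa only [Function.update_self] using h n hn
      · rcases eq_or_ne i n with rfl | hin
        · simpa only [Function.update_self] using h.2
        · simpa only [Function.update_of_ne hin] using h.1 i ⟨hin, hi⟩
    rw [hpre, Measure.prod_prod, Measure.infinitePi_pi _ (fun i _ => ht i),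
      Finset.prod_erase_mul _ _ hn]
  · have hpre : ((fun p : (ℕ → S) × S => Function.update p.1 n p.2) ⁻¹' (Set.pi s t)) =
        (Set.pi s t) ×ˢ Set.univ := by
      ext ⟨x, z⟩
      simp only [Set.mem_preimage, Set.mem_pi, Finset.mem_coe, Set.mem_prod, Set.mem_univ, and_true]
      refine forall₂_congr fun i hi => ?_
      rw [Function.update_of_ne (ne_of_mem_of_not_mem hi hn)]
    rw [hpre, Measure.prod_prod, Measure.infinitePi_pi _ (fun i _ => ht i), measure_univ, mul_one]

theorem lintegral_resample (n : ℕ) {f : (ℕ → S) → ℝ≥0∞} (hf : Measurable f) :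
    ∫⁻ x, f x ∂(seqLaw μ) = ∫⁻ x, ∫⁻ z, f (Function.update x n z) ∂μ ∂(seqLaw μ) := by
  have h := measurePreserving_update μ n
  rw [← h.lintegral_comp hf, lintegral_prod (fun p => f (Function.update p.1 n p.2))
    (hf.comp h.measurable).aemeasurable]

end SeqLaw

section PredictableSum

variable {S B : Type*} [MeasurableSpace S] [MeasurableSpace B]

/-- The increments `V j` and the events `A j` are measurable and do not depend on the coordinates
of index at least `j`. -/
structure IsPredictable (V : ℕ → (ℕ → S) → S → B) (A : ℕ → Set (ℕ → S)) : Prop where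
  measurable : ∀ j, Measurable fun p : (ℕ → S) × S => V j p.1 p.2
  measurableSet : ∀ j, MeasurableSet (A j)
  update_eq : ∀ j n x w z, j ≤ n → V j (Function.update x n w) z = V j x z
  update_mem : ∀ j n x w, j ≤ n → (Function.update x n w ∈ A j ↔ x ∈ A j)

variable [NormedAddCommGroup B] [NormedSpace ℝ B] (μ : Measure S)

open scoped Classical in
/-- The sum of the centred increments `V j x (x j) - ∫ z, V j x z ∂μ` over the times `j < n` at
which the event `A j` holds. -/
noncomputable def predictableSum (V : ℕ → (ℕ → S) → S → B) (A : ℕ → Set (ℕ → S)) (n : ℕ)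
    (x : ℕ → S) : B :=
  ∑ j ∈ Finset.range n, if x ∈ A j then V j x (x j) - ∫ z, V j x z ∂μ else 0

variable (B) in
/-- `C` is a constant in the martingale type `r` inequality for predictable sums: their `r`-th
moments are at most `C` times the sum of the `r`-th moments of the increments. -/
def IsMartingaleTypeConst (r C : ℝ) : Prop :=
  ∀ (V : ℕ → (ℕ → S) → S → B) (A : ℕ → Set (ℕ → S)), IsPredictable V A →
    ∀ n, ∫⁻ x, ‖predictableSum μ V A n x‖ₑ ^ r ∂(seqLaw μ) ≤
      ENNReal.ofReal C * ∑ j ∈ Finset.range n,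
        ∫⁻ x, (A j).indicator (fun x => ∫⁻ z, ‖V j x z‖ₑ ^ r ∂μ) x ∂(seqLaw μ)

variable {μ} {V : ℕ → (ℕ → S) → S → B} {A : ℕ → Set (ℕ → S)}

open scoped Classical in
theorem IsPredictable.predictableSum_succ_update (h : IsPredictable V A) (n : ℕ) (x : ℕ → S)
    (z : S) :
    predictableSum μ V A (n + 1) (Function.update x n z) =
      predictableSum μ V A n x + if x ∈ A n then V n x z - ∫ w, V n x w ∂μ else 0 := by
  have hpast : predictableSum μ V A n (Function.update x n z) = predictableSum μ V A n x := by
    refine Finset.sum_congr rfl fun j hj => ?_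
    have hjn : j < n := Finset.mem_range.1 hj
    simp only [h.update_mem j n x z hjn.le, h.update_eq j n x z _ hjn.le,
      Function.update_of_ne hjn.ne]
  rw [predictableSum, Finset.sum_range_succ, ← predictableSum, hpast]
  simp only [h.update_mem n n x z le_rfl, h.update_eq n n x z _ le_rfl, Function.update_self]

variable [BorelSpace B] [TopologicalSpace.SeparableSpace B] [IsProbabilityMeasure μ]

theorem IsPredictable.measurable_predictableSum (h : IsPredictable V A) (n : ℕ) :
    Measurable (predictableSum μ V A n) := by
  classical
  refine Finset.measurable_sum _ fun j _ => Measurable.ite (h.measurableSet j) ?_ measurable_const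
  exact ((h.measurable j).comp (measurable_id.prodMk (measurable_pi_apply j))).sub
    (h.measurable j).stronglyMeasurable.integral_prod_right.measurable

variable [CompleteSpace B]

theorem IsPredictable.lintegral_seminorm_predictableSum_le (h : IsPredictable V A) {r C K : ℝ}
    (hr : 1 ≤ r) {N : Seminorm ℝ B} (hC : 0 < C) (hN : ∀ x, N x ≤ C * ‖x‖) (hK : 0 < K)
    (hNK : ∀ x y : B, N (x + y) ^ r + N (x - y) ^ r ≤ 2 * N x ^ r + K * N y ^ r) (n : ℕ) :
    ∫⁻ x, ENNReal.ofReal (N (predictableSum μ V A n x) ^ r) ∂(seqLaw μ) ≤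
      ENNReal.ofReal (K * (2 * C) ^ r) * ∑ j ∈ Finset.range n,
        ∫⁻ x, (A j).indicator (fun x => ∫⁻ z, ‖V j x z‖ₑ ^ r ∂μ) x ∂(seqLaw μ) := by
  classical
  have hmeas : ∀ n, Measurable fun x => ENNReal.ofReal (N (predictableSum μ V A n x) ^ r) :=
    fun n => (((continuous_of_le_mul_norm hN).measurable.comp
      (h.measurable_predictableSum n)).pow_const r).ennreal_ofReal
  induction n with
  | zero => simp [predictableSum, Real.zero_rpow (by linarith : r ≠ 0)]
  | succ n ih =>
    have hstep : ∀ x, ∫⁻ z, ENNReal.ofReal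
          (N (predictableSum μ V A (n + 1) (Function.update x n z)) ^ r) ∂μ ≤
        ENNReal.ofReal (N (predictableSum μ V A n x) ^ r) + ENNReal.ofReal (K * (2 * C) ^ r) *
          (A n).indicator (fun x => ∫⁻ z, ‖V n x z‖ₑ ^ r ∂μ) x := fun x => by
      simp only [h.predictableSum_succ_update]
      by_cases hx : x ∈ A n
      · simp only [hx, if_true, Set.indicator_of_mem]
        exact lintegral_seminorm_add_centred_le hr hC hN hK hNK _
          ((h.measurable n).comp measurable_prodMk_left).aestronglyMeasurable
      · simp [hx]
    have hind : Measurable ((A n).indicator fun x => ∫⁻ z, ‖V n x z‖ₑ ^ r ∂μ) :=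
      (((h.measurable n).enorm.pow_const r).lintegral_prod_right').indicator (h.measurableSet n)
    rw [lintegral_resample μ n (hmeas (n + 1)), Finset.sum_range_succ, mul_add]
    refine (lintegral_mono hstep).trans ?_
    rw [lintegral_add_left (hmeas n), lintegral_const_mul _ hind]
    gcongr

variable (μ) in
theorem IsSmoothSpace.exists_isMartingaleTypeConst {r : ℝ} (hB : IsSmoothSpace B r) :
    ∃ C : ℝ, 0 < C ∧ IsMartingaleTypeConst B μ r C := by
  have hr : 1 ≤ r := hB.1.le
  obtain ⟨N, ⟨c, C, hc, hC, hN⟩, K, hK, hNK⟩ := hB.exists_seminorm_two_point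
  refine ⟨c⁻¹ ^ r * (K * (2 * C) ^ r), by positivity, fun V A h n => ?_⟩
  have hr0 : 0 ≤ r := by linarith
  have hnorm (v : B) : ‖v‖ₑ ^ r ≤ ENNReal.ofReal (c⁻¹ ^ r) * ENNReal.ofReal (N v ^ r) := by
    rw [← ENNReal.ofReal_mul (by positivity), ← Real.mul_rpow (by positivity)
      (apply_nonneg N _), ← ofReal_norm, ENNReal.ofReal_rpow_of_nonneg (norm_nonneg _) hr0]
    refine ENNReal.ofReal_le_ofReal (Real.rpow_le_rpow (norm_nonneg _) ?_ hr0)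
    exact (le_inv_mul_iff₀ hc).2 (hN v).1
  refine (lintegral_mono fun x => hnorm _).trans ?_
  rw [lintegral_const_mul' _ _ ENNReal.ofReal_ne_top, ENNReal.ofReal_mul (by positivity), mul_assoc]
  gcongr
  exact h.lintegral_seminorm_predictableSum_le hr hC (fun x => (hN x).2) hK hNK n

end PredictableSum

/-! ### Kernels and their sums -/

section VecCons

open Matrix (vecCons)

variable {S : Type*} [MeasurableSpace S] {k : ℕ}

theorem measurable_vecCons : Measurable fun p : S × (Fin k → S) => vecCons p.1 p.2 := by
  rw [measurable_pi_iff]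
  refine Fin.cases ?_ fun i => ?_
  · simpa only [Matrix.cons_val_zero] using measurable_fst
  · simp only [Matrix.cons_val_succ]
    fun_prop

@[fun_prop]
theorem measurable_vecCons_comp {X : Type*} [MeasurableSpace X] {f : X → S} {h : X → Fin k → S}
    (hf : Measurable f) (hh : Measurable h) : Measurable fun a => vecCons (f a) (h a) :=
  measurable_vecCons.comp (hf.prodMk hh)

/-- The law of `k` independent variables with marginal `μ`. -/
noncomputable abbrev vecLaw (μ : Measure S) (k : ℕ) : Measure (Fin k → S) :=
  Measure.pi fun _ : Fin k => μ

variable (μ : Measure S)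

theorem measurePreserving_vecCons [SigmaFinite μ] :
    MeasurePreserving (fun p : S × (Fin k → S) => vecCons p.1 p.2) (μ.prod (vecLaw μ k))
      (vecLaw μ (k + 1)) := by
  convert (measurePreserving_piFinSuccAbove (fun _ : Fin (k + 1) => μ) 0).symm using 1
  ext p i
  refine Fin.cases ?_ (fun i => ?_) i <;> simp

theorem lintegral_vecLaw_succ [SigmaFinite μ] {f : (Fin (k + 1) → S) → ℝ≥0∞} (hf : Measurable f) :
    ∫⁻ v, f v ∂(vecLaw μ (k + 1)) = ∫⁻ z, ∫⁻ v, f (vecCons z v) ∂(vecLaw μ k) ∂μ := by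
  rw [← (measurePreserving_vecCons μ).lintegral_comp hf,
    lintegral_prod (fun p : S × (Fin k → S) => f (vecCons p.1 p.2)) (by fun_prop)]

theorem lintegral_vecLaw_zero (f : (Fin 0 → S) → ℝ≥0∞) : ∫⁻ v, f v ∂(vecLaw μ 0) = f ![] := by
  rw [vecLaw, Measure.pi_of_empty _ ![], lintegral_dirac]

end VecCons

section KernelSum

open Matrix (vecCons)

variable {S B : Type*} [AddCommMonoid B] {k : ℕ}

open scoped Classical in
/-- Strictly decreasing `k`-tuples of elements of `{0, …, n - 1}`. The largest index comes first,
so that the terms of a kernel sum are grouped by the head of the tuple. -/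
noncomputable def decIndices (k n : ℕ) : Finset (Fin k → ℕ) :=
  (Fintype.piFinset fun _ => Finset.range n).filter StrictAnti

theorem mem_decIndices {n : ℕ} {I : Fin k → ℕ} :
    I ∈ decIndices k n ↔ (∀ i, I i < n) ∧ StrictAnti I := by
  simp [decIndices]

/-- The sum of a kernel over all decreasing tuples of indices less than `n`; for a symmetric kernel
this is the unnormalized `U`-statistic. -/
noncomputable def kernelSum (g : (Fin k → S) → B) (n : ℕ) (x : ℕ → S) : B :=
  ∑ I ∈ decIndices k n, g fun l => x (I l)

theorem kernelSum_order_zero (g : (Fin 0 → S) → B) (n : ℕ) (x : ℕ → S) :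
    kernelSum g n x = g ![] := by
  have hsingle : decIndices 0 n = {![]} := by
    ext I
    simp [mem_decIndices, Subsingleton.elim I ![], Subsingleton.strictAnti]
  rw [kernelSum, hsingle, Finset.sum_singleton]
  exact congrArg g (Subsingleton.elim _ _)

theorem strictAnti_vecCons_of_lt {j : ℕ} {I : Fin k → ℕ} (hI : StrictAnti I)
    (hj : ∀ i, I i < j) : StrictAnti (vecCons j I) := by
  intro a b hab
  induction b using Fin.cases with
  | zero => exact absurd hab (Fin.not_lt_zero a)
  | succ b =>
    induction a using Fin.cases with
    | zero => exact hj b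
    | succ a => exact hI (Fin.succ_lt_succ_iff.1 hab)

theorem kernelSum_eq_sum_head (g : (Fin (k + 1) → S) → B) (n : ℕ) (x : ℕ → S) :
    kernelSum g n x = ∑ j ∈ Finset.range n, kernelSum (fun v => g (vecCons (x j) v)) j x := by
  simp only [kernelSum]
  rw [Finset.sum_sigma']
  refine Finset.sum_bij' (fun I _ => ⟨Matrix.vecHead I, Matrix.vecTail I⟩)
    (fun p _ => vecCons p.1 p.2) ?_ ?_ ?_ ?_ ?_
  · intro I hI
    rw [mem_decIndices] at hI
    simp only [Finset.mem_sigma, Finset.mem_range, mem_decIndices]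
    exact ⟨hI.1 0, fun i => hI.2 (Fin.succ_pos i), fun a b hab => hI.2 (Fin.succ_lt_succ_iff.2 hab)⟩
  · rintro ⟨j, I⟩ hI
    simp only [Finset.mem_sigma, Finset.mem_range, mem_decIndices] at hI
    exact mem_decIndices.2 ⟨Fin.cases hI.1 fun i => (hI.2.1 i).trans hI.1,
      strictAnti_vecCons_of_lt hI.2.2 hI.2.1⟩
  · exact fun I _ => Matrix.cons_head_tail I
  · exact fun _ _ => rfl
  · intro I _
    congr 1
    ext i
    refine Fin.cases rfl (fun i => rfl) i

theorem kernelSum_zero (g : (Fin (k + 1) → S) → B) (x : ℕ → S) : kernelSum g 0 x = 0 := by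
  rw [kernelSum_eq_sum_head, Finset.range_zero, Finset.sum_empty]

theorem kernelSum_succ (g : (Fin (k + 1) → S) → B) (n : ℕ) (x : ℕ → S) :
    kernelSum g (n + 1) x = kernelSum g n x + kernelSum (fun v => g (vecCons (x n) v)) n x := by
  rw [kernelSum_eq_sum_head, kernelSum_eq_sum_head, Finset.sum_range_succ]

theorem kernelSum_update (g : (Fin k → S) → B) {j n : ℕ} (hjn : j ≤ n) (x : ℕ → S) (w : S) :
    kernelSum g j (Function.update x n w) = kernelSum g j x := by
  refine Finset.sum_congr rfl fun I hI => congrArg g (funext fun l => ?_)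
  exact Function.update_of_ne (((mem_decIndices.1 hI).1 l).trans_le hjn).ne _ _

end KernelSum

section KernelSumMeasure

variable {S : Type*} [MeasurableSpace S] {k : ℕ}

@[fun_prop]
theorem measurable_kernelSum {B E : Type*} [AddCommMonoid B] [MeasurableSpace B] [MeasurableAdd₂ B]
    [MeasurableSpace E] {g : E → (Fin k → S) → B} {e : E → ℕ → S}
    (hg : Measurable fun p : E × (Fin k → S) => g p.1 p.2) (he : Measurable e) (n : ℕ) :
    Measurable fun p : E => kernelSum (g p) n (e p) := by
  unfold kernelSum
  refine Finset.measurable_sum _ fun I _ => ?_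
  have hpair : Measurable fun p : E => (p, fun l => e p (I l)) := by fun_prop
  exact hg.comp hpair

theorem ae_forall_decIndices (μ : Measure S) [IsProbabilityMeasure μ] {F : Type*}
    [MeasurableSpace F] {φ : Measure F} [SFinite φ] {Q : F × (Fin k → S) → Prop}
    (hQ : ∀ᵐ p ∂(φ.prod (vecLaw μ k)), Q p) :
    ∀ᵐ p ∂(φ.prod (seqLaw μ)), ∀ n, ∀ I ∈ decIndices k n, Q (p.1, fun l => p.2 (I l)) := by
  have hanti : ∀ᵐ p ∂(φ.prod (seqLaw μ)), ∀ I : Fin k → ℕ, StrictAnti I →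
      Q (p.1, fun l => p.2 (I l)) := by
    refine ae_all_iff.2 fun I => ?_
    by_cases hI : StrictAnti I
    · have hmp := (MeasurePreserving.id φ).prod (measurePreserving_seq_comp μ hI.injective)
      filter_upwards [hmp.quasiMeasurePreserving.ae hQ] with p hp _
      exact hp
    · exact .of_forall fun p h => absurd h hI
  filter_upwards [hanti] with p hp n I hI
  exact hp I (mem_decIndices.1 hI).2

end KernelSumMeasure

section Kernels

open Matrix (vecCons)

variable {S B F Y : Type*} {k : ℕ}

/-- Move the first variable of a kernel to the parameter space. -/
def freezeFirst (g : F × Y × (Fin (k + 1) → S) → B) : (F × S) × Y × (Fin k → S) → B :=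
  fun p => g (p.1.1, p.2.1, vecCons p.1.2 p.2.2)

/-- Move the first variable of a kernel to the space over which the `L^r` norm is taken. -/
def normFirst (g : F × Y × (Fin (k + 1) → S) → B) : F × (Y × S) × (Fin k → S) → B :=
  fun p => g (p.1, p.2.1.1, vecCons p.2.1.2 p.2.2)

variable [MeasurableSpace S] [MeasurableSpace F] [MeasurableSpace Y]

/-- Integrate the first variable of a kernel with respect to its law. -/
noncomputable def averageFirst [NormedAddCommGroup B] [NormedSpace ℝ B] (μ : Measure S)
    (g : F × Y × (Fin (k + 1) → S) → B) : F × Y × (Fin k → S) → B :=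
  fun p => ∫ z, g (p.1, p.2.1, vecCons z p.2.2) ∂μ

/-- The joint law of the parameters of a kernel, of the variables over which the `L^r` norm is
taken, and of the `k` variables of its kernel sum. -/
noncomputable abbrev jointLaw (μ : Measure S) (φ : Measure F) (ν : Measure Y) (k : ℕ) :
    Measure (F × Y × (Fin k → S)) :=
  φ.prod (ν.prod (vecLaw μ k))

variable (μ : Measure S) [SigmaFinite μ] (φ : Measure F) (ν : Measure Y) [SFinite ν]

theorem lintegral_jointLaw {f : F × Y × (Fin k → S) → ℝ≥0∞} (hf : Measurable f) :
    ∫⁻ p, f p ∂(jointLaw μ φ ν k) = ∫⁻ a, ∫⁻ y, ∫⁻ v, f (a, y, v) ∂(vecLaw μ k) ∂ν ∂φ := by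
  rw [lintegral_prod _ hf.aemeasurable]
  refine lintegral_congr fun a => ?_
  rw [lintegral_prod _ (by fun_prop)]

theorem lintegral_jointLaw_succ {f : F × Y × (Fin (k + 1) → S) → ℝ≥0∞} (hf : Measurable f) :
    ∫⁻ p, f p ∂(jointLaw μ φ ν (k + 1)) =
      ∫⁻ a, ∫⁻ y, ∫⁻ z, ∫⁻ v, f (a, y, vecCons z v) ∂(vecLaw μ k) ∂μ ∂ν ∂φ := by
  rw [lintegral_jointLaw μ φ ν hf]
  refine lintegral_congr fun a => lintegral_congr fun y => ?_
  rw [lintegral_vecLaw_succ μ (by fun_prop)]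

theorem measurePreserving_of_lintegral {X Z : Type*} [MeasurableSpace X] [MeasurableSpace Z]
    {P : Measure X} {Q : Measure Z} {T : X → Z} (hT : Measurable T)
    (h : ∀ f : Z → ℝ≥0∞, Measurable f → ∫⁻ a, f (T a) ∂P = ∫⁻ b, f b ∂Q) :
    MeasurePreserving T P Q :=
  ⟨hT, Measure.ext_of_lintegral _ fun f hf => by rw [lintegral_map hf hT, h f hf]⟩

theorem measurePreserving_freezeFirst :
    MeasurePreserving (fun p : (F × S) × Y × (Fin k → S) => (p.1.1, p.2.1, vecCons p.1.2 p.2.2))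
      (jointLaw μ (φ.prod μ) ν k) (jointLaw μ φ ν (k + 1)) := by
  refine measurePreserving_of_lintegral (by fun_prop) fun f hf => ?_
  rw [lintegral_jointLaw_succ μ φ ν hf,
    lintegral_jointLaw μ (φ.prod μ) ν (f := fun p => f (p.1.1, p.2.1, vecCons p.1.2 p.2.2))
      (by fun_prop),
    lintegral_prod _ (Measurable.aemeasurable (by fun_prop))]
  refine lintegral_congr fun a => ?_
  rw [lintegral_lintegral_swap (Measurable.aemeasurable (by fun_prop))]

theorem measurePreserving_normFirst :
    MeasurePreserving (fun p : F × (Y × S) × (Fin k → S) => (p.1, p.2.1.1, vecCons p.2.1.2 p.2.2))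
      (jointLaw μ φ (ν.prod μ) k) (jointLaw μ φ ν (k + 1)) := by
  refine measurePreserving_of_lintegral (by fun_prop) fun f hf => ?_
  rw [lintegral_jointLaw_succ μ φ ν hf,
    lintegral_jointLaw μ φ (ν.prod μ) (f := fun p => f (p.1, p.2.1.1, vecCons p.2.1.2 p.2.2))
      (by fun_prop)]
  refine lintegral_congr fun a => ?_
  rw [lintegral_prod _ (Measurable.aemeasurable (by fun_prop))]

theorem measurePreserving_averageFirst :
    MeasurePreserving (fun p : (F × Y × (Fin k → S)) × S => (p.1.1, p.1.2.1, vecCons p.2 p.1.2.2))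
      ((jointLaw μ φ ν k).prod μ) (jointLaw μ φ ν (k + 1)) := by
  refine measurePreserving_of_lintegral (by fun_prop) fun f hf => ?_
  rw [lintegral_jointLaw_succ μ φ ν hf, lintegral_prod _ (Measurable.aemeasurable (by fun_prop)),
    lintegral_jointLaw μ φ ν (f := fun a => ∫⁻ b, f (a.1, a.2.1, vecCons b a.2.2) ∂μ)
      (by fun_prop)]
  refine lintegral_congr fun a => lintegral_congr fun y => ?_
  rw [lintegral_lintegral_swap (Measurable.aemeasurable (by fun_prop))]

theorem measurePreserving_fiber :
    MeasurePreserving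
      (fun p : ((F × (Fin k → S)) × Y) × S => (p.1.1.1, p.1.2, vecCons p.2 p.1.1.2))
      (((φ.prod (vecLaw μ k)).prod ν).prod μ) (jointLaw μ φ ν (k + 1)) := by
  refine measurePreserving_of_lintegral (by fun_prop) fun f hf => ?_
  rw [lintegral_jointLaw_succ μ φ ν hf, lintegral_prod _ (Measurable.aemeasurable (by fun_prop)),
    lintegral_prod _ (Measurable.aemeasurable (by fun_prop)),
    lintegral_prod _ (Measurable.aemeasurable (by fun_prop))]
  refine lintegral_congr fun a => ?_
  rw [lintegral_lintegral_swap (Measurable.aemeasurable (by fun_prop))]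
  refine lintegral_congr fun y => ?_
  rw [lintegral_lintegral_swap (Measurable.aemeasurable (by fun_prop))]

variable {μ φ ν} [NormedAddCommGroup B] {g : F × Y × (Fin (k + 1) → S) → B}

theorem integrable_freezeFirst (hg : Integrable g (jointLaw μ φ ν (k + 1))) :
    Integrable (freezeFirst g) (jointLaw μ (φ.prod μ) ν k) :=
  (measurePreserving_freezeFirst μ φ ν).integrable_comp_of_integrable hg

theorem integrable_normFirst (hg : Integrable g (jointLaw μ φ ν (k + 1))) :
    Integrable (normFirst g) (jointLaw μ φ (ν.prod μ) k) :=
  (measurePreserving_normFirst μ φ ν).integrable_comp_of_integrable hg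

variable [NormedSpace ℝ B]

theorem integrable_averageFirst (hg : Integrable g (jointLaw μ φ ν (k + 1))) :
    Integrable (averageFirst μ g) (jointLaw μ φ ν k) :=
  ((measurePreserving_averageFirst μ φ ν).integrable_comp_of_integrable hg).integral_prod_left

theorem ae_kernelSum_integral {μ : Measure S} [IsProbabilityMeasure μ] [SFinite φ]
    (hg : Integrable g (jointLaw μ φ ν (k + 1))) :
    ∀ᵐ p ∂(φ.prod (seqLaw μ)), ∀ n, ∀ᵐ y ∂ν,
      ∫ z, kernelSum (fun v => g (p.1, y, vecCons z v)) n p.2 ∂μ =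
        kernelSum (fun v => averageFirst μ g (p.1, y, v)) n p.2 := by
  have hfiber := ((measurePreserving_fiber μ φ ν).integrable_comp_of_integrable hg).prod_right_ae
  filter_upwards [ae_forall_decIndices μ (Measure.ae_ae_of_ae_prod hfiber)] with p hp n
  have hint : ∀ᵐ y ∂ν, ∀ I ∈ decIndices k n,
      Integrable (fun z => g (p.1, y, vecCons z fun l => p.2 (I l))) μ :=
    (Finset.eventually_all _).2 fun I hI => hp n I hI
  filter_upwards [hint] with y hy
  simp only [kernelSum, averageFirst]
  rw [integral_finsetSum _ hy]

end Kernels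

section KernelMeasurability

open Matrix (vecCons)

variable {S B F Y : Type*} [MeasurableSpace S] [MeasurableSpace F] [MeasurableSpace Y]
  [MeasurableSpace B] {k : ℕ} {g : F × Y × (Fin (k + 1) → S) → B}

theorem measurable_freezeFirst (hg : Measurable g) : Measurable (freezeFirst g) := by
  unfold freezeFirst
  fun_prop

theorem measurable_normFirst (hg : Measurable g) : Measurable (normFirst g) := by
  unfold normFirst
  fun_prop

theorem measurable_averageFirst [NormedAddCommGroup B] [NormedSpace ℝ B] [BorelSpace B]
    [TopologicalSpace.SeparableSpace B] (μ : Measure S) [SFinite μ] (hg : Measurable g) :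
    Measurable (averageFirst μ g) := by
  have hcons : Measurable fun p : (F × Y × (Fin k → S)) × S =>
      g (p.1.1, p.1.2.1, vecCons p.2 p.1.2.2) := by fun_prop
  exact hcons.stronglyMeasurable.integral_prod_right.measurable

end KernelMeasurability

/-! ### The good-`λ` inequality -/

section Passage

/-- At time `j` the sequence `f` has exceeded the level `a`, but not yet the level `b`. -/
def IsBetweenPassages (f : ℕ → ℝ≥0∞) (a b : ℝ≥0∞) (j : ℕ) : Prop :=
  (∃ n ≤ j, a < f n) ∧ ∀ n ≤ j, f n ≤ b

theorem exists_isBetweenPassages_iff_mem_Ico {f : ℕ → ℝ≥0∞} {a b : ℝ≥0∞} {N : ℕ} (hab : a ≤ b)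
    (h0 : f 0 ≤ a) (hN : ∃ n ≤ N, b < f n) :
    ∃ s t, s < t ∧ t ≤ N ∧ f s ≤ a ∧ b < f t ∧
      ∀ j, IsBetweenPassages f a b j ↔ j ∈ Finset.Ico (s + 1) t := by
  classical
  obtain ⟨n, hnN, hn⟩ := hN
  have hexb : ∃ n, b < f n := ⟨n, hn⟩
  have hexa : ∃ n, a < f n := ⟨n, hab.trans_lt hn⟩
  obtain ⟨s, hs⟩ := Nat.exists_eq_succ_of_ne_zero fun h : Nat.find hexa = 0 =>
    h0.not_gt (h ▸ Nat.find_spec hexa)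
  refine ⟨s, Nat.find hexb, ?_, (Nat.find_min' hexb hn).trans hnN, ?_, Nat.find_spec hexb,
    fun j => ?_⟩
  · exact Nat.succ_le_iff.1 (hs ▸ Nat.find_min' hexa (hab.trans_lt (Nat.find_spec hexb)))
  · exact not_lt.1 (Nat.find_min hexa (hs ▸ Nat.lt_succ_self s))
  · rw [Finset.mem_Ico, ← Nat.succ_eq_add_one, ← hs, Nat.find_le_iff, Nat.lt_find_iff]
    simp only [IsBetweenPassages, not_lt]

variable {Y B : Type*} [MeasurableSpace Y] {ν : Measure Y} [NormedAddCommGroup B]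

theorem eLpNorm'_sum_le_of_card_le {r : ℝ} (hr : 1 ≤ r) {m : ℕ → Y → B}
    (hm : ∀ n, AEStronglyMeasurable (m n) ν) {s : Finset ℕ} {N : ℕ} (hN : 0 < N)
    (hs : s.card ≤ N) {c : ℝ} (hle : ∀ j ∈ s, eLpNorm' (m j) r ν ≤ ENNReal.ofReal (c / N)) :
    eLpNorm' (∑ j ∈ s, m j) r ν ≤ ENNReal.ofReal c := by
  have hN' : (0 : ℝ) < N := by exact_mod_cast hN
  calc eLpNorm' (∑ j ∈ s, m j) r ν ≤ ∑ j ∈ s, eLpNorm' (m j) r ν :=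
        eLpNorm'_sum_le (fun j _ => hm j) hr
    _ ≤ s.card * ENNReal.ofReal (c / N) := by
        simpa only [nsmul_eq_mul] using Finset.sum_le_card_nsmul s _ _ hle
    _ ≤ N * ENNReal.ofReal (c / N) := by gcongr
    _ = ENNReal.ofReal c := by
        rw [← ENNReal.ofReal_natCast, ← ENNReal.ofReal_mul hN'.le, mul_div_cancel₀ _ hN'.ne']

theorem eq_add_sum_Ico_sub_add_sum_Ico {E : Type*} [AddCommGroup E] {u V : ℕ → E}
    (hu : ∀ n, u (n + 1) = u n + V n) (m : ℕ → E) {s t : ℕ} (hst : s < t) :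
    u t = u s + V s +
      (∑ j ∈ Finset.Ico (s + 1) t, (V j - m j) + ∑ j ∈ Finset.Ico (s + 1) t, m j) := by
  have htele := Finset.sum_Ico_sub u (Nat.succ_le_iff.2 hst)
  simp only [hu, add_sub_cancel_left] at htele
  rw [← Finset.sum_add_distrib]
  simp only [sub_add_cancel]
  rw [htele, add_sub_cancel]

open scoped Classical in
/-- Between the passages of the levels `l` and `2 * l` a path gains almost `l`, and neither the
increment that crosses `l` nor the accumulated drift contributes more than `δ * l`. -/
theorem le_eLpNorm'_sum_of_passage {r : ℝ} (hr : 1 ≤ r) {u V m : ℕ → Y → B}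
    (hum : ∀ n, AEStronglyMeasurable (u n) ν) (hVm : ∀ n, AEStronglyMeasurable (V n) ν)
    (hmm : ∀ n, AEStronglyMeasurable (m n) ν) (hu0 : u 0 = 0) (hu : ∀ n, u (n + 1) = u n + V n)
    {N : ℕ} {l δ : ℝ} (hl : 0 < l) (hδ : 0 < δ) (hδ4 : δ ≤ 1 / 4)
    (hN : ∃ n ≤ N, ENNReal.ofReal (2 * l) < eLpNorm' (u n) r ν)
    (hV : ∀ j < N, eLpNorm' (V j) r ν ≤ ENNReal.ofReal (δ * l))
    (hm : ∀ j < N, eLpNorm' (m j) r ν ≤ ENNReal.ofReal (δ * l / N)) :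
    ENNReal.ofReal (l / 2) ≤ eLpNorm' (fun y => ∑ j ∈ Finset.range N,
      if IsBetweenPassages (fun n => eLpNorm' (u n) r ν) (ENNReal.ofReal l) (ENNReal.ofReal (2 * l))
        j then V j y - m j y else 0) r ν := by
  obtain ⟨s, t, hst, htN, hs, ht, hIco⟩ := exists_isBetweenPassages_iff_mem_Ico
    (ENNReal.ofReal_le_ofReal (by linarith : l ≤ 2 * l))
    (by simp [hu0, eLpNorm'_zero (by linarith : 0 < r)]) hN
  have hsum : (fun y => ∑ j ∈ Finset.range N, if IsBetweenPassages (fun n => eLpNorm' (u n) r ν)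
      (ENNReal.ofReal l) (ENNReal.ofReal (2 * l)) j then V j y - m j y else 0) =
        ∑ j ∈ Finset.Ico (s + 1) t, (V j - m j) := by
    have hsub : Finset.Ico (s + 1) t ⊆ Finset.range N := fun j hj =>
      Finset.mem_range.2 ((Finset.mem_Ico.1 hj).2.trans_le htN)
    ext y
    simp only [hIco, Finset.sum_apply, Pi.sub_apply]
    rw [Finset.sum_ite_mem, Finset.inter_eq_right.2 hsub]
  rw [hsum]
  set T := ∑ j ∈ Finset.Ico (s + 1) t, (V j - m j)
  set M := ∑ j ∈ Finset.Ico (s + 1) t, m j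
  have hTm : AEStronglyMeasurable T ν :=
    Finset.aestronglyMeasurable_sum _ fun j _ => (hVm j).sub (hmm j)
  have hMm : AEStronglyMeasurable M ν := Finset.aestronglyMeasurable_sum _ fun j _ => hmm j
  have hM : eLpNorm' M r ν ≤ ENNReal.ofReal (δ * l) :=
    eLpNorm'_sum_le_of_card_le hr hmm (by omega) (by rw [Nat.card_Ico]; omega) fun j hj =>
      hm j ((Finset.mem_Ico.1 hj).2.trans_le htN)
  have hgain : u t = u s + V s + (T + M) := eq_add_sum_Ico_sub_add_sum_Ico hu m hst
  by_contra! hT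
  refine ht.not_ge ?_
  calc eLpNorm' (u t) r ν
      ≤ eLpNorm' (u s + V s) r ν + eLpNorm' (T + M) r ν := by
        rw [hgain]
        exact eLpNorm'_add_le ((hum s).add (hVm s)) (hTm.add hMm) hr
    _ ≤ (ENNReal.ofReal l + ENNReal.ofReal (δ * l)) +
          (ENNReal.ofReal (l / 2) + ENNReal.ofReal (δ * l)) :=
        add_le_add ((eLpNorm'_add_le (hum s) (hVm s) hr).trans
          (add_le_add hs (hV s (hst.trans_le htN))))
          ((eLpNorm'_add_le hTm hMm hr).trans (add_le_add hT.le hM))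
    _ ≤ ENNReal.ofReal (2 * l) := by
        rw [← ENNReal.ofReal_add (by positivity) (by positivity),
          ← ENNReal.ofReal_add (by positivity) (by positivity),
          ← ENNReal.ofReal_add (by positivity) (by positivity)]
        exact ENNReal.ofReal_le_ofReal (by nlinarith)

end Passage

section MaxTail

variable {S B F Y : Type*} [MeasurableSpace Y] [NormedAddCommGroup B] {k : ℕ}

/-- The `L^r(ν)` norm of the kernel sum of order `k` over the first `n` terms of a sequence, for a
kernel depending on a parameter in `F`. -/
noncomputable def uNorm (r : ℝ) (ν : Measure Y) (g : F × Y × (Fin k → S) → B) (n : ℕ)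
    (p : F × (ℕ → S)) : ℝ≥0∞ :=
  eLpNorm' (fun y => kernelSum (fun v => g (p.1, y, v)) n p.2) r ν

theorem uNorm_update (r : ℝ) (ν : Measure Y) (g : F × Y × (Fin k → S) → B) {j n : ℕ} (hjn : j ≤ n)
    (a : F) (x : ℕ → S) (w : S) :
    uNorm r ν g j (a, Function.update x n w) = uNorm r ν g j (a, x) := by
  simp only [uNorm, kernelSum_update _ hjn]

variable [MeasurableSpace S] [MeasurableSpace F]

/-- The probability that one of the norms `uNorm r ν g n`, `n ≤ N`, exceeds `t`. -/
noncomputable def maxTail (r : ℝ) (μ : Measure S) (φ : Measure F) (ν : Measure Y)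
    (g : F × Y × (Fin k → S) → B) (N : ℕ) (t : ℝ) : ℝ≥0∞ :=
  (φ.prod (seqLaw μ)) {p | ∃ n ≤ N, ENNReal.ofReal t < uNorm r ν g n p}

variable [MeasurableSpace B] [BorelSpace B]

theorem measurable_eLpNorm' {X : Type*} [MeasurableSpace X] (r : ℝ) (ν : Measure Y) [SFinite ν]
    {f : X → Y → B} (hf : Measurable fun p : X × Y => f p.1 p.2) :
    Measurable fun a => eLpNorm' (f a) r ν :=
  ((hf.enorm.pow_const r).lintegral_prod_right').pow_const _

variable [TopologicalSpace.SeparableSpace B]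

theorem measurable_uNorm (r : ℝ) (ν : Measure Y) [SFinite ν] {g : F × Y × (Fin k → S) → B}
    (hg : Measurable g) (n : ℕ) : Measurable (uNorm r ν g n) := by
  refine measurable_eLpNorm' r ν (f := fun (p : F × (ℕ → S)) y =>
    kernelSum (fun v => g (p.1, y, v)) n p.2) ?_
  exact measurable_kernelSum (E := (F × (ℕ → S)) × Y) (g := fun p v => g (p.1.1, p.2, v))
    (e := fun p => p.1.2) (by fun_prop) (by fun_prop) n

theorem measurableSet_lt_uNorm (r : ℝ) (ν : Measure Y) [SFinite ν] {g : F × Y × (Fin k → S) → B}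
    (hg : Measurable g) (n : ℕ) (t : ℝ) :
    MeasurableSet {p : F × (ℕ → S) | ENNReal.ofReal t < uNorm r ν g n p} :=
  measurableSet_lt measurable_const (measurable_uNorm r ν hg n)

theorem measurableSet_exists_lt_uNorm (r : ℝ) (ν : Measure Y) [SFinite ν]
    {g : F × Y × (Fin k → S) → B} (hg : Measurable g) (N : ℕ) (t : ℝ) :
    MeasurableSet {p : F × (ℕ → S) | ∃ n ≤ N, ENNReal.ofReal t < uNorm r ν g n p} := by
  have hunion : {p : F × (ℕ → S) | ∃ n ≤ N, ENNReal.ofReal t < uNorm r ν g n p} =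
      ⋃ n ∈ Set.Iic N, {p | ENNReal.ofReal t < uNorm r ν g n p} := by
    ext p
    simp
  rw [hunion]
  exact .biUnion (Set.to_countable _) fun n _ => measurableSet_lt_uNorm r ν hg n t

variable {μ : Measure S} [IsProbabilityMeasure μ] {φ : Measure F} {ν : Measure Y} [SFinite ν]

theorem measurePreserving_swap_parameter [SFinite φ] :
    MeasurePreserving (fun p : F × ((ℕ → S) × S) => ((p.1, p.2.2), p.2.1))
      (φ.prod ((seqLaw μ).prod μ)) ((φ.prod μ).prod (seqLaw μ)) :=
  (measurePreserving_prodAssoc φ μ (seqLaw μ)).symm.comp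
    ((MeasurePreserving.id φ).prod Measure.measurePreserving_swap)

theorem measure_lt_uNorm_freezeFirst_le [SFinite φ] (r : ℝ) {g : F × Y × (Fin (k + 1) → S) → B}
    (hg : Measurable g) {j N : ℕ} (hj : j ≤ N) (t : ℝ) :
    (φ.prod (seqLaw μ)) {p | ENNReal.ofReal t < uNorm r ν (freezeFirst g) j ((p.1, p.2 j), p.2)} ≤
      maxTail r μ (φ.prod μ) ν (freezeFirst g) N t := by
  have hmeas := measurableSet_lt_uNorm r ν (measurable_freezeFirst hg) j t
  have hinsert : Measurable fun p : F × (ℕ → S) => ((p.1, p.2 j), p.2) := by fun_prop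
  have hset : MeasurableSet {p : F × (ℕ → S) |
      ENNReal.ofReal t < uNorm r ν (freezeFirst g) j ((p.1, p.2 j), p.2)} := hinsert hmeas
  have hresample := (MeasurePreserving.id φ).prod (measurePreserving_update μ j)
  have hpre : Prod.map id (fun p : (ℕ → S) × S => Function.update p.1 j p.2) ⁻¹'
        {p : F × (ℕ → S) | ENNReal.ofReal t < uNorm r ν (freezeFirst g) j ((p.1, p.2 j), p.2)} =
      (fun p : F × ((ℕ → S) × S) => ((p.1, p.2.2), p.2.1)) ⁻¹'
        {q | ENNReal.ofReal t < uNorm r ν (freezeFirst g) j q} := by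
    ext ⟨a, x, z⟩
    simp [uNorm_update r ν (freezeFirst g) le_rfl]
  rw [← hresample.measure_preimage hset.nullMeasurableSet, hpre,
    measurePreserving_swap_parameter.measure_preimage hmeas.nullMeasurableSet]
  exact measure_mono fun q hq => ⟨j, hj, hq⟩

theorem measure_exists_lt_uNorm_freezeFirst_le [SFinite φ] (r : ℝ)
    {g : F × Y × (Fin (k + 1) → S) → B} (hg : Measurable g) (N : ℕ) (t : ℝ) :
    (φ.prod (seqLaw μ))
        {p | ∃ j < N, ENNReal.ofReal t < uNorm r ν (freezeFirst g) j ((p.1, p.2 j), p.2)} ≤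
      N * maxTail r μ (φ.prod μ) ν (freezeFirst g) N t := by
  have hset : {p : F × (ℕ → S) | ∃ j < N, ENNReal.ofReal t <
      uNorm r ν (freezeFirst g) j ((p.1, p.2 j), p.2)} = ⋃ j ∈ Finset.range N,
      {p | ENNReal.ofReal t < uNorm r ν (freezeFirst g) j ((p.1, p.2 j), p.2)} := by
    ext p
    simp
  rw [hset]
  refine (measure_biUnion_finset_le _ _).trans ((Finset.sum_le_sum fun j hj =>
    measure_lt_uNorm_freezeFirst_le r hg (Finset.mem_range.1 hj).le t).trans ?_)
  simp

end MaxTail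

section GoodLambda

open Matrix (vecCons)

variable {S B F Y : Type*} [MeasurableSpace S] [NormedAddCommGroup B]
  [MeasurableSpace Y] {k : ℕ} {μ : Measure S} {ν : Measure Y}
  {g : F × Y × (Fin (k + 1) → S) → B}

/-- The event that at time `j` the path of norms is between its passages of the levels `l` and
`2 * l`, while the conditional `L^r` norm of the next increment is at most `c`. -/
def passageSet (r : ℝ) (μ : Measure S) (ν : Measure Y) (g : F × Y × (Fin (k + 1) → S) → B)
    (l c : ℝ) (a : F) (j : ℕ) : Set (ℕ → S) :=
  {x | IsBetweenPassages (fun n => uNorm r ν g n (a, x)) (ENNReal.ofReal l)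
      (ENNReal.ofReal (2 * l)) j ∧
    uNorm r (ν.prod μ) (normFirst g) j (a, x) ≤ ENNReal.ofReal c}

theorem update_mem_passageSet (r l c : ℝ) {j n : ℕ} (hjn : j ≤ n) (a : F) (x : ℕ → S) (w : S) :
    Function.update x n w ∈ passageSet r μ ν g l c a j ↔ x ∈ passageSet r μ ν g l c a j := by
  have hbefore : ∀ i ≤ j, uNorm r ν g i (a, Function.update x n w) = uNorm r ν g i (a, x) :=
    fun i hi => uNorm_update r ν g (hi.trans hjn) a x w
  simp only [passageSet, IsBetweenPassages, Set.mem_ofPred_eq, uNorm_update r _ _ hjn]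
  refine and_congr_left fun _ => and_congr ?_ ?_
  · exact exists_congr fun i => and_congr_right fun hi => by rw [hbefore i hi]
  · exact forall₂_congr fun i hi => by rw [hbefore i hi]

variable [MeasurableSpace F] [MeasurableSpace B] [BorelSpace B]
  [TopologicalSpace.SeparableSpace B]

theorem measurable_increment (hg : Measurable g) (j : ℕ) :
    Measurable fun q : ((F × (ℕ → S)) × Y) × S =>
      kernelSum (fun v => g (q.1.1.1, q.1.2, vecCons q.2 v)) j q.1.1.2 :=
  measurable_kernelSum (E := ((F × (ℕ → S)) × Y) × S)
    (g := fun q v => g (q.1.1.1, q.1.2, vecCons q.2 v)) (e := fun q => q.1.1.2)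
    (by fun_prop) (by fun_prop) j

variable [SFinite μ]

theorem uNorm_normFirst_rpow {r : ℝ} (hr : 0 < r) (hg : Measurable g) (j : ℕ) (a : F)
    (x : ℕ → S) :
    uNorm r (ν.prod μ) (normFirst g) j (a, x) ^ r =
      ∫⁻ y, ∫⁻ z, ‖kernelSum (fun v => g (a, y, vecCons z v)) j x‖ₑ ^ r ∂μ ∂ν := by
  have hmeas : Measurable fun q : Y × S => kernelSum (fun v => g (a, q.1, vecCons q.2 v)) j x :=
    (measurable_increment hg j).comp (f := fun q : Y × S => (((a, x), q.1), q.2)) (by fun_prop)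
  rw [uNorm, ← lintegral_rpow_enorm_eq_rpow_eLpNorm' hr]
  exact lintegral_prod _ (hmeas.enorm.pow_const r).aemeasurable

variable [SFinite ν]

theorem measurableSet_passageSet (r : ℝ) (hg : Measurable g) (l c : ℝ) (j : ℕ) :
    MeasurableSet {p : F × (ℕ → S) | p.2 ∈ passageSet r μ ν g l c p.1 j} := by
  have hset : {p : F × (ℕ → S) | p.2 ∈ passageSet r μ ν g l c p.1 j} =
      ({p | ∃ n ≤ j, ENNReal.ofReal l < uNorm r ν g n p} ∩
        {p | ∃ n ≤ j, ENNReal.ofReal (2 * l) < uNorm r ν g n p}ᶜ) ∩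
        {p | ENNReal.ofReal c < uNorm r (ν.prod μ) (normFirst g) j p}ᶜ := by
    ext p
    simp [passageSet, IsBetweenPassages]
  rw [hset]
  exact ((measurableSet_exists_lt_uNorm r ν hg j l).inter
    (measurableSet_exists_lt_uNorm r ν hg j (2 * l)).compl).inter
    (measurableSet_lt_uNorm r (ν.prod μ) (measurable_normFirst hg) j c).compl

theorem isPredictable_increment (r : ℝ) (hg : Measurable g) (l c : ℝ) (a : F) (y : Y) :
    IsPredictable (fun j x z => kernelSum (fun v => g (a, y, vecCons z v)) j x)
      (passageSet r μ ν g l c a) where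
  measurable j := (measurable_increment hg j).comp
    (f := fun q : (ℕ → S) × S => (((a, q.1), y), q.2)) (by fun_prop)
  measurableSet j := measurable_prodMk_left (measurableSet_passageSet r hg l c j)
  update_eq _ _ x w _ hjn := kernelSum_update _ hjn x w
  update_mem _ _ x w hjn := update_mem_passageSet r l c hjn a x w

variable [NormedSpace ℝ B]

/-- The sum of the centred increments of the kernel sums over the times in the passage. -/
noncomputable def passageSum (r : ℝ) (μ : Measure S) (ν : Measure Y)
    (g : F × Y × (Fin (k + 1) → S) → B) (l c : ℝ) (N : ℕ) (a : F) (y : Y) (x : ℕ → S) : B :=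
  predictableSum μ (fun j x z => kernelSum (fun v => g (a, y, vecCons z v)) j x)
    (passageSet r μ ν g l c a) N x

theorem measurable_passageSum (r : ℝ) (hg : Measurable g) (l c : ℝ) (N : ℕ) :
    Measurable fun q : (F × (ℕ → S)) × Y => passageSum r μ ν g l c N q.1.1 q.2 q.1.2 := by
  unfold passageSum predictableSum
  refine Finset.measurable_sum _ fun j _ => Measurable.ite
    (measurable_fst (measurableSet_passageSet r hg l c j)) ?_ measurable_const
  have hvalue : Measurable fun q : (F × (ℕ → S)) × Y =>
      kernelSum (fun v => g (q.1.1, q.2, vecCons (q.1.2 j) v)) j q.1.2 :=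
    (measurable_increment hg j).comp (f := fun q : (F × (ℕ → S)) × Y => (q, q.1.2 j))
      (by fun_prop)
  have hmean : Measurable fun q : (F × (ℕ → S)) × Y =>
      ∫ z, kernelSum (fun v => g (q.1.1, q.2, vecCons z v)) j q.1.2 ∂μ :=
    (measurable_increment hg j).stronglyMeasurable.integral_prod_right.measurable
  exact hvalue.sub hmean

theorem measurable_eLpNorm'_passageSum (r : ℝ) (hg : Measurable g) (l c : ℝ) (N : ℕ) :
    Measurable fun p : F × (ℕ → S) =>
      eLpNorm' (fun y => passageSum r μ ν g l c N p.1 y p.2) r ν :=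
  measurable_eLpNorm' r ν (f := fun (p : F × (ℕ → S)) y => passageSum r μ ν g l c N p.1 y p.2)
    (measurable_passageSum r hg l c N)

variable {μ : Measure S} [IsProbabilityMeasure μ] {r C : ℝ}

theorem lintegral_eLpNorm'_passageSum_le (hr : 0 < r) (hC : IsMartingaleTypeConst B μ r C)
    (hg : Measurable g) (l c : ℝ) (N : ℕ) (a : F) :
    ∫⁻ x, eLpNorm' (fun y => passageSum r μ ν g l c N a y x) r ν ^ r ∂(seqLaw μ) ≤
      ENNReal.ofReal C * ∑ j ∈ Finset.range N, ∫⁻ x, (passageSet r μ ν g l c a j).indicator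
        (fun x => uNorm r (ν.prod μ) (normFirst g) j (a, x) ^ r) x ∂(seqLaw μ) := by
  have hsection : Measurable fun q : (ℕ → S) × Y => ((a, q.1), q.2) := by fun_prop
  have hsum : Measurable fun q : (ℕ → S) × Y => ‖passageSum r μ ν g l c N a q.2 q.1‖ₑ ^ r :=
    ((measurable_passageSum r hg l c N).comp hsection).enorm.pow_const r
  have hmoment : ∀ j, Measurable fun q : (ℕ → S) × Y =>
      ∫⁻ z, ‖kernelSum (fun v => g (a, q.2, vecCons z v)) j q.1‖ₑ ^ r ∂μ := fun j =>
    Measurable.lintegral_prod_right' (ν := μ) <| Measurable.pow_const (Measurable.enorm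
      ((measurable_increment hg j).comp
        (f := fun q : ((ℕ → S) × Y) × S => (((a, q.1.1), q.1.2), q.2)) (by fun_prop))) r
  have hterm : ∀ j, Measurable fun q : (ℕ → S) × Y => (passageSet r μ ν g l c a j).indicator
      (fun x => ∫⁻ z, ‖kernelSum (fun v => g (a, q.2, vecCons z v)) j x‖ₑ ^ r ∂μ) q.1 := fun j =>
    (hmoment j).indicator
      (measurable_fst (measurable_prodMk_left (measurableSet_passageSet r hg l c j)))
  calc ∫⁻ x, eLpNorm' (fun y => passageSum r μ ν g l c N a y x) r ν ^ r ∂(seqLaw μ)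
      = ∫⁻ y, ∫⁻ x, ‖passageSum r μ ν g l c N a y x‖ₑ ^ r ∂(seqLaw μ) ∂ν := by
        simp only [← lintegral_rpow_enorm_eq_rpow_eLpNorm' hr]
        exact lintegral_lintegral_swap hsum.aemeasurable
    _ ≤ ∫⁻ y, ENNReal.ofReal C * ∑ j ∈ Finset.range N,
          ∫⁻ x, (passageSet r μ ν g l c a j).indicator
            (fun x => ∫⁻ z, ‖kernelSum (fun v => g (a, y, vecCons z v)) j x‖ₑ ^ r ∂μ) x
            ∂(seqLaw μ) ∂ν :=
        lintegral_mono fun y => hC _ _ (isPredictable_increment r hg l c a y) N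
    _ = _ := ?_
  rw [lintegral_const_mul' _ _ ENNReal.ofReal_ne_top,
    lintegral_finsetSum' _ fun j _ => (hterm j).lintegral_prod_left'.aemeasurable]
  refine congrArg _ (Finset.sum_congr rfl fun j _ => ?_)
  rw [← lintegral_lintegral_swap (hterm j).aemeasurable]
  refine lintegral_congr fun x => ?_
  by_cases hx : x ∈ passageSet r μ ν g l c a j
  · simp only [Set.indicator_of_mem hx, uNorm_normFirst_rpow hr hg]
  · simp only [Set.indicator_of_notMem hx, lintegral_zero]

theorem lintegral_passageSum_le {φ : Measure F} (hr : 0 < r) (hC : IsMartingaleTypeConst B μ r C)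
    (hg : Measurable g) (l c : ℝ) (N : ℕ) :
    ∫⁻ p, eLpNorm' (fun y => passageSum r μ ν g l c N p.1 y p.2) r ν ^ r ∂(φ.prod (seqLaw μ)) ≤
      ENNReal.ofReal C * (N * ENNReal.ofReal c ^ r * maxTail r μ φ ν g N l) := by
  have hexc := measurableSet_exists_lt_uNorm r ν hg N l
  have hterm : ∀ a j, j < N → ∫⁻ x, (passageSet r μ ν g l c a j).indicator
      (fun x => uNorm r (ν.prod μ) (normFirst g) j (a, x) ^ r) x ∂(seqLaw μ) ≤
        ENNReal.ofReal c ^ r *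
          seqLaw μ (Prod.mk a ⁻¹' {p | ∃ n ≤ N, ENNReal.ofReal l < uNorm r ν g n p}) := by
    intro a j hj
    rw [← lintegral_indicator_const (measurable_prodMk_left hexc)]
    refine lintegral_mono fun x => ?_
    by_cases hx : x ∈ passageSet r μ ν g l c a j
    · obtain ⟨⟨⟨n, hn, hlt⟩, -⟩, hle⟩ := hx
      have hmem : x ∈ Prod.mk a ⁻¹' {p | ∃ n ≤ N, ENNReal.ofReal l < uNorm r ν g n p} :=
        ⟨n, hn.trans hj.le, hlt⟩
      rw [Set.indicator_of_mem hmem]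
      exact (Set.indicator_le_self _ _ _).trans (ENNReal.rpow_le_rpow hle hr.le)
    · simp only [Set.indicator_of_notMem hx, zero_le]
  rw [lintegral_prod _ ((measurable_eLpNorm'_passageSum r hg l c N).pow_const r).aemeasurable,
    maxTail, Measure.prod_apply hexc,
    ← lintegral_const_mul _ (measurable_measure_prodMk_left hexc),
    ← lintegral_const_mul' _ _ ENNReal.ofReal_ne_top]
  refine lintegral_mono fun a => (lintegral_eLpNorm'_passageSum_le hr hC hg l c N a).trans ?_
  gcongr
  refine (Finset.sum_le_sum fun j hj => hterm a j (Finset.mem_range.1 hj)).trans_eq ?_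
  rw [Finset.sum_const, Finset.card_range, nsmul_eq_mul, mul_assoc]

theorem ofReal_mul_rpow_div_rpow_inv {r C l δ N : ℝ} (hr : 0 < r) (hC : 0 < C) (hl : 0 < l)
    (hδ : 0 < δ) (hN : 0 < N) :
    ENNReal.ofReal C * (ENNReal.ofReal N * ENNReal.ofReal (δ * l / N ^ (1 / r)) ^ r) =
      ENNReal.ofReal (l / 2) ^ r * ENNReal.ofReal (C * (2 * δ) ^ r) := by
  have hroot : (δ * l / N ^ (1 / r)) ^ r = (δ * l) ^ r / N := by
    rw [Real.div_rpow (by positivity) (by positivity), ← Real.rpow_mul hN.le, one_div,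
      inv_mul_cancel₀ hr.ne', Real.rpow_one]
  have hsplit : (l / 2) ^ r * (2 * δ) ^ r = (δ * l) ^ r := by
    rw [← Real.mul_rpow (by positivity) (by positivity)]
    ring_nf
  rw [ENNReal.ofReal_rpow_of_pos (by positivity), ENNReal.ofReal_rpow_of_pos (by positivity),
    ← ENNReal.ofReal_mul hN.le, ← ENNReal.ofReal_mul hC.le, ← ENNReal.ofReal_mul (by positivity),
    hroot, mul_div_cancel₀ _ hN.ne', mul_left_comm, hsplit]

theorem measure_le_eLpNorm'_passageSum_le {φ : Measure F} (hr : 0 < r) (hC0 : 0 < C)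
    (hC : IsMartingaleTypeConst B μ r C) (hg : Measurable g) {N : ℕ} (hN : 1 ≤ N) {l δ : ℝ}
    (hl : 0 < l) (hδ : 0 < δ) :
    (φ.prod (seqLaw μ)) {p | ENNReal.ofReal (l / 2) ≤
        eLpNorm' (fun y => passageSum r μ ν g l (δ * l / N ^ (1 / r)) N p.1 y p.2) r ν} ≤
      ENNReal.ofReal (C * (2 * δ) ^ r) * maxTail r μ φ ν g N l := by
  have hmeas := (measurable_eLpNorm'_passageSum (μ := μ) (ν := ν) r hg l
    (δ * l / N ^ (1 / r)) N).pow_const r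
  have hmarkov := (mul_meas_ge_le_lintegral (μ := φ.prod (seqLaw μ)) hmeas
    (ENNReal.ofReal (l / 2) ^ r)).trans (lintegral_passageSum_le hr hC hg l _ N)
  have hl2 : 0 < ENNReal.ofReal (l / 2) := ENNReal.ofReal_pos.2 (half_pos hl)
  simp only [ENNReal.rpow_le_rpow_iff hr] at hmarkov
  rw [← mul_assoc, ← ENNReal.ofReal_natCast,
    ofReal_mul_rpow_div_rpow_inv hr hC0 hl hδ (by positivity), mul_assoc] at hmarkov
  exact (ENNReal.mul_le_mul_iff_right
    (ENNReal.rpow_pos_of_nonneg hl2 hr.le).ne'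
    (ENNReal.rpow_ne_top_of_nonneg hr.le ENNReal.ofReal_ne_top)).1 hmarkov

theorem le_eLpNorm'_passageSum {ν : Measure Y} (hr : 1 ≤ r) (hg : Measurable g) {N : ℕ}
    {l c δ : ℝ} (hl : 0 < l) (hδ : 0 < δ) (hδ4 : δ ≤ 1 / 4) {p : F × (ℕ → S)}
    (hmean : ∀ n, ∀ᵐ y ∂ν, ∫ z, kernelSum (fun v => g (p.1, y, vecCons z v)) n p.2 ∂μ =
      kernelSum (fun v => averageFirst μ g (p.1, y, v)) n p.2)
    (hpass : ∃ n ≤ N, ENNReal.ofReal (2 * l) < uNorm r ν g n p)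
    (hfreeze : ∀ j < N, uNorm r ν (freezeFirst g) j ((p.1, p.2 j), p.2) ≤ ENNReal.ofReal (δ * l))
    (hnorm : ∀ j < N, uNorm r (ν.prod μ) (normFirst g) j p ≤ ENNReal.ofReal c)
    (haverage : ∀ j < N, uNorm r ν (averageFirst μ g) j p ≤ ENNReal.ofReal (δ * l / N)) :
    ENNReal.ofReal (l / 2) ≤ eLpNorm' (fun y => passageSum r μ ν g l c N p.1 y p.2) r ν := by
  have hincrement := measurable_increment hg
  have hgain := le_eLpNorm'_sum_of_passage (ν := ν) hr
    (u := fun n y => kernelSum (fun v => g (p.1, y, v)) n p.2)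
    (V := fun j y => kernelSum (fun v => g (p.1, y, vecCons (p.2 j) v)) j p.2)
    (m := fun j y => ∫ z, kernelSum (fun v => g (p.1, y, vecCons z v)) j p.2 ∂μ)
    (fun n => (measurable_kernelSum (E := Y) (g := fun y v => g (p.1, y, v)) (e := fun _ => p.2)
      (by fun_prop) (by fun_prop) n).aestronglyMeasurable)
    (fun j => ((hincrement j).comp (f := fun y : Y => ((p, y), p.2 j))
      (by fun_prop)).aestronglyMeasurable)
    (fun j => ((hincrement j).stronglyMeasurable.integral_prod_right'.measurable.comp
      (f := fun y : Y => (p, y)) (by fun_prop)).aestronglyMeasurable)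
    (funext fun y => kernelSum_zero _ _) (fun n => funext fun y => kernelSum_succ _ _ _)
    hl hδ hδ4 hpass hfreeze
    (fun j hj => (eLpNorm'_congr_ae (hmean j)).trans_le (haverage j hj))
  refine hgain.trans_eq (congrArg (eLpNorm' · r ν) (funext fun y => ?_))
  refine Finset.sum_congr rfl fun j hj => ?_
  have hmem : p.2 ∈ passageSet r μ ν g l c p.1 j ↔
      IsBetweenPassages (fun n => eLpNorm' (fun y => kernelSum (fun v => g (p.1, y, v)) n p.2) r ν)
        (ENNReal.ofReal l) (ENNReal.ofReal (2 * l)) j :=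
    and_iff_left (hnorm j (Finset.mem_range.1 hj))
  by_cases hjp : p.2 ∈ passageSet r μ ν g l c p.1 j
  · rw [if_pos (hmem.1 hjp), if_pos hjp]
  · rw [if_neg (mt hmem.2 hjp), if_neg hjp]

theorem maxTail_two_mul_le {φ : Measure F} [SFinite φ] (hr : 1 < r) (hC0 : 0 < C)
    (hC : IsMartingaleTypeConst B μ r C) (hg : Measurable g)
    (hgi : Integrable g (jointLaw μ φ ν (k + 1))) {N : ℕ} (hN : 1 ≤ N) {l δ : ℝ} (hl : 0 < l)
    (hδ : 0 < δ) (hδ4 : δ ≤ 1 / 4) :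
    maxTail r μ φ ν g N (2 * l) ≤ ENNReal.ofReal (C * (2 * δ) ^ r) * maxTail r μ φ ν g N l +
      (N * maxTail r μ (φ.prod μ) ν (freezeFirst g) N (δ * l) +
        maxTail r μ φ (ν.prod μ) (normFirst g) N (δ * l / N ^ (1 / r)) +
        maxTail r μ φ ν (averageFirst μ g) N (δ * l / N)) := by
  have hr0 : 0 < r := by linarith
  set c := δ * l / (N : ℝ) ^ (1 / r)
  let crossing := {p : F × (ℕ → S) | ENNReal.ofReal (l / 2) ≤
    eLpNorm' (fun y => passageSum r μ ν g l c N p.1 y p.2) r ν}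
  let frozen := {p : F × (ℕ → S) | ∃ j < N, ENNReal.ofReal (δ * l) <
    uNorm r ν (freezeFirst g) j ((p.1, p.2 j), p.2)}
  let normed := {p : F × (ℕ → S) | ∃ n ≤ N, ENNReal.ofReal c <
    uNorm r (ν.prod μ) (normFirst g) n p}
  let averaged := {p : F × (ℕ → S) | ∃ n ≤ N, ENNReal.ofReal (δ * l / N) <
    uNorm r ν (averageFirst μ g) n p}
  have hcover : ∀ᵐ p ∂(φ.prod (seqLaw μ)),
      (∃ n ≤ N, ENNReal.ofReal (2 * l) < uNorm r ν g n p) →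
        p ∈ crossing ∪ (frozen ∪ normed ∪ averaged) := by
    filter_upwards [ae_kernelSum_integral hgi] with p hmean hpass
    by_contra hnot
    simp only [crossing, frozen, normed, averaged, Set.mem_union, Set.mem_ofPred_eq, not_or,
      not_exists, not_and, not_lt] at hnot
    obtain ⟨hcrossing, ⟨hfrozen, hnormed⟩, haveraged⟩ := hnot
    exact hcrossing (le_eLpNorm'_passageSum hr.le hg hl hδ hδ4 hmean hpass hfrozen
      (fun j hj => hnormed j hj.le) fun j hj => haveraged j hj.le)
  calc maxTail r μ φ ν g N (2 * l)
      ≤ (φ.prod (seqLaw μ)) (crossing ∪ (frozen ∪ normed ∪ averaged)) := measure_mono_ae hcover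
    _ ≤ (φ.prod (seqLaw μ)) crossing + ((φ.prod (seqLaw μ)) frozen + (φ.prod (seqLaw μ)) normed +
        (φ.prod (seqLaw μ)) averaged) :=
        (measure_union_le _ _).trans (add_le_add le_rfl ((measure_union_le _ _).trans
          (add_le_add (measure_union_le _ _) le_rfl)))
    _ ≤ _ := by
        refine add_le_add (measure_le_eLpNorm'_passageSum_le hr0 hC0 hC hg hN hl hδ) ?_
        exact add_le_add_left (add_le_add_left
          (measure_exists_lt_uNorm_freezeFirst_le r hg N (δ * l)) _) _

end GoodLambda

/-! ### Dyadic sums of tails -/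

section Geometric

theorem tsum_ofReal_pow_lt_top {x : ℝ} (hx : 0 ≤ x) (hx1 : x < 1) :
    ∑' l : ℕ, ENNReal.ofReal (x ^ l) < ∞ := by
  rw [← ENNReal.ofReal_tsum_of_nonneg (fun n => pow_nonneg hx n)
    (summable_geometric_of_lt_one hx hx1)]
  exact ENNReal.ofReal_lt_top

theorem tsum_ofReal_pow_mul_le_of_le_succ {η : ℝ} (hη : 0 ≤ η) {f G : ℕ → ℝ≥0∞}
    (hf : ∑' l, ENNReal.ofReal (η ^ l) * f l ≠ ∞)
    (hfG : ∀ l, f l ≤ ENNReal.ofReal (η / 2) * f (l + 1) + G l) :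
    ∑' l, ENNReal.ofReal (η ^ l) * f l ≤ 2 * ∑' l, ENNReal.ofReal (η ^ l) * G l := by
  set s := ∑' l, ENNReal.ofReal (η ^ l) * f l
  have hweight : ∀ l, ENNReal.ofReal (η ^ l) * ENNReal.ofReal (η / 2) =
      2⁻¹ * ENNReal.ofReal (η ^ (l + 1)) := fun l => by
    rw [← ENNReal.ofReal_mul (by positivity), ← ENNReal.ofReal_ofNat 2,
      ← ENNReal.ofReal_inv_of_pos two_pos, ← ENNReal.ofReal_mul (by norm_num), pow_succ]
    ring_nf
  have hsum : s ≤ 2⁻¹ * s + ∑' l, ENNReal.ofReal (η ^ l) * G l :=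
    calc s ≤ ∑' l, (2⁻¹ * (ENNReal.ofReal (η ^ (l + 1)) * f (l + 1)) +
          ENNReal.ofReal (η ^ l) * G l) := by
          refine ENNReal.tsum_le_tsum fun l => (mul_le_mul_right (hfG l) _).trans_eq ?_
          rw [mul_add, ← mul_assoc, hweight, mul_assoc]
      _ ≤ _ := by
          rw [ENNReal.tsum_add, ENNReal.tsum_mul_left]
          gcongr
          exact ENNReal.tsum_comp_le_tsum_of_injective (add_left_injective 1)
            fun l => ENNReal.ofReal (η ^ l) * f l
  have hhalf : 2⁻¹ * s ≤ ∑' l, ENNReal.ofReal (η ^ l) * G l := by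
    refine (ENNReal.add_le_add_iff_left (ENNReal.mul_ne_top (by simp) hf : 2⁻¹ * s ≠ ∞)).1 ?_
    rwa [← add_mul, ENNReal.inv_two_add_inv_two, one_mul]
  calc s = 2 * (2⁻¹ * s) := by rw [← mul_assoc, ENNReal.mul_inv_cancel (by simp) (by simp), one_mul]
    _ ≤ _ := by gcongr

theorem exists_mul_rpow_two_mul_le {r C η : ℝ} (hr : 0 < r) (hC : 0 < C) (hη : 0 < η) :
    ∃ δ : ℝ, 0 < δ ∧ δ ≤ 1 / 4 ∧ C * (2 * δ) ^ r ≤ η / 2 := by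
  set δ := min (1 / 4) ((η / (2 * C)) ^ (1 / r) / 2)
  refine ⟨δ, by positivity, min_le_left _ _, ?_⟩
  have hδ : 2 * δ ≤ (η / (2 * C)) ^ (1 / r) := by
    linarith [min_le_right (1 / 4) ((η / (2 * C)) ^ (1 / r) / 2)]
  calc C * (2 * δ) ^ r ≤ C * ((η / (2 * C)) ^ (1 / r)) ^ r := by gcongr
    _ = C * (η / (2 * C)) := by
        rw [← Real.rpow_mul (by positivity), one_div, inv_mul_cancel₀ hr.ne', Real.rpow_one]
    _ = η / 2 := by field_simp

end Geometric

section DyadicTail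

variable {S B F Y : Type*} [MeasurableSpace S] [NormedAddCommGroup B]
  [MeasurableSpace F] [MeasurableSpace Y] {k : ℕ}

/-- The sum of the tails of `maxTail` at the levels `t / 2 ^ l`, with geometric weights `η ^ l`. The
good-`λ` inequality becomes a recursion for this sum. -/
noncomputable def geomTail (r η : ℝ) (μ : Measure S) (φ : Measure F) (ν : Measure Y)
    (g : F × Y × (Fin k → S) → B) (N : ℕ) (t : ℝ) : ℝ≥0∞ :=
  ∑' l : ℕ, ENNReal.ofReal (η ^ l) * maxTail r μ φ ν g N (t / 2 ^ l)

/-- The sum over the dyadic blocks `N = 2 ^ b` of `N ^ ρ` times `geomTail` at the level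
`ε * N ^ τ`. -/
noncomputable def dyadicTail (r η : ℝ) (μ : Measure S) (φ : Measure F) (ν : Measure Y) (ρ τ : ℝ)
    (g : F × Y × (Fin k → S) → B) (ε : ℝ) : ℝ≥0∞ :=
  ∑' b : ℕ, ENNReal.ofReal (2 ^ (b * ρ)) * geomTail r η μ φ ν g (2 ^ b) (ε * 2 ^ (b * τ))

variable {μ : Measure S} [IsProbabilityMeasure μ] {φ : Measure F} [IsProbabilityMeasure φ]
  {ν : Measure Y}

theorem geomTail_ne_top {η : ℝ} (hη : 0 ≤ η) (hη1 : η < 1) (r : ℝ)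
    (g : F × Y × (Fin k → S) → B) (N : ℕ) (t : ℝ) : geomTail r η μ φ ν g N t ≠ ∞ :=
  ((ENNReal.tsum_le_tsum fun _ => mul_le_of_le_one_right' prob_le_one).trans_lt
    (tsum_ofReal_pow_lt_top hη hη1)).ne

variable [NormedSpace ℝ B] [TopologicalSpace.SeparableSpace B] [MeasurableSpace B] [BorelSpace B]
  [SFinite ν] {r C η δ : ℝ} {g : F × Y × (Fin (k + 1) → S) → B}

theorem geomTail_le (hr : 1 < r) (hC0 : 0 < C) (hC : IsMartingaleTypeConst B μ r C)
    (hη : 0 < η) (hη1 : η < 1) (hδ : 0 < δ) (hδ4 : δ ≤ 1 / 4) (hδη : C * (2 * δ) ^ r ≤ η / 2)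
    (hg : Measurable g) (hgi : Integrable g (jointLaw μ φ ν (k + 1))) {N : ℕ} (hN : 1 ≤ N)
    {t : ℝ} (ht : 0 < t) :
    geomTail r η μ φ ν g N t ≤ 2 * (N * geomTail r η μ (φ.prod μ) ν (freezeFirst g) N (δ / 2 * t) +
      geomTail r η μ φ (ν.prod μ) (normFirst g) N (δ / 2 * t / N ^ (1 / r)) +
      geomTail r η μ φ ν (averageFirst μ g) N (δ / 2 * t / N)) := by
  have hstep : ∀ l : ℕ, maxTail r μ φ ν g N (t / 2 ^ l) ≤
      ENNReal.ofReal (η / 2) * maxTail r μ φ ν g N (t / 2 ^ (l + 1)) +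
      (N * maxTail r μ (φ.prod μ) ν (freezeFirst g) N (δ / 2 * t / 2 ^ l) +
        maxTail r μ φ (ν.prod μ) (normFirst g) N (δ / 2 * t / N ^ (1 / r) / 2 ^ l) +
        maxTail r μ φ ν (averageFirst μ g) N (δ / 2 * t / N / 2 ^ l)) := by
    intro l
    have hgood := maxTail_two_mul_le (l := t / 2 ^ (l + 1)) hr hC0 hC hg hgi hN (by positivity)
      hδ hδ4
    have hdouble : 2 * (t / 2 ^ (l + 1)) = t / 2 ^ l := by rw [pow_succ]; field_simp
    have hscale : δ * (t / 2 ^ (l + 1)) = δ / 2 * t / 2 ^ l := by rw [pow_succ]; field_simp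
    rw [hdouble, hscale, div_right_comm _ ((2 : ℝ) ^ l), div_right_comm _ ((2 : ℝ) ^ l)] at hgood
    exact hgood.trans (by gcongr)
  refine (tsum_ofReal_pow_mul_le_of_le_succ hη.le (geomTail_ne_top hη.le hη1 r g N t)
    hstep).trans_eq ?_
  simp only [mul_add, ENNReal.tsum_add, geomTail, mul_left_comm _ (N : ℝ≥0∞), ENNReal.tsum_mul_left]

theorem dyadicTail_le (hr : 1 < r) (hC0 : 0 < C) (hC : IsMartingaleTypeConst B μ r C)
    (hη : 0 < η) (hη1 : η < 1) (hδ : 0 < δ) (hδ4 : δ ≤ 1 / 4) (hδη : C * (2 * δ) ^ r ≤ η / 2)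
    (hg : Measurable g) (hgi : Integrable g (jointLaw μ φ ν (k + 1))) (ρ τ : ℝ) {ε : ℝ}
    (hε : 0 < ε) :
    dyadicTail r η μ φ ν ρ τ g ε ≤
      2 * (dyadicTail r η μ (φ.prod μ) ν (ρ + 1) τ (freezeFirst g) (δ / 2 * ε) +
        dyadicTail r η μ φ (ν.prod μ) ρ (τ - 1 / r) (normFirst g) (δ / 2 * ε) +
        dyadicTail r η μ φ ν ρ (τ - 1) (averageFirst μ g) (δ / 2 * ε)) := by
  simp only [dyadicTail]
  rw [← ENNReal.tsum_add, ← ENNReal.tsum_add, ← ENNReal.tsum_mul_left]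
  refine ENNReal.tsum_le_tsum fun b => ?_
  have hblock := geomTail_le hr hC0 hC hη hη1 hδ hδ4 hδη hg hgi (N := 2 ^ b) Nat.one_le_two_pow
    (t := ε * 2 ^ (b * τ)) (by positivity)
  have hcast : ((2 ^ b : ℕ) : ℝ) = 2 ^ (b : ℝ) := by norm_cast
  have hnorm : δ / 2 * (ε * 2 ^ (b * τ)) / ((2 ^ b : ℕ) : ℝ) ^ (1 / r) =
      δ / 2 * ε * 2 ^ (b * (τ - 1 / r)) := by
    rw [hcast, ← Real.rpow_mul two_pos.le, mul_sub, Real.rpow_sub two_pos]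
    ring
  have haverage : δ / 2 * (ε * 2 ^ (b * τ)) / ((2 ^ b : ℕ) : ℝ) =
      δ / 2 * ε * 2 ^ (b * (τ - 1)) := by
    rw [hcast, mul_sub, Real.rpow_sub two_pos, mul_one]
    ring
  have hweight : ENNReal.ofReal (2 ^ (b * (ρ + 1))) =
      ENNReal.ofReal (2 ^ (b * ρ)) * ((2 ^ b : ℕ) : ℝ≥0∞) := by
    rw [← ENNReal.ofReal_natCast, hcast, ← ENNReal.ofReal_mul (by positivity),
      ← Real.rpow_add two_pos, mul_add, mul_one]
  rw [hnorm, haverage, ← mul_assoc (δ / 2)] at hblock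
  refine (mul_le_mul_right hblock _).trans_eq ?_
  rw [hweight]
  ring

end DyadicTail

section DyadicMeasure

variable {F : Type*} [MeasurableSpace F]

theorem sum_range_succ_two_rpow_le {ρ : ℝ} (hρ : 0 < ρ) (n : ℕ) :
    ∑ b ∈ Finset.range (n + 1), (2 : ℝ) ^ (b * ρ) ≤ (1 - (2 ^ ρ)⁻¹)⁻¹ * 2 ^ (n * ρ) := by
  have hbase : (1 : ℝ) < 2 ^ ρ := Real.one_lt_rpow one_lt_two hρ
  have hpow : ∀ b : ℕ, (2 : ℝ) ^ (b * ρ) = (2 ^ ρ) ^ b := fun b => by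
    rw [mul_comm, Real.rpow_mul two_pos.le, Real.rpow_natCast]
  have hconst : (1 - ((2 : ℝ) ^ ρ)⁻¹)⁻¹ = 2 ^ ρ / (2 ^ ρ - 1) := by
    rw [show 1 - ((2 : ℝ) ^ ρ)⁻¹ = (2 ^ ρ - 1) / 2 ^ ρ by field_simp, inv_div]
  simp only [hpow]
  rw [geom_sum_eq hbase.ne', hconst, div_mul_eq_mul_div, ← pow_succ']
  gcongr
  linarith

theorem tsum_dyadic_indicator_le {ρ τ q : ℝ} (hρ : 0 < ρ) (hτ : 0 < τ) (hq : ρ ≤ q * τ) {s : ℝ}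
    (hs : 0 < s) (H : ℝ≥0∞) :
    ∑' b : ℕ, (if ENNReal.ofReal (s * 2 ^ (b * τ)) < H then ENNReal.ofReal (2 ^ (b * ρ)) else 0) ≤
      ENNReal.ofReal ((1 - (2 ^ ρ)⁻¹)⁻¹ * s ^ (-q)) * H ^ q := by
  have hq0 : 0 < q := pos_of_mul_pos_left (hρ.trans_le hq) hτ.le
  have hconst : 0 ≤ (1 - ((2 : ℝ) ^ ρ)⁻¹)⁻¹ :=
    inv_nonneg.2 (sub_nonneg.2 (inv_le_one_of_one_le₀ (Real.one_le_rpow one_le_two hρ.le)))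
  refine ENNReal.tsum_le_of_sum_range_le fun n => ?_
  induction n with
  | zero => simp
  | succ n ih =>
    by_cases hn : ENNReal.ofReal (s * 2 ^ (n * τ)) < H
    · have hlevel : (2 : ℝ) ^ (n * ρ) ≤ s ^ (-q) * (s * 2 ^ (n * τ)) ^ q := by
        rw [Real.mul_rpow hs.le (by positivity), ← mul_assoc, ← Real.rpow_add hs, neg_add_cancel,
          Real.rpow_zero, one_mul, ← Real.rpow_mul two_pos.le]
        exact Real.rpow_le_rpow_of_exponent_le one_le_two (by nlinarith [n.cast_nonneg (α := ℝ)])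
      calc ∑ b ∈ Finset.range (n + 1),
            (if ENNReal.ofReal (s * 2 ^ (b * τ)) < H then ENNReal.ofReal (2 ^ (b * ρ)) else 0)
          ≤ ∑ b ∈ Finset.range (n + 1), ENNReal.ofReal (2 ^ (b * ρ)) :=
            Finset.sum_le_sum fun b _ => by split_ifs <;> simp
        _ = ENNReal.ofReal (∑ b ∈ Finset.range (n + 1), 2 ^ (b * ρ)) :=
            (ENNReal.ofReal_sum_of_nonneg fun b _ => by positivity).symm
        _ ≤ ENNReal.ofReal ((1 - (2 ^ ρ)⁻¹)⁻¹ * s ^ (-q) * (s * 2 ^ (n * τ)) ^ q) := by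
            refine ENNReal.ofReal_le_ofReal ((sum_range_succ_two_rpow_le hρ n).trans ?_)
            rw [mul_assoc]
            gcongr
        _ ≤ _ := by
            rw [ENNReal.ofReal_mul (by positivity), ← ENNReal.ofReal_rpow_of_pos (by positivity)]
            gcongr
    · rwa [Finset.sum_range_succ, if_neg hn, add_zero]

theorem tsum_dyadic_measure_le {ρ τ q : ℝ} (hρ : 0 < ρ) (hτ : 0 < τ) (hq : ρ ≤ q * τ) {s : ℝ}
    (hs : 0 < s) (φ : Measure F) {H : F → ℝ≥0∞} (hH : Measurable H) :
    ∑' b : ℕ, ENNReal.ofReal (2 ^ (b * ρ)) * φ {a | ENNReal.ofReal (s * 2 ^ (b * τ)) < H a} ≤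
      ENNReal.ofReal ((1 - (2 ^ ρ)⁻¹)⁻¹ * s ^ (-q)) * ∫⁻ a, H a ^ q ∂φ := by
  have hset : ∀ b : ℕ, MeasurableSet {a | ENNReal.ofReal (s * 2 ^ (b * τ)) < H a} := fun b =>
    measurableSet_lt measurable_const hH
  calc ∑' b : ℕ, ENNReal.ofReal (2 ^ (b * ρ)) * φ {a | ENNReal.ofReal (s * 2 ^ (b * τ)) < H a}
      = ∑' b : ℕ, ∫⁻ a, (if ENNReal.ofReal (s * 2 ^ (b * τ)) < H a then
          ENNReal.ofReal (2 ^ (b * ρ)) else 0) ∂φ := by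
        refine tsum_congr fun b => ?_
        rw [← lintegral_indicator_const (hset b)]
        simp only [Set.indicator_apply, Set.mem_ofPred_eq]
    _ = ∫⁻ a, ∑' b : ℕ, (if ENNReal.ofReal (s * 2 ^ (b * τ)) < H a then
          ENNReal.ofReal (2 ^ (b * ρ)) else 0) ∂φ :=
        (lintegral_tsum fun b =>
          (Measurable.ite (hset b) measurable_const measurable_const).aemeasurable).symm
    _ ≤ ∫⁻ a, ENNReal.ofReal ((1 - (2 ^ ρ)⁻¹)⁻¹ * s ^ (-q)) * H a ^ q ∂φ :=
        lintegral_mono fun a => tsum_dyadic_indicator_le hρ hτ hq hs (H a)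
    _ = _ := lintegral_const_mul' _ _ ENNReal.ofReal_ne_top

theorem tsum_dyadic_geometric_lt_top {ρ τ q η : ℝ} (hρ : 0 < ρ) (hτ : 0 < τ) (hq : ρ ≤ q * τ)
    (hη : 0 ≤ η) (hηq : η * 2 ^ q < 1) {s : ℝ} (hs : 0 < s) (φ : Measure F) {H : F → ℝ≥0∞}
    (hH : Measurable H) (hHq : ∫⁻ a, H a ^ q ∂φ < ∞) :
    ∑' b : ℕ, ENNReal.ofReal (2 ^ (b * ρ)) * ∑' l : ℕ, ENNReal.ofReal (η ^ l) *
      φ {a | ENNReal.ofReal (s * 2 ^ (b * τ) / 2 ^ l) < H a} < ∞ := by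
  have hlevel : ∀ l : ℕ, η ^ l * (s / 2 ^ l) ^ (-q) = (η * 2 ^ q) ^ l * s ^ (-q) := fun l => by
    have hpow : ((2 : ℝ) ^ l) ^ q = (2 ^ q) ^ l := by
      rw [← Real.rpow_natCast, ← Real.rpow_natCast, ← Real.rpow_mul two_pos.le,
        ← Real.rpow_mul two_pos.le, mul_comm]
    rw [Real.div_rpow hs.le (by positivity), Real.rpow_neg (by positivity : (0 : ℝ) ≤ 2 ^ l),
      div_inv_eq_mul, hpow, mul_pow]
    ring
  calc ∑' b : ℕ, ENNReal.ofReal (2 ^ (b * ρ)) * ∑' l : ℕ, ENNReal.ofReal (η ^ l) *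
        φ {a | ENNReal.ofReal (s * 2 ^ (b * τ) / 2 ^ l) < H a}
      = ∑' l : ℕ, ENNReal.ofReal (η ^ l) * ∑' b : ℕ, ENNReal.ofReal (2 ^ (b * ρ)) *
        φ {a | ENNReal.ofReal (s / 2 ^ l * 2 ^ (b * τ)) < H a} := by
        simp only [← ENNReal.tsum_mul_left, div_mul_eq_mul_div]
        rw [ENNReal.tsum_comm]
        exact tsum_congr fun l => tsum_congr fun b => mul_left_comm _ _ _
    _ ≤ ∑' l : ℕ, ENNReal.ofReal (η ^ l) *
        (ENNReal.ofReal ((1 - (2 ^ ρ)⁻¹)⁻¹ * (s / 2 ^ l) ^ (-q)) * ∫⁻ a, H a ^ q ∂φ) := by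
        gcongr with l
        exact tsum_dyadic_measure_le hρ hτ hq (by positivity) φ hH
    _ = ∑' l : ℕ, ENNReal.ofReal ((η * 2 ^ q) ^ l) *
        (ENNReal.ofReal ((1 - (2 ^ ρ)⁻¹)⁻¹ * s ^ (-q)) * ∫⁻ a, H a ^ q ∂φ) := by
        refine tsum_congr fun l => ?_
        rw [← mul_assoc, ← mul_assoc, ← ENNReal.ofReal_mul (by positivity),
          ← ENNReal.ofReal_mul (by positivity), mul_left_comm, hlevel, mul_left_comm]
    _ < ∞ := by
        rw [ENNReal.tsum_mul_right]
        exact ENNReal.mul_lt_top (tsum_ofReal_pow_lt_top (by positivity) hηq)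
          (ENNReal.mul_lt_top ENNReal.ofReal_lt_top hHq)

end DyadicMeasure

/-! ### Stability of the moment, degeneracy and exponent conditions -/

section Piecewise

open Matrix (vecCons)

variable {S : Type*} {k : ℕ}

theorem piecewise_insert_zero_vecCons (J : Finset (Fin k)) (z z' : S) (x x' : Fin k → S) :
    (insert 0 (J.map (Fin.succEmb k))).piecewise (vecCons z x) (vecCons z' x') =
      vecCons z (J.piecewise x x') := by
  ext i
  refine Fin.cases ?_ (fun i => ?_) i <;> simp [Finset.piecewise]

theorem piecewise_map_succ_vecCons (J : Finset (Fin k)) (z z' : S) (x x' : Fin k → S) :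
    (J.map (Fin.succEmb k)).piecewise (vecCons z x) (vecCons z' x') =
      vecCons z' (J.piecewise x x') := by
  ext i
  refine Fin.cases ?_ (fun i => ?_) i <;> simp [Finset.piecewise]

theorem card_insert_zero_map_succ (J : Finset (Fin k)) :
    (insert 0 (J.map (Fin.succEmb k))).card = J.card + 1 := by
  rw [Finset.card_insert_of_notMem (by simp), Finset.card_map]

@[fun_prop]
theorem measurable_piecewise [MeasurableSpace S] {α : Type*} [MeasurableSpace α]
    (J : Finset (Fin k)) {f h : α → Fin k → S} (hf : Measurable f) (hh : Measurable h) :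
    Measurable fun a => J.piecewise (f a) (h a) := by
  refine measurable_pi_iff.2 fun i => ?_
  by_cases hi : i ∈ J
  · simp only [Finset.piecewise, hi, if_true]; fun_prop
  · simp only [Finset.piecewise, hi, if_false]; fun_prop

end Piecewise

section ExponentCond

variable {r ρ τ : ℝ} {k e : ℕ} {q : ℕ → ℝ}

/-- The numerical relations between the weight exponent `ρ`, the level exponent `τ` and the moment
exponents `q` of a kernel of order `k` which is degenerate of order `e`. In `j + a + c = k` the
number of variables that are frozen is `j`, the number of those put into the `L^r` norm is `a`, and
the number of those averaged is `c`. -/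
def ExponentCond (r : ℝ) (k e : ℕ) (ρ τ : ℝ) (q : ℕ → ℝ) : Prop :=
  ∀ j a c : ℕ, j + a + c = k → e ≤ a + j → 0 < τ - a / r - c ∧ ρ + j ≤ q j * (τ - a / r - c)

theorem ExponentCond.freezeFirst (h : ExponentCond r (k + 1) e ρ τ q) :
    ExponentCond r k (e - 1) (ρ + 1) τ fun j => q (j + 1) := by
  intro j a c hk he
  have hsucc := h (j + 1) a c (by omega) (by omega)
  push_cast at hsucc
  exact ⟨hsucc.1, by linarith [hsucc.2]⟩

theorem ExponentCond.normFirst (h : ExponentCond r (k + 1) e ρ τ q) :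
    ExponentCond r k (e - 1) ρ (τ - 1 / r) q := by
  intro j a c hk he
  have hsucc := h j (a + 1) c (by omega) (by omega)
  push_cast at hsucc
  rwa [show τ - 1 / r - a / r - c = τ - (a + 1) / r - c by ring]

theorem ExponentCond.averageFirst (h : ExponentCond r (k + 1) e ρ τ q) :
    ExponentCond r k e ρ (τ - 1) q := by
  intro j a c hk he
  have hsucc := h j a (c + 1) (by omega) (by omega)
  push_cast at hsucc
  rwa [show τ - 1 - a / r - c = τ - a / r - (c + 1) by ring]

end ExponentCond

section MomentCond

open Matrix (vecCons)

variable {S B F Y : Type*} [MeasurableSpace S] [NormedAddCommGroup B] [MeasurableSpace F]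
  [MeasurableSpace Y] {k : ℕ} {q : ℕ → ℝ}

/-- The moment of order `q |J|` of the conditional `L^r` norm of a kernel given the parameter and
the variables with index in `J` is finite. -/
def MomentCond (r : ℝ) (μ : Measure S) (φ : Measure F) (ν : Measure Y) (q : ℕ → ℝ)
    (g : F × Y × (Fin k → S) → B) (J : Finset (Fin k)) : Prop :=
  ∫⁻ a, ∫⁻ x, (∫⁻ y, ∫⁻ x', ‖g (a, y, J.piecewise x x')‖ₑ ^ r ∂(vecLaw μ k) ∂ν) ^ (q J.card / r)
    ∂(vecLaw μ k) ∂φ < ∞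

theorem momentCond_order_zero_iff {r : ℝ} {μ : Measure S} {φ : Measure F} {ν : Measure Y}
    (q : ℕ → ℝ) (g : F × Y × (Fin 0 → S) → B) :
    MomentCond r μ φ ν q g ∅ ↔ ∫⁻ a, eLpNorm' (fun y => g (a, y, ![])) r ν ^ q 0 ∂φ < ∞ := by
  simp only [MomentCond, lintegral_vecLaw_zero, Finset.card_empty, eLpNorm', ← ENNReal.rpow_mul,
    one_div_mul_eq_div]
  simp only [Subsingleton.elim (Finset.piecewise _ _ _) ![]]

variable {r : ℝ} {μ : Measure S} [IsProbabilityMeasure μ] {φ : Measure F} {ν : Measure Y}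
  [SFinite ν] [MeasurableSpace B] [OpensMeasurableSpace B] {g : F × Y × (Fin (k + 1) → S) → B}
  {J : Finset (Fin k)}

theorem MomentCond.freezeFirst (hg : Measurable g)
    (h : MomentCond r μ φ ν q g (insert 0 (J.map (Fin.succEmb k)))) :
    MomentCond r μ (φ.prod μ) ν (fun j => q (j + 1)) (freezeFirst g) J := by
  unfold MomentCond at h ⊢
  rw [card_insert_zero_map_succ] at h
  have hgF := measurable_freezeFirst hg
  rw [lintegral_prod _ (Measurable.aemeasurable (by fun_prop))]
  refine lt_of_eq_of_lt (lintegral_congr fun a => ?_) h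
  rw [lintegral_vecLaw_succ μ (by fun_prop)]
  refine lintegral_congr fun z => lintegral_congr fun x => ?_
  refine congrArg (· ^ _) (lintegral_congr fun y => ?_)
  rw [lintegral_vecLaw_succ μ (by fun_prop)]
  simp only [piecewise_insert_zero_vecCons, lintegral_const, measure_univ, mul_one]
  rfl

theorem momentCond_map_succ_iff (hg : Measurable g) :
    MomentCond r μ φ ν q g (J.map (Fin.succEmb k)) ↔
      ∫⁻ a, ∫⁻ x, (∫⁻ y, ∫⁻ z, ∫⁻ x', ‖g (a, y, vecCons z (J.piecewise x x'))‖ₑ ^ r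
        ∂(vecLaw μ k) ∂μ ∂ν) ^ (q J.card / r) ∂(vecLaw μ k) ∂φ < ∞ := by
  have hinner : ∀ a y x, ∫⁻ x', ‖g (a, y, (J.map (Fin.succEmb k)).piecewise x x')‖ₑ ^ r
      ∂(vecLaw μ (k + 1)) = ∫⁻ z, ∫⁻ x', ‖g (a, y, (J.map (Fin.succEmb k)).piecewise x
        (vecCons z x'))‖ₑ ^ r ∂(vecLaw μ k) ∂μ := fun a y x =>
    lintegral_vecLaw_succ μ (by fun_prop)
  have houter : ∀ a, ∫⁻ x, (∫⁻ y, ∫⁻ x', ‖g (a, y, (J.map (Fin.succEmb k)).piecewise x x')‖ₑ ^ r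
      ∂(vecLaw μ (k + 1)) ∂ν) ^ (q J.card / r) ∂(vecLaw μ (k + 1)) =
      ∫⁻ x, (∫⁻ y, ∫⁻ z, ∫⁻ x', ‖g (a, y, vecCons z (J.piecewise x x'))‖ₑ ^ r
        ∂(vecLaw μ k) ∂μ ∂ν) ^ (q J.card / r) ∂(vecLaw μ k) := fun a => by
    rw [lintegral_vecLaw_succ μ (by fun_prop)]
    simp only [hinner, piecewise_map_succ_vecCons, lintegral_const, measure_univ, mul_one]
  simp only [MomentCond, Finset.card_map, houter]

theorem MomentCond.normFirst (hg : Measurable g)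
    (h : MomentCond r μ φ ν q g (J.map (Fin.succEmb k))) :
    MomentCond r μ φ (ν.prod μ) q (normFirst g) J := by
  rw [momentCond_map_succ_iff hg] at h
  unfold MomentCond
  have hgI := measurable_normFirst hg
  refine lt_of_eq_of_lt (lintegral_congr fun a => lintegral_congr fun x => ?_) h
  rw [lintegral_prod _ (Measurable.aemeasurable (by fun_prop))]
  rfl

theorem enorm_integral_rpow_le [NormedSpace ℝ B] [TopologicalSpace.SeparableSpace B]
    (hr : 1 ≤ r) {f : S → B} (hf : Measurable f) :
    ‖∫ z, f z ∂μ‖ₑ ^ r ≤ ∫⁻ z, ‖f z‖ₑ ^ r ∂μ := by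
  have hr0 : 0 < r := one_pos.trans_le hr
  have hnorm : ‖∫ z, f z ∂μ‖ₑ ≤ eLpNorm' f r μ := by
    calc ‖∫ z, f z ∂μ‖ₑ ≤ ∫⁻ z, ‖f z‖ₑ ∂μ := enorm_integral_le_lintegral_enorm _
      _ = eLpNorm' f 1 μ := by simp [eLpNorm']
      _ ≤ eLpNorm' f r μ :=
        eLpNorm'_le_eLpNorm'_of_exponent_le one_pos hr μ hf.aestronglyMeasurable
  rw [lintegral_rpow_enorm_eq_rpow_eLpNorm' hr0]
  exact ENNReal.rpow_le_rpow hnorm hr0.le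

theorem MomentCond.averageFirst [NormedSpace ℝ B] [TopologicalSpace.SeparableSpace B]
    (hr : 1 ≤ r) (hg : Measurable g) (hq : 0 ≤ q J.card)
    (h : MomentCond r μ φ ν q g (J.map (Fin.succEmb k))) :
    MomentCond r μ φ ν q (averageFirst μ g) J := by
  have hr0 : 0 < r := one_pos.trans_le hr
  rw [momentCond_map_succ_iff hg] at h
  unfold MomentCond
  refine lt_of_le_of_lt (lintegral_mono fun a => lintegral_mono fun x => ?_) h
  refine ENNReal.rpow_le_rpow (lintegral_mono fun y => ?_) (by positivity)
  dsimp only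
  rw [lintegral_lintegral_swap (Measurable.aemeasurable (by fun_prop))]
  exact lintegral_mono fun x' => enorm_integral_rpow_le hr (by fun_prop)

end MomentCond

section DegenerateCond

open Matrix (vecCons)

variable {S B F Y : Type*} [MeasurableSpace S] [NormedAddCommGroup B] [NormedSpace ℝ B]
  [MeasurableSpace F] [MeasurableSpace Y] {k e : ℕ} {μ : Measure S} {φ : Measure F}
  {ν : Measure Y}

/-- Integrals of the kernel over events depending only on the parameters and on fewer than `e`
variables vanish. -/
def DegenerateCond (μ : Measure S) (φ : Measure F) (ν : Measure Y) (e : ℕ)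
    (g : F × Y × (Fin k → S) → B) : Prop :=
  ∀ T : Finset (Fin k), T.card < e → ∀ A : Set (F × Y × (Fin k → S)), MeasurableSet A →
    (∀ a y x x', (∀ i ∈ T, x i = x' i) → ((a, y, x) ∈ A ↔ (a, y, x') ∈ A)) →
    ∫ p in A, g p ∂(jointLaw μ φ ν k) = 0

theorem DegenerateCond.setIntegral_preimage_eq_zero [TopologicalSpace.SeparableSpace B]
    [MeasurableSpace B] [BorelSpace B] {X : Type*} [MeasurableSpace X] {P : Measure X}
    {T : X → F × Y × (Fin k → S)} {g : F × Y × (Fin k → S) → B} (hg : Measurable g)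
    (h : DegenerateCond μ φ ν e g) (hT : MeasurePreserving T P (jointLaw μ φ ν k))
    {J : Finset (Fin k)} (hJ : J.card < e) {A : Set (F × Y × (Fin k → S))} (hA : MeasurableSet A)
    (hAJ : ∀ a y x x', (∀ i ∈ J, x i = x' i) → ((a, y, x) ∈ A ↔ (a, y, x') ∈ A)) :
    ∫ p in T ⁻¹' A, g (T p) ∂P = 0 := by
  rw [← h J hJ A hA hAJ, ← hT.map_eq,
    setIntegral_map hA hg.aestronglyMeasurable hT.measurable.aemeasurable]

variable [IsProbabilityMeasure μ] [SFinite ν]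

theorem ae_ae_of_ae_jointLaw_zero {Q : F × Y × (Fin 0 → S) → Prop}
    (hQ : ∀ᵐ p ∂(jointLaw μ φ ν 0), Q p) : ∀ᵐ a ∂φ, ∀ᵐ y ∂ν, Q (a, y, ![]) := by
  filter_upwards [Measure.ae_ae_of_ae_prod hQ] with a ha
  filter_upwards [Measure.ae_ae_of_ae_prod ha] with y hy
  obtain ⟨v, hv⟩ := hy.exists
  rwa [Subsingleton.elim ![] v]

theorem DegenerateCond.ae_eq_zero [CompleteSpace B] {g : F × Y × (Fin 0 → S) → B}
    (hgi : Integrable g (jointLaw μ φ ν 0)) (h : DegenerateCond μ φ ν e g) (he : 0 < e) :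
    ∀ᵐ a ∂φ, ∀ᵐ y ∂ν, g (a, y, ![]) = 0 := by
  have hzero : g =ᵐ[jointLaw μ φ ν 0] 0 := by
    refine hgi.ae_eq_zero_of_forall_setIntegral_eq_zero fun A hA _ => ?_
    exact h ∅ (by simpa using he) A hA fun a y x x' _ => by rw [Subsingleton.elim x x']
  exact ae_ae_of_ae_jointLaw_zero hzero

variable [TopologicalSpace.SeparableSpace B] [MeasurableSpace B] [BorelSpace B]
  {g : F × Y × (Fin (k + 1) → S) → B}

theorem DegenerateCond.freezeFirst (hg : Measurable g) (h : DegenerateCond μ φ ν e g) :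
    DegenerateCond μ (φ.prod μ) ν (e - 1) (freezeFirst g) := by
  intro T hT A hA hAT
  have hsplit : Measurable fun p : F × Y × (Fin (k + 1) → S) =>
      ((p.1, p.2.2 0), p.2.1, fun i : Fin k => p.2.2 i.succ) := by fun_prop
  refine h.setIntegral_preimage_eq_zero hg (measurePreserving_freezeFirst μ φ ν)
    (J := insert 0 (T.map (Fin.succEmb k))) (by rw [card_insert_zero_map_succ]; omega)
    (hsplit hA) fun a y x x' hx => ?_
  simp only [Set.mem_preimage]
  rw [hx 0 (by simp)]
  exact hAT _ _ _ _ fun i hi => hx i.succ (by simp [hi])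

theorem DegenerateCond.normFirst (hg : Measurable g) (h : DegenerateCond μ φ ν e g) :
    DegenerateCond μ φ (ν.prod μ) (e - 1) (normFirst g) := by
  intro T hT A hA hAT
  have hsplit : Measurable fun p : F × Y × (Fin (k + 1) → S) =>
      (p.1, (p.2.1, p.2.2 0), fun i : Fin k => p.2.2 i.succ) := by fun_prop
  refine h.setIntegral_preimage_eq_zero hg (measurePreserving_normFirst μ φ ν)
    (J := insert 0 (T.map (Fin.succEmb k))) (by rw [card_insert_zero_map_succ]; omega)
    (hsplit hA) fun a y x x' hx => ?_
  simp only [Set.mem_preimage]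
  rw [hx 0 (by simp)]
  exact hAT _ _ _ _ fun i hi => hx i.succ (by simp [hi])

theorem DegenerateCond.averageFirst [SFinite φ] (hg : Measurable g)
    (hgi : Integrable g (jointLaw μ φ ν (k + 1))) (h : DegenerateCond μ φ ν e g) :
    DegenerateCond μ φ ν e (averageFirst μ g) := by
  intro T hT A hA hAT
  have htail : Measurable fun p : F × Y × (Fin (k + 1) → S) =>
      (p.1, p.2.1, fun i : Fin k => p.2.2 i.succ) := by fun_prop
  have hzero := h.setIntegral_preimage_eq_zero hg (measurePreserving_averageFirst μ φ ν)
    (J := T.map (Fin.succEmb k)) (by rwa [Finset.card_map]) (htail hA) fun a y x x' hx =>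
      hAT _ _ _ _ fun i hi => hx i.succ (by simp [hi])
  have hint := (measurePreserving_averageFirst μ φ ν).integrable_comp_of_integrable hgi
  have hprod := setIntegral_prod (s := A) (t := Set.univ) _ hint.integrableOn
  simp only [Measure.restrict_univ] at hprod
  rw [Set.prod_univ] at hprod
  exact hprod.symm.trans hzero

end DegenerateCond

/-! ### Kernels with high moments -/

section HighMoments

theorem maxTail_order_zero {S B F Y : Type*} [MeasurableSpace S] [NormedAddCommGroup B]
    [MeasurableSpace F] [MeasurableSpace Y] {μ : Measure S} [IsProbabilityMeasure μ] (r : ℝ)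
    (φ : Measure F) (ν : Measure Y) (g : F × Y × (Fin 0 → S) → B) (N : ℕ) (t : ℝ) :
    maxTail r μ φ ν g N t =
      φ {a | ENNReal.ofReal t < eLpNorm' (fun y => g (a, y, ![])) r ν} := by
  have hset : {p : F × (ℕ → S) | ∃ n ≤ N, ENNReal.ofReal t < uNorm r ν g n p} =
      {a | ENNReal.ofReal t < eLpNorm' (fun y => g (a, y, ![])) r ν} ×ˢ Set.univ := by
    ext p
    simp only [uNorm, kernelSum_order_zero, Set.mem_prod, Set.mem_univ, and_true]
    exact ⟨fun ⟨_, _, h⟩ => h, fun h => ⟨0, Nat.zero_le _, h⟩⟩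
  rw [maxTail, hset, Measure.prod_prod, measure_univ, mul_one]

universe u v

variable {S : Type u} {B : Type v} [MeasurableSpace S] [NormedAddCommGroup B] [NormedSpace ℝ B]
  [CompleteSpace B] [MeasurableSpace B] [BorelSpace B] {μ : Measure S} [IsProbabilityMeasure μ]
  {r C : ℝ}

theorem dyadicTail_order_zero_lt_top {F Y : Type*} [MeasurableSpace F] [MeasurableSpace Y]
    {φ : Measure F} {ν : Measure Y} [SFinite ν]
    {g : F × Y × (Fin 0 → S) → B} (hr : 0 < r) (hg : Measurable g)
    (hgi : Integrable g (jointLaw μ φ ν 0)) {q : ℕ → ℝ} {e : ℕ} {ρ τ : ℝ} (hρ : 0 < ρ)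
    (hE : ExponentCond r 0 e ρ τ q) (hM : e ≤ 0 → ∀ J, MomentCond r μ φ ν q g J)
    (hD : DegenerateCond μ φ ν e g) {η : ℝ} (hη : 0 ≤ η) (hηq : η * 2 ^ q 0 < 1) {ε : ℝ}
    (hε : 0 < ε) : dyadicTail r η μ φ ν ρ τ g ε < ∞ := by
  simp only [dyadicTail, geomTail, maxTail_order_zero]
  rcases Nat.eq_zero_or_pos e with he | he
  · have hnorm : Measurable fun a => eLpNorm' (fun y => g (a, y, ![])) r ν :=
      measurable_eLpNorm' r ν (f := fun a y => g (a, y, ![])) (by fun_prop)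
    have hexp := hE 0 0 0 rfl (by omega)
    simp only [Nat.cast_zero, zero_div, sub_zero, add_zero] at hexp
    exact tsum_dyadic_geometric_lt_top hρ hexp.1 hexp.2 hη hηq hε φ hnorm
      ((momentCond_order_zero_iff _ _).1 (hM he.le ∅))
  · have hnull : ∀ t : ℝ, φ {a | ENNReal.ofReal t < eLpNorm' (fun y => g (a, y, ![])) r ν} = 0 := by
      refine fun t => measure_mono_null (t := {a | ¬ ∀ᵐ y ∂ν, g (a, y, ![]) = 0})
        (fun a ha hz => ?_) (hD.ae_eq_zero hgi he)
      have hnorm : eLpNorm' (fun y => g (a, y, ![])) r ν = 0 := by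
        rw [eLpNorm'_congr_ae (g := 0) hz, eLpNorm'_zero hr]
      exact absurd (hnorm ▸ ha.out) not_lt_zero
    simp [hnull]

variable [TopologicalSpace.SeparableSpace B]

theorem dyadicTail_lt_top_of_momentCond (hr : 1 < r) (hC0 : 0 < C)
    (hC : IsMartingaleTypeConst B μ r C) {η : ℝ} (hη : 0 < η) (hη1 : η < 1) (k : ℕ) :
    ∀ {F Y : Type u} [MeasurableSpace F] [MeasurableSpace Y] (φ : Measure F)
      [IsProbabilityMeasure φ] (ν : Measure Y) [IsProbabilityMeasure ν]
      {g : F × Y × (Fin k → S) → B} {q : ℕ → ℝ} {e : ℕ} {ρ τ ε : ℝ},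
      Measurable g → Integrable g (jointLaw μ φ ν k) → 0 < ρ → (∀ j ≤ k, 0 ≤ q j) →
      (∀ j ≤ k, η * 2 ^ q j < 1) → ExponentCond r k e ρ τ q →
      (e ≤ k → ∀ J, MomentCond r μ φ ν q g J) → DegenerateCond μ φ ν e g → 0 < ε →
      dyadicTail r η μ φ ν ρ τ g ε < ∞ := by
  have hr0 : 0 < r := one_pos.trans hr
  obtain ⟨δ, hδ, hδ4, hδη⟩ := exists_mul_rpow_two_mul_le (C := C) hr0 hC0 hη
  induction k with
  | zero =>
    intro F Y _ _ φ _ ν _ g q e ρ τ ε hg hgi hρ _ hηq hE hM hD hε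
    exact dyadicTail_order_zero_lt_top hr0 hg hgi hρ hE hM hD hη.le (hηq 0 le_rfl) hε
  | succ k ih =>
    intro F Y _ _ φ _ ν _ g q e ρ τ ε hg hgi hρ hq hηq hE hM hD hε
    refine (dyadicTail_le hr hC0 hC hη hη1 hδ hδ4 hδη hg hgi ρ τ hε).trans_lt ?_
    refine ENNReal.mul_lt_top (by simp) (ENNReal.add_lt_top.2 ⟨ENNReal.add_lt_top.2 ⟨?_, ?_⟩, ?_⟩)
    · exact ih (φ.prod μ) ν (measurable_freezeFirst hg) (integrable_freezeFirst hgi) (by linarith)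
        (fun j hj => hq (j + 1) (by omega)) (fun j hj => hηq (j + 1) (by omega)) hE.freezeFirst
        (fun he J => (hM (by omega) _).freezeFirst hg) (hD.freezeFirst hg) (by positivity)
    · exact ih φ (ν.prod μ) (measurable_normFirst hg) (integrable_normFirst hgi) hρ
        (fun j hj => hq j (by omega)) (fun j hj => hηq j (by omega)) hE.normFirst
        (fun he J => (hM (by omega) _).normFirst hg) (hD.normFirst hg) (by positivity)
    · exact ih φ ν (measurable_averageFirst μ hg) (integrable_averageFirst hgi) hρ
        (fun j hj => hq j (by omega)) (fun j hj => hηq j (by omega)) hE.averageFirst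
        (fun he J => (hM (by omega) _).averageFirst hr.le hg
          (hq _ ((Finset.card_le_univ J).trans (by simp)))) (hD.averageFirst hg hgi) (by positivity)

end HighMoments

/-! ### Truncation of kernels of order one -/

section Minkowski

theorem le_rpow_of_le_mul_rpow {r q : ℝ} (hrq : r.HolderConjugate q) {I M : ℝ≥0∞} (hI : I ≠ ∞)
    (h : I ≤ M * I ^ (1 / q)) : I ≤ M ^ r := by
  rcases eq_or_ne I 0 with rfl | hI0
  · exact zero_le
  have hsplit : I = I ^ (1 / r) * I ^ (1 / q) := by
    rw [← ENNReal.rpow_add _ _ hI0 hI, one_div, one_div, hrq.inv_add_inv_eq_one, ENNReal.rpow_one]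
  have hroot : I ^ (1 / r) ≤ M := by
    refine (ENNReal.mul_le_mul_iff_left (c := I ^ (1 / q)) ?_ ?_).1 (hsplit ▸ h)
    · simp [ENNReal.rpow_eq_zero_iff, hI0, hI]
    · exact ENNReal.rpow_ne_top_of_nonneg (one_div_nonneg.2 hrq.symm.nonneg) hI
  calc I = (I ^ (1 / r)) ^ r := by
        rw [← ENNReal.rpow_mul, one_div_mul_cancel hrq.ne_zero, ENNReal.rpow_one]
    _ ≤ M ^ r := ENNReal.rpow_le_rpow hroot hrq.nonneg

variable {S Y : Type*} [MeasurableSpace S] [MeasurableSpace Y] {μ : Measure S} [SFinite μ]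
  {ν : Measure Y} {r : ℝ} {f : S × Y → ℝ≥0∞}

theorem lintegral_rpow_le_of_le_lintegral [SFinite ν] (hr : 1 < r) (hf : Measurable f)
    {h : Y → ℝ≥0∞} (hh : Measurable h) (hhf : ∀ y, h y ≤ ∫⁻ z, f (z, y) ∂μ)
    (hfin : ∫⁻ y, h y ^ r ∂ν ≠ ∞) :
    ∫⁻ y, h y ^ r ∂ν ≤ (∫⁻ z, (∫⁻ y, f (z, y) ^ r ∂ν) ^ (1 / r) ∂μ) ^ r := by
  have hrq : r.HolderConjugate (r / (r - 1)) := Real.HolderConjugate.conjExponent hr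
  refine le_rpow_of_le_mul_rpow hrq hfin ?_
  calc ∫⁻ y, h y ^ r ∂ν ≤ ∫⁻ y, ∫⁻ z, f (z, y) * h y ^ (r - 1) ∂μ ∂ν := by
        refine lintegral_mono fun y => ?_
        rw [lintegral_mul_const _ (by fun_prop)]
        calc h y ^ r = h y ^ (1 : ℝ) * h y ^ (r - 1) := by
              rw [← ENNReal.rpow_add_of_nonneg _ _ zero_le_one (by linarith), add_sub_cancel]
          _ ≤ (∫⁻ z, f (z, y) ∂μ) * h y ^ (r - 1) := by
              rw [ENNReal.rpow_one]
              gcongr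
              exact hhf y
    _ = ∫⁻ z, ∫⁻ y, f (z, y) * h y ^ (r - 1) ∂ν ∂μ :=
        lintegral_lintegral_swap (Measurable.aemeasurable (by fun_prop))
    _ ≤ ∫⁻ z, (∫⁻ y, f (z, y) ^ r ∂ν) ^ (1 / r) *
          (∫⁻ y, h y ^ r ∂ν) ^ (1 / (r / (r - 1))) ∂μ :=
        lintegral_mono fun z => ENNReal.lintegral_mul_rpow_le_lintegral_rpow_mul_lintegral_rpow hrq
          (f := fun y => f (z, y)) (Measurable.aemeasurable (by fun_prop)) hh.aemeasurable
    _ = _ := lintegral_mul_const _ (by fun_prop)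

variable [IsFiniteMeasure ν]

theorem lintegral_rpow_lintegral_le (hr : 1 < r) (hf : Measurable f) :
    ∫⁻ y, (∫⁻ z, f (z, y) ∂μ) ^ r ∂ν ≤ (∫⁻ z, (∫⁻ y, f (z, y) ^ r ∂ν) ^ (1 / r) ∂μ) ^ r := by
  have hr0 : 0 < r := one_pos.trans hr
  set G : Y → ℝ≥0∞ := fun y => ∫⁻ z, f (z, y) ∂μ
  have hG : Measurable G := by fun_prop
  have hmin : ∀ n : ℕ, Measurable fun y => min (G y) n := fun n => hG.min measurable_const
  have hsup : ∀ y, G y ^ r = ⨆ n : ℕ, min (G y) n ^ r := fun y => by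
    have hGy : G y = ⨆ n : ℕ, min (G y) (n : ℝ≥0∞) := by
      rw [← inf_iSup_eq, ENNReal.iSup_natCast, inf_top_eq]
    conv_lhs => rw [hGy]
    exact (ENNReal.orderIsoRpow r hr0).map_iSup _
  change ∫⁻ y, G y ^ r ∂ν ≤ _
  simp only [hsup]
  rw [lintegral_iSup (fun n => (hmin n).pow_const r) fun n n' hn y =>
    ENNReal.rpow_le_rpow (min_le_min le_rfl (by exact_mod_cast hn)) hr0.le]
  refine iSup_le fun n => lintegral_rpow_le_of_le_lintegral hr hf (hmin n)
    (fun y => min_le_left _ _) (ne_top_of_le_ne_top (b := ∫⁻ _, (n : ℝ≥0∞) ^ r ∂ν) ?_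
      (lintegral_mono fun y => ENNReal.rpow_le_rpow (min_le_right _ _) hr0.le))
  rw [lintegral_const]
  exact ENNReal.mul_ne_top (ENNReal.rpow_ne_top_of_nonneg hr0.le (by simp)) (by simp)

theorem eLpNorm'_integral_le {B : Type*} [NormedAddCommGroup B] [NormedSpace ℝ B]
    [MeasurableSpace B] [OpensMeasurableSpace B] (hr : 1 < r) {f : S → Y → B}
    (hf : Measurable fun p : S × Y => f p.1 p.2) :
    eLpNorm' (fun y => ∫ z, f z y ∂μ) r ν ≤ ∫⁻ z, eLpNorm' (f z) r ν ∂μ := by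
  have hr0 : 0 < r := one_pos.trans hr
  rw [← ENNReal.rpow_le_rpow_iff hr0, ← lintegral_rpow_enorm_eq_rpow_eLpNorm' hr0]
  calc ∫⁻ y, ‖∫ z, f z y ∂μ‖ₑ ^ r ∂ν ≤ ∫⁻ y, (∫⁻ z, ‖f z y‖ₑ ∂μ) ^ r ∂ν := by
        gcongr with y
        exact enorm_integral_le_lintegral_enorm _
    _ ≤ _ := lintegral_rpow_lintegral_le hr (f := fun p => ‖f p.1 p.2‖ₑ) hf.enorm

end Minkowski

section Pointwise

variable {H : ℝ≥0∞} {q t : ℝ}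

theorem le_rpow_one_sub_mul_rpow_of_le (ht : 0 < t) (hq : 0 ≤ q) (hq1 : q ≤ 1)
    (hH : H ≤ ENNReal.ofReal t) : H ≤ ENNReal.ofReal (t ^ (1 - q)) * H ^ q := by
  calc H = H ^ (1 - q) * H ^ q := by
        rw [← ENNReal.rpow_add_of_nonneg _ _ (by linarith) hq, sub_add_cancel, ENNReal.rpow_one]
    _ ≤ ENNReal.ofReal (t ^ (1 - q)) * H ^ q := by
        rw [← ENNReal.ofReal_rpow_of_pos ht]
        gcongr

theorem le_rpow_one_sub_mul_rpow_of_lt (ht : 0 < t) (hq : 1 ≤ q) (hH : ENNReal.ofReal t < H) :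
    H ≤ ENNReal.ofReal (t ^ (1 - q)) * H ^ q := by
  rcases eq_or_ne H ∞ with rfl | hH'
  · rw [ENNReal.top_rpow_of_pos (by linarith), ENNReal.mul_top (by simpa using by positivity)]
  calc H = H ^ (1 - q) * H ^ q := by
        rw [← ENNReal.rpow_add _ _ (zero_le.trans_lt hH).ne' hH', sub_add_cancel, ENNReal.rpow_one]
    _ ≤ ENNReal.ofReal (t ^ (1 - q)) * H ^ q := by
        rw [← ENNReal.ofReal_rpow_of_pos ht]
        refine mul_le_mul_left ?_ _
        rw [← neg_sub, ENNReal.rpow_neg, ENNReal.rpow_neg, ENNReal.inv_le_inv]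
        exact ENNReal.rpow_le_rpow hH.le (by linarith)

theorem le_one_add_rpow (hq : 1 ≤ q) : H ≤ 1 + H ^ q := by
  rcases le_total H 1 with hH | hH
  · exact hH.trans le_self_add
  · calc H = H ^ (1 : ℝ) := (ENNReal.rpow_one H).symm
      _ ≤ H ^ q := ENNReal.rpow_le_rpow_of_exponent_le hH hq
      _ ≤ 1 + H ^ q := le_add_self

theorem rpow_le_mul_tsum_ite {r : ℝ} (ht : 0 < t) (hr : 0 < r) (hH : H ≤ ENNReal.ofReal t) :
    H ^ r ≤ ENNReal.ofReal (t ^ r) * ∑' i : ℕ,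
      if ENNReal.ofReal (t / 2 / 2 ^ i) < H then ENNReal.ofReal ((2 ^ (-r)) ^ i) else 0 := by
  rcases eq_or_ne H 0 with rfl | hH0
  · simp [hr]
  obtain ⟨u, rfl⟩ : ∃ u : ℝ, H = ENNReal.ofReal u :=
    ⟨H.toReal, (ENNReal.ofReal_toReal (ne_top_of_le_ne_top ENNReal.ofReal_ne_top hH)).symm⟩
  have hu : 0 < u := by simpa using hH0
  have hut : u ≤ t := (ENNReal.ofReal_le_ofReal_iff ht.le).1 hH
  obtain ⟨i, hlower, hupper⟩ := exists_nat_pow_near_of_lt_one (x := u / t) (y := (1 / 2 : ℝ))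
    (by positivity) ((div_le_one ht).2 hut) (by norm_num) (by norm_num)
  have hlevel : t / 2 / 2 ^ i < u := by
    calc t / 2 / 2 ^ i = (1 / 2) ^ (i + 1) * t := by rw [one_div, inv_pow, pow_succ]; field_simp
      _ < u := (lt_div_iff₀ ht).1 hlower
  have hpow : u ^ r ≤ t ^ r * (2 ^ (-r)) ^ i := by
    calc u ^ r = t ^ r * (u / t) ^ r := by
          rw [Real.div_rpow hu.le ht.le, mul_div_cancel₀ _ (by positivity)]
      _ ≤ t ^ r * ((1 / 2) ^ i) ^ r := by gcongr
      _ = t ^ r * (2 ^ (-r)) ^ i := by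
          rw [← Real.rpow_pow_comm (by norm_num), one_div, Real.inv_rpow (by norm_num),
            Real.rpow_neg (by norm_num)]
  rw [ENNReal.ofReal_rpow_of_pos hu]
  calc ENNReal.ofReal (u ^ r) ≤ ENNReal.ofReal (t ^ r) * ENNReal.ofReal ((2 ^ (-r)) ^ i) := by
        rw [← ENNReal.ofReal_mul (by positivity)]
        exact ENNReal.ofReal_le_ofReal hpow
    _ ≤ _ := by
        gcongr
        refine le_trans ?_ (ENNReal.le_tsum i)
        rw [if_pos ((ENNReal.ofReal_lt_ofReal_iff hu).2 hlevel)]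

end Pointwise

section Truncation

variable {S B F Y : Type*} [MeasurableSpace Y] [NormedAddCommGroup B] {r : ℝ} {ν : Measure Y}

/-- The `L^r(ν)` norm of a kernel of order one, as a function of its parameter and variable. -/
noncomputable def firstNorm (r : ℝ) (ν : Measure Y) (g : F × Y × (Fin 1 → S) → B) (p : F × S) :
    ℝ≥0∞ :=
  eLpNorm' (fun y => freezeFirst g (p, y, ![])) r ν

theorem firstNorm_indicator (hr : 0 < r) (A : Set (F × S)) (g : F × Y × (Fin 1 → S) → B) :
    firstNorm r ν (((fun p : F × Y × (Fin 1 → S) => (p.1, p.2.2 0)) ⁻¹' A).indicator g) =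
      A.indicator (firstNorm r ν g) := by
  ext p
  by_cases hp : p ∈ A
  · simp [firstNorm, freezeFirst, Set.indicator, hp]
  · simp [firstNorm, freezeFirst, Set.indicator, hp, eLpNorm', hr]

/-- The restriction of a kernel of order one to the event that its norm is at most `t`. -/
noncomputable def truncateFirst (r : ℝ) (ν : Measure Y) (t : ℝ) (g : F × Y × (Fin 1 → S) → B) :
    F × Y × (Fin 1 → S) → B :=
  ((fun p => (p.1, p.2.2 0)) ⁻¹' {p | firstNorm r ν g p ≤ ENNReal.ofReal t}).indicator g

theorem firstNorm_truncateFirst (hr : 0 < r) (g : F × Y × (Fin 1 → S) → B) (t : ℝ) :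
    firstNorm r ν (truncateFirst r ν t g) =
      {p | firstNorm r ν g p ≤ ENNReal.ofReal t}.indicator (firstNorm r ν g) :=
  firstNorm_indicator hr _ g

theorem firstNorm_sub_truncateFirst (hr : 0 < r) (g : F × Y × (Fin 1 → S) → B) (t : ℝ) :
    firstNorm r ν (g - truncateFirst r ν t g) =
      {p | firstNorm r ν g p ≤ ENNReal.ofReal t}ᶜ.indicator (firstNorm r ν g) := by
  rw [truncateFirst, ← Set.indicator_compl, ← Set.preimage_compl, firstNorm_indicator hr]

theorem firstNorm_truncateFirst_le (hr : 0 < r) (g : F × Y × (Fin 1 → S) → B) (t : ℝ) :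
    firstNorm r ν (truncateFirst r ν t g) ≤ firstNorm r ν g := by
  rw [firstNorm_truncateFirst hr]
  exact Set.indicator_le_self _ _

variable [MeasurableSpace S] [MeasurableSpace F] {μ : Measure S} {φ : Measure F}

section Measurability

variable [MeasurableSpace B] [BorelSpace B] {g : F × Y × (Fin 1 → S) → B}

theorem measurable_firstNorm [SFinite ν] (hg : Measurable g) : Measurable (firstNorm r ν g) := by
  have hgF := measurable_freezeFirst hg
  exact measurable_eLpNorm' r ν (f := fun p y => freezeFirst g (p, y, ![])) (by fun_prop)

theorem measurableSet_firstNorm_le [SFinite ν] (hg : Measurable g) (t : ℝ) :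
    MeasurableSet ((fun p : F × Y × (Fin 1 → S) => (p.1, p.2.2 0)) ⁻¹'
      {p | firstNorm r ν g p ≤ ENNReal.ofReal t}) :=
  measurableSet_preimage (by fun_prop) (measurableSet_le (measurable_firstNorm hg) measurable_const)

theorem measurable_truncateFirst [SFinite ν] (hg : Measurable g) (t : ℝ) :
    Measurable (truncateFirst r ν t g) :=
  hg.indicator (measurableSet_firstNorm_le hg t)

theorem integrable_truncateFirst [SFinite ν] (hg : Measurable g)
    (hgi : Integrable g (jointLaw μ φ ν 1)) (t : ℝ) :
    Integrable (truncateFirst r ν t g) (jointLaw μ φ ν 1) :=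
  hgi.indicator (measurableSet_firstNorm_le hg t)

end Measurability

variable [IsProbabilityMeasure μ]

theorem maxTail_freezeFirst_order_one (g : F × Y × (Fin 1 → S) → B) (N : ℕ) (t : ℝ) :
    maxTail r μ (φ.prod μ) ν (freezeFirst g) N t =
      (φ.prod μ) {p | ENNReal.ofReal t < firstNorm r ν g p} :=
  maxTail_order_zero r (φ.prod μ) ν (freezeFirst g) N t

theorem maxTail_freezeFirst_truncateFirst_le (hr : 0 < r) (g : F × Y × (Fin 1 → S) → B) (t : ℝ)
    (N : ℕ) (s : ℝ) :
    maxTail r μ (φ.prod μ) ν (freezeFirst (truncateFirst r ν t g)) N s ≤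
      maxTail r μ (φ.prod μ) ν (freezeFirst g) N s := by
  rw [maxTail_freezeFirst_order_one, maxTail_freezeFirst_order_one]
  exact measure_mono fun p hp => lt_of_lt_of_le hp (firstNorm_truncateFirst_le hr g t p)

theorem maxTail_le_add_maxTail_truncateFirst [TopologicalSpace.SeparableSpace B]
    [MeasurableSpace B] [BorelSpace B] [SFinite φ] [SFinite ν] {g : F × Y × (Fin 1 → S) → B}
    (hg : Measurable g) (N : ℕ) (s t : ℝ) :
    maxTail r μ φ ν g N s ≤ N * maxTail r μ (φ.prod μ) ν (freezeFirst g) N t +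
      maxTail r μ φ ν (truncateFirst r ν t g) N s := by
  refine le_trans ?_ (add_le_add (measure_exists_lt_uNorm_freezeFirst_le r hg N t) le_rfl)
  refine le_trans (measure_mono ?_) (measure_union_le _ _)
  rintro p ⟨n, hn, hp⟩
  by_cases hlarge : ∃ j < N, ENNReal.ofReal t < uNorm r ν (freezeFirst g) j ((p.1, p.2 j), p.2)
  · exact Or.inl hlarge
  refine Or.inr ⟨n, hn, hp.trans_eq ?_⟩
  push Not at hlarge
  unfold uNorm
  congr 1
  ext y
  rw [kernelSum_eq_sum_head, kernelSum_eq_sum_head]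
  refine Finset.sum_congr rfl fun j hj => ?_
  rw [kernelSum_order_zero, kernelSum_order_zero]
  have hsmall : firstNorm r ν g (p.1, p.2 j) ≤ ENNReal.ofReal t := by
    simpa only [uNorm, kernelSum_order_zero, firstNorm] using
      hlarge j ((Finset.mem_range.1 hj).trans_le hn)
  exact (Set.indicator_of_mem (by simpa using hsmall) g).symm

end Truncation

section NormOfTruncation

variable {S B F Y : Type*} [MeasurableSpace S] [MeasurableSpace F] [MeasurableSpace Y]
  [NormedAddCommGroup B] [MeasurableSpace B] [BorelSpace B] {μ : Measure S} {φ : Measure F}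
  {ν : Measure Y} {r : ℝ} {g : F × Y × (Fin 1 → S) → B}

theorem measure_ofReal_lt_le (hr : 0 < r) {X : F → ℝ≥0∞} (hX : Measurable X) {s : ℝ}
    (hs : 0 < s) :
    φ {a | ENNReal.ofReal s < X a} ≤ ENNReal.ofReal (s ^ (-r)) * ∫⁻ a, X a ^ r ∂φ := by
  have hsr : ENNReal.ofReal (s ^ r) ≠ 0 := by simpa using by positivity
  refine (ENNReal.mul_le_mul_iff_right hsr ENNReal.ofReal_ne_top).1 ?_
  calc ENNReal.ofReal (s ^ r) * φ {a | ENNReal.ofReal s < X a}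
      ≤ ENNReal.ofReal s ^ r * φ {a | ENNReal.ofReal s ^ r ≤ X a ^ r} := by
        rw [ENNReal.ofReal_rpow_of_pos hs]
        gcongr
        intro ha
        rw [← ENNReal.ofReal_rpow_of_pos hs]
        exact ENNReal.rpow_le_rpow ha.le hr.le
    _ ≤ ∫⁻ a, X a ^ r ∂φ := mul_meas_ge_le_lintegral (hX.pow_const r) _
    _ = ENNReal.ofReal (s ^ r) * (ENNReal.ofReal (s ^ (-r)) * ∫⁻ a, X a ^ r ∂φ) := by
        rw [← mul_assoc, ← ENNReal.ofReal_mul (by positivity), ← Real.rpow_add hs, add_neg_cancel,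
          Real.rpow_zero, ENNReal.ofReal_one, one_mul]

variable [SFinite ν]

theorem eLpNorm'_normFirst_rpow [SFinite μ] (hr : 0 < r) (hg : Measurable g) (a : F) :
    eLpNorm' (fun y => normFirst g (a, y, ![])) r (ν.prod μ) ^ r =
      ∫⁻ z, firstNorm r ν g (a, z) ^ r ∂μ := by
  have hgI := measurable_normFirst hg
  rw [← lintegral_rpow_enorm_eq_rpow_eLpNorm' hr, lintegral_prod_symm' _ (by fun_prop)]
  refine lintegral_congr fun z => ?_
  rw [firstNorm, ← lintegral_rpow_enorm_eq_rpow_eLpNorm' hr]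
  rfl

theorem lintegral_firstNorm_truncateFirst_rpow_le (hr : 0 < r) (hg : Measurable g)
    {t : ℝ} (ht : 0 < t) :
    ∫⁻ p, firstNorm r ν (truncateFirst r ν t g) p ^ r ∂(φ.prod μ) ≤
      ENNReal.ofReal (t ^ r) * ∑' i : ℕ, ENNReal.ofReal ((2 ^ (-r)) ^ i) *
        (φ.prod μ) {p | ENNReal.ofReal (t / 2 / 2 ^ i) < firstNorm r ν g p} := by
  have hset : ∀ i : ℕ, MeasurableSet {p | ENNReal.ofReal (t / 2 / 2 ^ i) < firstNorm r ν g p} :=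
    fun i => measurableSet_lt measurable_const (measurable_firstNorm hg)
  calc ∫⁻ p, firstNorm r ν (truncateFirst r ν t g) p ^ r ∂(φ.prod μ)
      ≤ ∫⁻ p, ENNReal.ofReal (t ^ r) * ∑' i : ℕ,
          (if ENNReal.ofReal (t / 2 / 2 ^ i) < firstNorm r ν g p then
            ENNReal.ofReal ((2 ^ (-r)) ^ i) else 0) ∂(φ.prod μ) := by
        refine lintegral_mono fun p => ?_
        rw [firstNorm_truncateFirst hr]
        by_cases hp : firstNorm r ν g p ≤ ENNReal.ofReal t
        · simpa only [Set.indicator_apply, Set.mem_ofPred_eq, hp, if_true] using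
            rpow_le_mul_tsum_ite ht hr hp
        · simp [hp, hr]
    _ = _ := by
        rw [lintegral_const_mul' _ _ ENNReal.ofReal_ne_top, lintegral_tsum fun i =>
          (Measurable.ite (hset i) measurable_const measurable_const).aemeasurable]
        refine congrArg _ (tsum_congr fun i => ?_)
        rw [← lintegral_indicator_const (hset i)]
        simp only [Set.indicator_apply, Set.mem_ofPred_eq]

theorem maxTail_normFirst_truncateFirst_le [IsProbabilityMeasure μ] (hr : 0 < r)
    (hg : Measurable g) {t s : ℝ} (ht : 0 < t) (hs : 0 < s) (N : ℕ) :
    maxTail r μ φ (ν.prod μ) (normFirst (truncateFirst r ν t g)) N s ≤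
      ENNReal.ofReal ((t / s) ^ r) * ∑' i : ℕ, ENNReal.ofReal ((2 ^ (-r)) ^ i) *
        (φ.prod μ) {p | ENNReal.ofReal (t / 2 / 2 ^ i) < firstNorm r ν g p} := by
  have hg' : Measurable (truncateFirst r ν t g) := measurable_truncateFirst hg t
  have hgI := measurable_normFirst hg'
  have hnorm := measurable_firstNorm (r := r) (ν := ν) hg'
  rw [maxTail_order_zero]
  refine (measure_ofReal_lt_le hr (measurable_eLpNorm' r (ν.prod μ) (f := fun a y =>
    normFirst (truncateFirst r ν t g) (a, y, ![])) (by fun_prop)) hs).trans ?_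
  simp only [eLpNorm'_normFirst_rpow hr hg']
  rw [← lintegral_prod (fun p => firstNorm r ν (truncateFirst r ν t g) p ^ r)
    (hnorm.pow_const r).aemeasurable]
  refine (mul_le_mul_right (lintegral_firstNorm_truncateFirst_rpow_le hr hg ht) _).trans_eq ?_
  rw [← mul_assoc, ← ENNReal.ofReal_mul (by positivity), Real.div_rpow ht.le hs.le,
    Real.rpow_neg hs.le, inv_mul_eq_div]

end NormOfTruncation

section MeanOfTruncation

open Matrix (vecCons)

variable {S B F Y : Type*} [MeasurableSpace S] [MeasurableSpace F] [MeasurableSpace Y]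
  [NormedAddCommGroup B] [NormedSpace ℝ B] [MeasurableSpace B] [BorelSpace B] {μ : Measure S}
  {φ : Measure F} {ν : Measure Y} [IsFiniteMeasure ν] {r q : ℝ} {g : F × Y × (Fin 1 → S) → B}

theorem eLpNorm'_averageFirst_le_lintegral_firstNorm [SFinite μ] (hr : 1 < r) (hg : Measurable g)
    (a : F) :
    eLpNorm' (fun y => averageFirst μ g (a, y, ![])) r ν ≤ ∫⁻ z, firstNorm r ν g (a, z) ∂μ :=
  eLpNorm'_integral_le hr (f := fun z y => g (a, y, vecCons z ![])) (by fun_prop)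

theorem eLpNorm'_averageFirst_le_mul [SFinite μ] (hr : 1 < r) (hg : Measurable g) {a : F} {c : ℝ}
    {H : S → ℝ≥0∞} (hH : ∀ z, firstNorm r ν g (a, z) ≤ ENNReal.ofReal c * H z) :
    eLpNorm' (fun y => averageFirst μ g (a, y, ![])) r ν ≤ ENNReal.ofReal c * ∫⁻ z, H z ∂μ := by
  rw [← lintegral_const_mul' _ _ ENNReal.ofReal_ne_top]
  exact (eLpNorm'_averageFirst_le_lintegral_firstNorm hr hg a).trans (lintegral_mono hH)

variable [IsProbabilityMeasure μ]

theorem eLpNorm'_averageFirst_truncateFirst_le_one_add (hr : 1 < r) (hg : Measurable g)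
    (hq : 1 ≤ q) (t : ℝ) (a : F) :
    eLpNorm' (fun y => averageFirst μ (truncateFirst r ν t g) (a, y, ![])) r ν ≤
      1 + ∫⁻ z, firstNorm r ν g (a, z) ^ q ∂μ := by
  have hr0 : 0 < r := one_pos.trans hr
  calc eLpNorm' (fun y => averageFirst μ (truncateFirst r ν t g) (a, y, ![])) r ν
      ≤ ∫⁻ z, firstNorm r ν (truncateFirst r ν t g) (a, z) ∂μ :=
        eLpNorm'_averageFirst_le_lintegral_firstNorm hr (measurable_truncateFirst hg t) a
    _ ≤ ∫⁻ z, (1 + firstNorm r ν g (a, z) ^ q) ∂μ := lintegral_mono fun z =>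
        (firstNorm_truncateFirst_le hr0 g t (a, z)).trans (le_one_add_rpow hq)
    _ = 1 + ∫⁻ z, firstNorm r ν g (a, z) ^ q ∂μ := by
        rw [lintegral_add_left measurable_const, lintegral_one, measure_univ]

theorem eLpNorm'_averageFirst_truncateFirst_le_of_le_one (hr : 1 < r) (hg : Measurable g)
    (hq : 0 ≤ q) (hq1 : q ≤ 1) {t : ℝ} (ht : 0 < t) (a : F) :
    eLpNorm' (fun y => averageFirst μ (truncateFirst r ν t g) (a, y, ![])) r ν ≤
      ENNReal.ofReal (t ^ (1 - q)) * ∫⁻ z, firstNorm r ν g (a, z) ^ q ∂μ := by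
  refine eLpNorm'_averageFirst_le_mul hr (measurable_truncateFirst hg t) fun z => ?_
  rw [firstNorm_truncateFirst (one_pos.trans hr), Set.indicator_apply]
  split_ifs with hz
  · exact le_rpow_one_sub_mul_rpow_of_le ht hq hq1 hz
  · exact zero_le

theorem eLpNorm'_averageFirst_eq_sub_of_degenerateCond [CompleteSpace B]
    [TopologicalSpace.SeparableSpace B] [SFinite φ] {g' : F × Y × (Fin 1 → S) → B}
    (hg : Measurable g) (hgi : Integrable g (jointLaw μ φ ν 1))
    (hgi' : Integrable g' (jointLaw μ φ ν 1)) (h : DegenerateCond μ φ ν 1 g) :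
    ∀ᵐ a ∂φ, eLpNorm' (fun y => averageFirst μ g' (a, y, ![])) r ν =
      eLpNorm' (fun y => averageFirst μ (g - g') (a, y, ![])) r ν := by
  have hT := measurePreserving_averageFirst (k := 0) μ φ ν
  have hsub : ∀ᵐ p ∂(jointLaw μ φ ν 0),
      averageFirst μ (g - g') p = averageFirst μ g p - averageFirst μ g' p := by
    filter_upwards [(hT.integrable_comp_of_integrable hgi).prod_right_ae,
      (hT.integrable_comp_of_integrable hgi').prod_right_ae] with p hp hp'
    exact integral_sub hp hp'
  filter_upwards [ae_ae_of_ae_jointLaw_zero hsub,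
    (h.averageFirst hg hgi).ae_eq_zero (integrable_averageFirst hgi) one_pos] with a ha hzero
  refine eLpNorm'_congr_norm_ae ?_
  filter_upwards [ha, hzero] with y hy hy0
  rw [hy, hy0, zero_sub, norm_neg]

theorem eLpNorm'_averageFirst_truncateFirst_le_of_degenerateCond [CompleteSpace B]
    [TopologicalSpace.SeparableSpace B] [SFinite φ] (hr : 1 < r) (hg : Measurable g)
    (hgi : Integrable g (jointLaw μ φ ν 1)) (h : DegenerateCond μ φ ν 1 g) (hq : 1 ≤ q) {t : ℝ}
    (ht : 0 < t) :
    ∀ᵐ a ∂φ, eLpNorm' (fun y => averageFirst μ (truncateFirst r ν t g) (a, y, ![])) r ν ≤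
      ENNReal.ofReal (t ^ (1 - q)) * ∫⁻ z, firstNorm r ν g (a, z) ^ q ∂μ := by
  filter_upwards [eLpNorm'_averageFirst_eq_sub_of_degenerateCond (r := r) hg hgi
    (integrable_truncateFirst (r := r) hg hgi t) h] with a ha
  rw [ha]
  refine eLpNorm'_averageFirst_le_mul hr (hg.sub (measurable_truncateFirst hg t)) fun z => ?_
  rw [firstNorm_sub_truncateFirst (one_pos.trans hr), Set.indicator_apply]
  split_ifs with hz
  · exact le_rpow_one_sub_mul_rpow_of_lt ht hq (not_le.1 hz)
  · exact zero_le

end MeanOfTruncation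

/-! ### Kernels with low moments -/

theorem measure_ofReal_lt_le_of_ae_le {F : Type*} [MeasurableSpace F] (φ : Measure F)
    [IsProbabilityMeasure φ] {X : F → ℝ≥0∞} {s w Q : ℝ} (hs : 0 < s) (hQ : 0 ≤ Q)
    (hX : ∀ᵐ a ∂φ, X a ≤ ENNReal.ofReal w) :
    φ {a | ENNReal.ofReal s < X a} ≤ ENNReal.ofReal ((w / s) ^ Q) := by
  rcases lt_or_ge s w with hsw | hws
  · refine prob_le_one.trans ?_
    rw [← ENNReal.ofReal_one]
    exact ENNReal.ofReal_le_ofReal (Real.one_le_rpow ((one_le_div hs).2 hsw.le) hQ)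
  · refine (le_of_eq ?_).trans zero_le
    refine measure_mono_null (t := {a | ¬X a ≤ ENNReal.ofReal w}) (fun a ha hXa => ?_) hX
    exact absurd (lt_of_lt_of_le ha hXa) (not_lt.2 (ENNReal.ofReal_le_ofReal hws))

theorem ofReal_two_rpow_mul_two_pow (b : ℕ) (ρ : ℝ) :
    ENNReal.ofReal (2 ^ (b * ρ)) * ((2 ^ b : ℕ) : ℝ≥0∞) = ENNReal.ofReal (2 ^ (b * (ρ + 1))) := by
  have hcast : ((2 ^ b : ℕ) : ℝ) = 2 ^ (b : ℝ) := by norm_cast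
  rw [← ENNReal.ofReal_natCast, hcast, ← ENNReal.ofReal_mul (by positivity),
    ← Real.rpow_add two_pos, mul_add, mul_one]

section GeomTailOrderOne

variable {S B F Y : Type*} [MeasurableSpace S] [NormedAddCommGroup B] [MeasurableSpace F]
  [MeasurableSpace Y] {μ : Measure S} {φ : Measure F} {ν : Measure Y} {r η : ℝ}

theorem geomTail_le_of_maxTail_le {k N : ℕ} {g : F × Y × (Fin k → S) → B} {w Q : ℝ} {c : ℝ≥0∞}
    (hη : 0 ≤ η) (hw : 0 ≤ w)
    (h : ∀ s, 0 < s → maxTail r μ φ ν g N s ≤ ENNReal.ofReal ((w / s) ^ Q) * c) {s : ℝ}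
    (hs : 0 < s) :
    geomTail r η μ φ ν g N s ≤
      (∑' l : ℕ, ENNReal.ofReal ((η * 2 ^ Q) ^ l)) * (ENNReal.ofReal ((w / s) ^ Q) * c) := by
  rw [geomTail, ← ENNReal.tsum_mul_right]
  refine ENNReal.tsum_le_tsum fun l => ?_
  have hrescale : η ^ l * (w / (s / 2 ^ l)) ^ Q = (η * 2 ^ Q) ^ l * (w / s) ^ Q := by
    rw [div_div_eq_mul_div, mul_div_right_comm, Real.mul_rpow (by positivity) (by positivity),
      mul_pow, Real.rpow_pow_comm zero_le_two]
    ring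
  calc ENNReal.ofReal (η ^ l) * maxTail r μ φ ν g N (s / 2 ^ l)
      ≤ ENNReal.ofReal (η ^ l) * (ENNReal.ofReal ((w / (s / 2 ^ l)) ^ Q) * c) := by
        gcongr
        exact h _ (by positivity)
    _ = ENNReal.ofReal ((η * 2 ^ Q) ^ l) * (ENNReal.ofReal ((w / s) ^ Q) * c) := by
        rw [← mul_assoc, ← mul_assoc, ← ENNReal.ofReal_mul (by positivity),
          ← ENNReal.ofReal_mul (by positivity), hrescale]

variable [IsProbabilityMeasure μ]

theorem geomTail_order_zero_le [IsProbabilityMeasure φ] {g : F × Y × (Fin 0 → S) → B} {w s Q : ℝ}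
    (hη : 0 ≤ η) (hw : 0 ≤ w) (hs : 0 < s) (hQ : 0 ≤ Q)
    (h : ∀ᵐ a ∂φ, eLpNorm' (fun y => g (a, y, ![])) r ν ≤ ENNReal.ofReal w) (N : ℕ) :
    geomTail r η μ φ ν g N s ≤
      (∑' l : ℕ, ENNReal.ofReal ((η * 2 ^ Q) ^ l)) * ENNReal.ofReal ((w / s) ^ Q) := by
  rw [← mul_one (ENNReal.ofReal ((w / s) ^ Q))]
  refine geomTail_le_of_maxTail_le hη hw (fun u hu => ?_) hs
  rw [maxTail_order_zero, mul_one]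
  exact measure_ofReal_lt_le_of_ae_le φ hu hQ h

theorem tsum_geomTail_order_zero_lt_top [IsProbabilityMeasure φ]
    {g : ℕ → F × Y × (Fin 0 → S) → B} {s : ℕ → ℝ} {ρ θ D : ℝ} (hη : 0 ≤ η) (hD : 0 ≤ D)
    (hs : ∀ b, 0 < s b) (hρ : 0 ≤ ρ) (hθ : 0 < θ) (hηθ : η * 2 ^ ((ρ + 1) / θ) < 1)
    (h : ∀ b, ∀ᵐ a ∂φ, eLpNorm' (fun y => g b (a, y, ![])) r ν ≤
      ENNReal.ofReal (D * 2 ^ (-(b * θ)) * s b)) (N : ℕ → ℕ) :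
    ∑' b : ℕ, ENNReal.ofReal (2 ^ (b * ρ)) * geomTail r η μ φ ν (g b) (N b) (s b) < ∞ := by
  set Q := (ρ + 1) / θ with hQ
  set G := ∑' l : ℕ, ENNReal.ofReal ((η * 2 ^ Q) ^ l)
  have hdecay : ∀ b : ℕ, 2 ^ (b * ρ) * (D * 2 ^ (-(b * θ)) * s b / s b) ^ Q =
      D ^ Q * (1 / 2) ^ b := fun b => by
    rw [mul_div_cancel_right₀ _ (hs b).ne', Real.mul_rpow hD (by positivity),
      ← Real.rpow_mul zero_le_two, mul_left_comm, ← Real.rpow_add two_pos,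
      show (b : ℝ) * ρ + -(b * θ) * Q = -b by rw [hQ]; field_simp; ring,
      Real.rpow_neg zero_le_two, Real.rpow_natCast, one_div, inv_pow]
  calc ∑' b : ℕ, ENNReal.ofReal (2 ^ (b * ρ)) * geomTail r η μ φ ν (g b) (N b) (s b)
      ≤ ∑' b : ℕ, G * ENNReal.ofReal (D ^ Q) * ENNReal.ofReal ((1 / 2) ^ b) := by
        refine ENNReal.tsum_le_tsum fun b => ?_
        have hsb := hs b
        refine (mul_le_mul_right (geomTail_order_zero_le (Q := Q) hη (by positivity) hsb
          (by positivity) (h b) (N b)) _).trans_eq ?_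
        rw [mul_left_comm, ← ENNReal.ofReal_mul (by positivity), hdecay,
          ENNReal.ofReal_mul (by positivity), mul_assoc]
    _ < ∞ := by
        rw [ENNReal.tsum_mul_left]
        exact ENNReal.mul_lt_top (ENNReal.mul_lt_top
          (tsum_ofReal_pow_lt_top (by positivity) hηθ) ENNReal.ofReal_lt_top)
          (tsum_ofReal_pow_lt_top (by norm_num) (by norm_num))

variable [MeasurableSpace B] [BorelSpace B] [SFinite ν]
  {g : F × Y × (Fin 1 → S) → B}

theorem geomTail_normFirst_truncateFirst_le (hr : 0 < r) (hη : 0 ≤ η) (hg : Measurable g)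
    {t s : ℝ} (ht : 0 < t) (hs : 0 < s) (N : ℕ) :
    geomTail r η μ φ (ν.prod μ) (normFirst (truncateFirst r ν t g)) N s ≤
      (∑' l : ℕ, ENNReal.ofReal ((η * 2 ^ r) ^ l)) * (ENNReal.ofReal ((t / s) ^ r) *
      ∑' i : ℕ, ENNReal.ofReal ((2 ^ (-r)) ^ i) *
        (φ.prod μ) {p | ENNReal.ofReal (t / 2 / 2 ^ i) < firstNorm r ν g p}) :=
  geomTail_le_of_maxTail_le hη ht.le
    (fun _ hu => maxTail_normFirst_truncateFirst_le hr hg ht hu N) hs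

theorem tsum_geomTail_normFirst_truncateFirst_lt_top {q ρ τ ε c : ℝ} (hr : 0 < r) (hη : 0 ≤ η)
    (hηr : η * 2 ^ r < 1) (hqr : q < r) (hρ : 0 < ρ + 1) (hτ : 0 < τ) (hρq : ρ + 1 ≤ q * τ)
    (hε : 0 < ε) (hc : 0 < c) (hg : Measurable g)
    (hgq : ∫⁻ p, firstNorm r ν g p ^ q ∂(φ.prod μ) < ∞) :
    ∑' b : ℕ, ENNReal.ofReal (2 ^ (b * ρ)) * geomTail r η μ φ (ν.prod μ)
      (normFirst (truncateFirst r ν (ε * 2 ^ (b * τ)) g)) (2 ^ b)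
      (c * (ε * 2 ^ (b * τ)) / ((2 ^ b : ℕ) : ℝ) ^ (1 / r)) < ∞ := by
  set G := ∑' l : ℕ, ENNReal.ofReal ((η * 2 ^ r) ^ l)
  set X : ℕ → ℝ≥0∞ := fun b => ∑' i : ℕ, ENNReal.ofReal ((2 ^ (-r)) ^ i) *
    (φ.prod μ) {p | ENNReal.ofReal (ε / 2 * 2 ^ (b * τ) / 2 ^ i) < firstNorm r ν g p} with hX
  have hratio : ∀ b : ℕ, (ε * 2 ^ (b * τ) /
      (c * (ε * 2 ^ (b * τ)) / ((2 ^ b : ℕ) : ℝ) ^ (1 / r))) ^ r =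
      c⁻¹ ^ r * ((2 ^ b : ℕ) : ℝ) := fun b => by
    have hcancel : ε * 2 ^ (b * τ) / (c * (ε * 2 ^ (b * τ)) / ((2 ^ b : ℕ) : ℝ) ^ (1 / r)) =
        c⁻¹ * ((2 ^ b : ℕ) : ℝ) ^ (1 / r) := by field_simp
    rw [hcancel, Real.mul_rpow (by positivity) (by positivity), ← Real.rpow_mul (by positivity),
      one_div, inv_mul_cancel₀ hr.ne', Real.rpow_one]
  calc _ ≤ ∑' b : ℕ, G * ENNReal.ofReal (c⁻¹ ^ r) *
        (ENNReal.ofReal (2 ^ (b * (ρ + 1))) * X b) := by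
        refine ENNReal.tsum_le_tsum fun b => ?_
        refine (mul_le_mul_right (geomTail_normFirst_truncateFirst_le hr hη hg (by positivity)
          (by positivity) _) _).trans_eq ?_
        simp only [hratio, mul_div_right_comm ε _ (2 : ℝ)]
        rw [ENNReal.ofReal_mul (by positivity), ENNReal.ofReal_natCast,
          ← ofReal_two_rpow_mul_two_pow, hX]
        ring
    _ < ∞ := by
        have hweight : (2 : ℝ) ^ (-r) * 2 ^ q < 1 := by
          rw [← Real.rpow_add two_pos]
          exact Real.rpow_lt_one_of_one_lt_of_neg one_lt_two (by linarith)
        rw [ENNReal.tsum_mul_left]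
        exact ENNReal.mul_lt_top (ENNReal.mul_lt_top
          (tsum_ofReal_pow_lt_top (by positivity) hηr) ENNReal.ofReal_lt_top)
          (tsum_dyadic_geometric_lt_top hρ hτ hρq (by positivity) hweight (by positivity)
            (φ.prod μ) (measurable_firstNorm hg) hgq)

theorem tsum_maxTail_freezeFirst_lt_top {q ρ τ ε : ℝ} (hρ : 0 < ρ + 1) (hτ : 0 < τ)
    (hρq : ρ + 1 ≤ q * τ) (hε : 0 < ε) (hg : Measurable g)
    (hgq : ∫⁻ p, firstNorm r ν g p ^ q ∂(φ.prod μ) < ∞) :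
    ∑' b : ℕ, ENNReal.ofReal (2 ^ (b * ρ)) * ((2 ^ b : ℕ) *
      maxTail r μ (φ.prod μ) ν (freezeFirst g) (2 ^ b) (ε * 2 ^ (b * τ))) < ∞ := by
  simp only [← mul_assoc, ofReal_two_rpow_mul_two_pow, maxTail_freezeFirst_order_one]
  exact (tsum_dyadic_measure_le hρ hτ hρq hε (φ.prod μ) (measurable_firstNorm hg)).trans_lt
    (ENNReal.mul_lt_top ENNReal.ofReal_lt_top hgq)

theorem tsum_geomTail_freezeFirst_lt_top {q ρ τ ε c : ℝ} (hη : 0 ≤ η) (hηq : η * 2 ^ q < 1)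
    (hρ : 0 < ρ + 1) (hτ : 0 < τ) (hρq : ρ + 1 ≤ q * τ) (hε : 0 < ε) (hc : 0 < c)
    (hg : Measurable g) (hgq : ∫⁻ p, firstNorm r ν g p ^ q ∂(φ.prod μ) < ∞) :
    ∑' b : ℕ, ENNReal.ofReal (2 ^ (b * ρ)) * ((2 ^ b : ℕ) *
      geomTail r η μ (φ.prod μ) ν (freezeFirst g) (2 ^ b) (c * (ε * 2 ^ (b * τ)))) < ∞ := by
  simp only [← mul_assoc, ofReal_two_rpow_mul_two_pow, geomTail, maxTail_freezeFirst_order_one]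
  exact tsum_dyadic_geometric_lt_top hρ hτ hρq hη hηq (mul_pos hc hε) (φ.prod μ)
    (measurable_firstNorm hg) hgq

end GeomTailOrderOne

section MeanOfTruncationBound

theorem rpow_one_sub_le_of_add_one_le_mul {q ρ τ θ ε : ℝ} (hε : 0 < ε) (hρq : ρ + 1 ≤ q * τ)
    (hθρ : θ ≤ ρ) (b : ℕ) :
    (ε * 2 ^ (b * τ)) ^ (1 - q) ≤
      ε ^ (-q) * (2 ^ (-(b * θ)) * (ε * 2 ^ (b * τ)) / ((2 ^ b : ℕ) : ℝ)) := by
  have hcast : ((2 ^ b : ℕ) : ℝ) = 2 ^ (b : ℝ) := by norm_cast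
  have hexponent : (2 : ℝ) ^ (-(b * τ * q)) ≤ 2 ^ (-(b * θ)) / 2 ^ (b : ℝ) := by
    rw [← Real.rpow_sub two_pos]
    refine Real.rpow_le_rpow_of_exponent_le one_le_two ?_
    have : (b : ℝ) * (θ + 1) ≤ b * (q * τ) := by gcongr; linarith
    linarith
  calc (ε * 2 ^ (b * τ)) ^ (1 - q)
      = ε ^ (-q) * (2 ^ (-(b * τ * q)) * (ε * 2 ^ (b * τ))) := by
        rw [sub_eq_add_neg, Real.rpow_add (by positivity), Real.rpow_one,
          Real.mul_rpow hε.le (by positivity), ← Real.rpow_mul zero_le_two, mul_neg]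
        ring
    _ ≤ ε ^ (-q) * (2 ^ (-(b * θ)) / 2 ^ (b : ℝ) * (ε * 2 ^ (b * τ))) := by gcongr
    _ = _ := by rw [hcast]; ring

theorem one_le_inv_mul_of_le_sub_one {τ θ ε : ℝ} (hε : 0 < ε) (hθ : θ ≤ τ - 1) (b : ℕ) :
    1 ≤ ε⁻¹ * (2 ^ (-(b * θ)) * (ε * 2 ^ (b * τ)) / ((2 ^ b : ℕ) : ℝ)) := by
  have hcast : ((2 ^ b : ℕ) : ℝ) = 2 ^ (b : ℝ) := by norm_cast
  have hexponent : (b : ℝ) * θ ≤ b * (τ - 1) := by gcongr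
  calc (1 : ℝ) ≤ 2 ^ (-(b * θ) + b * τ - b) := Real.one_le_rpow one_le_two (by linarith)
    _ = 2 ^ (-(b * θ)) * 2 ^ (b * τ) / 2 ^ (b : ℝ) := by
        rw [Real.rpow_sub two_pos, Real.rpow_add two_pos]
    _ = _ := by rw [hcast]; field_simp

variable {S B F Y : Type*} [MeasurableSpace S] [NormedAddCommGroup B] [NormedSpace ℝ B]
  [CompleteSpace B] [TopologicalSpace.SeparableSpace B] [MeasurableSpace B] [BorelSpace B]
  [MeasurableSpace F] [MeasurableSpace Y] {μ : Measure S} [IsProbabilityMeasure μ]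
  {φ : Measure F} [SFinite φ] {ν : Measure Y} [IsProbabilityMeasure ν] {r q ρ τ θ ε : ℝ}
  {g : F × Y × (Fin 1 → S) → B} {K : NNReal}

theorem ae_eLpNorm'_averageFirst_truncateFirst_le (hr : 1 < r) (hg : Measurable g)
    (hgi : Integrable g (jointLaw μ φ ν 1)) (hq : 0 ≤ q) (hε : 0 < ε)
    (hcases : q ≤ 1 ∨ 1 ≤ q ∧ DegenerateCond μ φ ν 1 g)
    (hK : ∀ a, ∫⁻ z, firstNorm r ν g (a, z) ^ q ∂μ ≤ K) (hρq : ρ + 1 ≤ q * τ) (hθρ : θ ≤ ρ)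
    (b : ℕ) :
    ∀ᵐ a ∂φ, eLpNorm' (fun y => averageFirst μ (truncateFirst r ν (ε * 2 ^ (b * τ)) g)
      (a, y, ![])) r ν ≤ ENNReal.ofReal
        (ε ^ (-q) * K * (2 ^ (-(b * θ)) * (ε * 2 ^ (b * τ)) / ((2 ^ b : ℕ) : ℝ))) := by
  have ht : 0 < ε * (2 : ℝ) ^ (b * τ) := by positivity
  have hmean : ∀ᵐ a ∂φ, eLpNorm' (fun y => averageFirst μ
      (truncateFirst r ν (ε * 2 ^ (b * τ)) g) (a, y, ![])) r ν ≤
      ENNReal.ofReal ((ε * 2 ^ (b * τ)) ^ (1 - q)) * ∫⁻ z, firstNorm r ν g (a, z) ^ q ∂μ := by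
    rcases hcases with hq1 | ⟨hq1, hD⟩
    · exact .of_forall (eLpNorm'_averageFirst_truncateFirst_le_of_le_one hr hg hq hq1 ht)
    · exact eLpNorm'_averageFirst_truncateFirst_le_of_degenerateCond hr hg hgi hD hq1 ht
  filter_upwards [hmean] with a ha
  calc _ ≤ ENNReal.ofReal ((ε * 2 ^ (b * τ)) ^ (1 - q)) * K := ha.trans (mul_le_mul_right (hK a) _)
    _ = ENNReal.ofReal ((ε * 2 ^ (b * τ)) ^ (1 - q) * K) := by
        rw [ENNReal.ofReal_mul (by positivity), ENNReal.ofReal_coe_nnreal]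
    _ ≤ _ := by
        rw [mul_right_comm]
        gcongr
        exact rpow_one_sub_le_of_add_one_le_mul hε hρq hθρ b

theorem exists_eLpNorm'_averageFirst_truncateFirst_le (hr : 1 < r) (hg : Measurable g)
    (hgi : Integrable g (jointLaw μ φ ν 1)) {e : ℕ} (hq : 0 ≤ q) (hε : 0 < ε) (he : e ≤ 1)
    (hD : DegenerateCond μ φ ν e g) (hK : ∀ a, ∫⁻ z, firstNorm r ν g (a, z) ^ q ∂μ ≤ K)
    (hρq : ρ + 1 ≤ q * τ) (hθρ : θ ≤ ρ) (hθe : e = 0 → θ ≤ τ - 1) :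
    ∃ D : ℝ, 0 ≤ D ∧ ∀ b : ℕ, ∀ᵐ a ∂φ,
      eLpNorm' (fun y => averageFirst μ (truncateFirst r ν (ε * 2 ^ (b * τ)) g)
        (a, y, ![])) r ν ≤ ENNReal.ofReal
          (D * (2 ^ (-(b * θ)) * (ε * 2 ^ (b * τ)) / ((2 ^ b : ℕ) : ℝ))) := by
  have hsmall := ae_eLpNorm'_averageFirst_truncateFirst_le (φ := φ) (ρ := ρ) (θ := θ) (τ := τ)
    hr hg hgi hq hε (hK := hK) (hρq := hρq) (hθρ := hθρ)
  rcases le_total q 1 with hq1 | hq1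
  · exact ⟨ε ^ (-q) * K, by positivity, hsmall (.inl hq1)⟩
  obtain rfl | rfl : e = 1 ∨ e = 0 := by omega
  · exact ⟨ε ^ (-q) * K, by positivity, hsmall (.inr ⟨hq1, hD⟩)⟩
  refine ⟨(1 + K) * ε⁻¹, by positivity, fun b => .of_forall fun a => ?_⟩
  calc _ ≤ 1 + (K : ℝ≥0∞) := (eLpNorm'_averageFirst_truncateFirst_le_one_add hr hg hq1 _ a).trans
        (add_le_add le_rfl (hK a))
    _ = ENNReal.ofReal ((1 + K) * 1) := by
        rw [mul_one, ENNReal.ofReal_add zero_le_one K.coe_nonneg, ENNReal.ofReal_one,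
          ENNReal.ofReal_coe_nnreal]
    _ ≤ _ := by
        rw [mul_assoc]
        gcongr
        exact one_le_inv_mul_of_le_sub_one hε (hθe rfl) b

end MeanOfTruncationBound

section OrderOne

variable {S B F Y : Type*} [MeasurableSpace S] [NormedAddCommGroup B] [NormedSpace ℝ B]
  [TopologicalSpace.SeparableSpace B] [MeasurableSpace B] [BorelSpace B]
  [MeasurableSpace F] [MeasurableSpace Y] {μ : Measure S} [IsProbabilityMeasure μ]
  {φ : Measure F} [IsProbabilityMeasure φ] {ν : Measure Y} [IsProbabilityMeasure ν]
  {r η C : ℝ} {g : F × Y × (Fin 1 → S) → B}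

theorem geomTail_order_one_le {δ : ℝ} (hr : 1 < r) (hC0 : 0 < C)
    (hC : IsMartingaleTypeConst B μ r C) (hη : 0 < η) (hη1 : η < 1) (hδ : 0 < δ) (hδ4 : δ ≤ 1 / 4)
    (hδη : C * (2 * δ) ^ r ≤ η / 2) (hg : Measurable g) (hgi : Integrable g (jointLaw μ φ ν 1))
    {N : ℕ} (hN : 1 ≤ N) {t : ℝ} (ht : 0 < t) :
    geomTail r η μ φ ν g N t ≤
      (∑' l : ℕ, ENNReal.ofReal (η ^ l)) *
        (N * maxTail r μ (φ.prod μ) ν (freezeFirst g) N t) +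
      2 * (N * geomTail r η μ (φ.prod μ) ν (freezeFirst g) N (δ / 2 * t) +
        geomTail r η μ φ (ν.prod μ) (normFirst (truncateFirst r ν t g)) N
          (δ / 2 * t / N ^ (1 / r)) +
        geomTail r η μ φ ν (averageFirst μ (truncateFirst r ν t g)) N (δ / 2 * t / N)) := by
  have htruncated := geomTail_le hr hC0 hC hη hη1 hδ hδ4 hδη (measurable_truncateFirst hg t)
    (integrable_truncateFirst (r := r) hg hgi t) hN ht
  calc geomTail r η μ φ ν g N t
      ≤ ∑' l : ℕ, (ENNReal.ofReal (η ^ l) *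
          (N * maxTail r μ (φ.prod μ) ν (freezeFirst g) N t) +
        ENNReal.ofReal (η ^ l) * maxTail r μ φ ν (truncateFirst r ν t g) N (t / 2 ^ l)) := by
        refine ENNReal.tsum_le_tsum fun l => ?_
        rw [← mul_add]
        gcongr
        exact maxTail_le_add_maxTail_truncateFirst hg N (t / 2 ^ l) t
    _ = (∑' l : ℕ, ENNReal.ofReal (η ^ l)) *
          (N * maxTail r μ (φ.prod μ) ν (freezeFirst g) N t) +
        geomTail r η μ φ ν (truncateFirst r ν t g) N t := by
        rw [ENNReal.tsum_add, ENNReal.tsum_mul_right, ← geomTail]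
    _ ≤ _ := by
        refine add_le_add le_rfl (htruncated.trans ?_)
        gcongr
        exact ENNReal.tsum_le_tsum fun l => mul_le_mul_right
          (maxTail_freezeFirst_truncateFirst_le (one_pos.trans hr) g t N _) _

variable [CompleteSpace B]

theorem dyadicTail_order_one_lt_top (hr : 1 < r) (hC0 : 0 < C)
    (hC : IsMartingaleTypeConst B μ r C) (hg : Measurable g)
    (hgi : Integrable g (jointLaw μ φ ν 1)) {q ρ τ θ ε : ℝ} {e : ℕ} {K : NNReal} (hq : 0 ≤ q)
    (hqr : q < r) (hε : 0 < ε) (hτ : 0 < τ) (he : e ≤ 1)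
    (hD : DegenerateCond μ φ ν e g) (hK : ∀ a, ∫⁻ z, firstNorm r ν g (a, z) ^ q ∂μ ≤ K)
    (hρq : ρ + 1 ≤ q * τ) (hθ : 0 < θ) (hθρ : θ ≤ ρ) (hθe : e = 0 → θ ≤ τ - 1) (hη : 0 < η)
    (hη1 : η < 1) (hηq : η * 2 ^ q < 1) (hηr : η * 2 ^ r < 1)
    (hηθ : η * 2 ^ ((ρ + 1) / θ) < 1) : dyadicTail r η μ φ ν ρ τ g ε < ∞ := by
  have hρ : 0 < ρ := hθ.trans_le hθρ
  have hρ1 : 0 < ρ + 1 := by linarith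
  obtain ⟨δ, hδ, hδ4, hδη⟩ := exists_mul_rpow_two_mul_le (C := C) (one_pos.trans hr) hC0 hη
  obtain ⟨D, hD0, hDb⟩ :=
    exists_eLpNorm'_averageFirst_truncateFirst_le hr hg hgi hq hε he hD hK hρq hθρ hθe
  have hgq : ∫⁻ p, firstNorm r ν g p ^ q ∂(φ.prod μ) < ∞ := by
    have hH := measurable_firstNorm (r := r) (ν := ν) hg
    rw [lintegral_prod _ (Measurable.aemeasurable (by fun_prop))]
    refine (lintegral_mono hK).trans_lt ?_
    simp
  have hlarge := tsum_maxTail_freezeFirst_lt_top (μ := μ) (φ := φ) hρ1 hτ hρq hε hg hgq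
  have hfreeze := tsum_geomTail_freezeFirst_lt_top (μ := μ) (φ := φ) hη.le hηq hρ1 hτ hρq hε
    (half_pos hδ) hg hgq
  have hnorm := tsum_geomTail_normFirst_truncateFirst_lt_top (one_pos.trans hr) hη.le hηr hqr hρ1
    hτ hρq hε (half_pos hδ) hg hgq
  have haverage : ∑' b : ℕ, ENNReal.ofReal (2 ^ (b * ρ)) * geomTail r η μ φ ν
      (averageFirst μ (truncateFirst r ν (ε * 2 ^ (b * τ)) g)) (2 ^ b)
      (δ / 2 * (ε * 2 ^ (b * τ)) / ((2 ^ b : ℕ) : ℝ)) < ∞ := by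
    refine tsum_geomTail_order_zero_lt_top (D := D / (δ / 2)) hη.le (by positivity)
      (fun b => by positivity) hρ.le hθ hηθ (fun b => ?_) _
    filter_upwards [hDb b] with a ha
    refine ha.trans_eq (congrArg _ ?_)
    field_simp
  calc dyadicTail r η μ φ ν ρ τ g ε
      ≤ ∑' b : ℕ, ENNReal.ofReal (2 ^ (b * ρ)) * _ := ENNReal.tsum_le_tsum fun b =>
        mul_le_mul_right (geomTail_order_one_le hr hC0 hC hη hη1 hδ hδ4 hδη hg hgi
          Nat.one_le_two_pow (by positivity)) _
    _ < ∞ := by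
        simp only [mul_add, mul_left_comm _ (∑' l : ℕ, ENNReal.ofReal (η ^ l)) _,
          mul_left_comm _ (2 : ℝ≥0∞) _, ENNReal.tsum_add, ENNReal.tsum_mul_left]
        exact ENNReal.add_lt_top.2 ⟨ENNReal.mul_lt_top (tsum_ofReal_pow_lt_top hη.le hη1) hlarge,
          ENNReal.add_lt_top.2 ⟨ENNReal.add_lt_top.2 ⟨ENNReal.mul_lt_top ENNReal.ofNat_lt_top
            hfreeze, ENNReal.mul_lt_top ENNReal.ofNat_lt_top hnorm⟩,
            ENNReal.mul_lt_top ENNReal.ofNat_lt_top haverage⟩⟩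

end OrderOne

section LowMoments

open scoped Topology

/-- The relations of `ExponentCond` in which the moment condition is only imposed if at least one
variable is frozen: the hypothesis of the induction that covers moments of order below `r`. -/
def ExponentCondPos (r : ℝ) (k e : ℕ) (ρ τ : ℝ) (q : ℕ → ℝ) : Prop :=
  ∀ j a c : ℕ, j + a + c = k → e ≤ a + j →
    0 < τ - a / r - c ∧ (0 < j → ρ + j ≤ q j * (τ - a / r - c))

theorem ExponentCondPos.freezeFirst {k : ℕ} {r ρ τ : ℝ} {e : ℕ} {q : ℕ → ℝ}
    (h : ExponentCondPos r (k + 1) e ρ τ q) :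
    ExponentCond r k (e - 1) (ρ + 1) τ fun j => q (j + 1) := by
  intro j a c hk he
  have := h (j + 1) a c (by omega) (by omega)
  push_cast at this
  exact ⟨this.1, by linarith [this.2 (by omega)]⟩

theorem ExponentCondPos.normFirst {k : ℕ} {r ρ τ : ℝ} {e : ℕ} {q : ℕ → ℝ}
    (h : ExponentCondPos r (k + 1) e ρ τ q) : ExponentCondPos r k (e - 1) ρ (τ - 1 / r) q := by
  intro j a c hk he
  have := h j (a + 1) c (by omega) (by omega)
  push_cast at this
  rw [show τ - 1 / r - a / r - c = τ - (a + 1) / r - c by ring]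
  exact this

theorem ExponentCondPos.averageFirst {k : ℕ} {r ρ τ : ℝ} {e : ℕ} {q : ℕ → ℝ}
    (h : ExponentCondPos r (k + 1) e ρ τ q) : ExponentCondPos r k e ρ (τ - 1) q := by
  intro j a c hk he
  have := h j a (c + 1) (by omega) (by omega)
  push_cast at this
  rw [show τ - 1 - a / r - c = τ - a / r - (c + 1) by ring]
  exact this

theorem ExponentCondPos.exists_decay_rate {r ρ τ : ℝ} {e : ℕ} {q : ℕ → ℝ} (hρ : 0 < ρ)
    (h : ExponentCondPos r 1 e ρ τ q) : ∃ θ, 0 < θ ∧ θ ≤ ρ ∧ (e = 0 → θ ≤ τ - 1) := by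
  rcases Nat.eq_zero_or_pos e with rfl | he
  · have hτ := (h 0 0 1 rfl le_rfl).1
    simp only [Nat.cast_zero, zero_div, sub_zero, Nat.cast_one] at hτ
    exact ⟨min ρ (τ - 1), lt_min hρ hτ, min_le_left _ _, fun _ => min_le_right _ _⟩
  · exact ⟨ρ, hρ, le_rfl, fun h0 => absurd h0 he.ne'⟩

theorem eventually_nhdsGT_zero_mul_lt_one (x : ℝ) : ∀ᶠ η in 𝓝[>] (0 : ℝ), η * x < 1 := by
  have hlim : Filter.Tendsto (fun η : ℝ => η * x) (𝓝[>] 0) (𝓝 (0 * x)) :=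
    (Filter.tendsto_id.mul_const x).mono_left nhdsWithin_le_nhds
  rw [zero_mul] at hlim
  exact hlim.eventually_lt_const one_pos

theorem exists_forall_lintegral_firstNorm_rpow_le {S B F Y : Type*} [MeasurableSpace S]
    [NormedAddCommGroup B] [MeasurableSpace B] [BorelSpace B] [MeasurableSpace F] [Unique F]
    [MeasurableSpace Y] {μ : Measure S} [IsProbabilityMeasure μ] {φ : Measure F}
    [IsProbabilityMeasure φ] {ν : Measure Y} [SFinite ν] {r : ℝ}
    {g : F × Y × (Fin 1 → S) → B} (hg : Measurable g) {q : ℕ → ℝ}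
    (hM : MomentCond r μ φ ν q g {0}) :
    ∃ K : NNReal, ∀ a, ∫⁻ z, firstNorm r ν g (a, z) ^ q 1 ∂μ ≤ K := by
  have hM' : MomentCond r μ φ ν q g (insert 0 ((∅ : Finset (Fin 0)).map (Fin.succEmb 0))) := hM
  have hfinite : ∫⁻ p, firstNorm r ν g p ^ q 1 ∂(φ.prod μ) < ∞ :=
    (momentCond_order_zero_iff _ _).1 (hM'.freezeFirst hg)
  have hH := measurable_firstNorm (r := r) (ν := ν) hg
  rw [lintegral_prod _ (Measurable.aemeasurable (by fun_prop))] at hfinite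
  obtain ⟨a, ha⟩ := (ae_lt_top (by fun_prop) hfinite.ne).exists
  refine ⟨(∫⁻ z, firstNorm r ν g (a, z) ^ q 1 ∂μ).toNNReal, fun a' => ?_⟩
  rw [ENNReal.coe_toNNReal ha.ne, Subsingleton.elim a' a]

universe u v

variable {S : Type u} {B : Type v} [MeasurableSpace S] [NormedAddCommGroup B] [NormedSpace ℝ B]
  [CompleteSpace B] [TopologicalSpace.SeparableSpace B] [MeasurableSpace B] [BorelSpace B]
  {μ : Measure S} [IsProbabilityMeasure μ] {r C : ℝ}

theorem eventually_dyadicTail_order_one_lt_top (hr : 1 < r) (hC0 : 0 < C)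
    (hC : IsMartingaleTypeConst B μ r C) {q : ℕ → ℝ} {e : ℕ} {ρ τ : ℝ} (hρ : 0 < ρ)
    (hq : 0 ≤ q 1) (hqr : q 1 < r) (hE : ExponentCondPos r 1 e ρ τ q) :
    ∀ᶠ η in 𝓝[>] (0 : ℝ), ∀ {F Y : Type u} [MeasurableSpace F] [Unique F] [MeasurableSpace Y]
      (φ : Measure F) [IsProbabilityMeasure φ] (ν : Measure Y) [IsProbabilityMeasure ν]
      {g : F × Y × (Fin 1 → S) → B} {ε : ℝ},
      Measurable g → Integrable g (jointLaw μ φ ν 1) →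
      (e ≤ 1 → ∀ J, J.Nonempty → MomentCond r μ φ ν q g J) → DegenerateCond μ φ ν e g → 0 < ε →
      dyadicTail r η μ φ ν ρ τ g ε < ∞ := by
  obtain ⟨θ, hθ, hθρ, hθe⟩ := hE.exists_decay_rate hρ
  filter_upwards [self_mem_nhdsWithin, eventually_nhdsGT_zero_mul_lt_one 1,
    eventually_nhdsGT_zero_mul_lt_one (2 ^ q 1), eventually_nhdsGT_zero_mul_lt_one (2 ^ r),
    eventually_nhdsGT_zero_mul_lt_one (2 ^ ((ρ + 1) / θ))] with η hη hη1 hηq hηr hηθ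
  rw [mul_one] at hη1
  intro F Y _ _ _ φ _ ν _ g ε hg hgi hM hD hε
  by_cases he : e ≤ 1
  · obtain ⟨K, hK⟩ := exists_forall_lintegral_firstNorm_rpow_le hg (hM he {0} (by simp))
    have hE1 := hE 1 0 0 rfl (by omega)
    simp only [Nat.cast_zero, zero_div, sub_zero, Nat.cast_one, Nat.one_pos, true_implies] at hE1
    exact dyadicTail_order_one_lt_top hr hC0 hC hg hgi hq hqr hε hE1.1 he hD hK hE1.2 hθ hθρ hθe
      hη hη1 hηq hηr hηθ
  · refine dyadicTail_lt_top_of_momentCond hr hC0 hC hη hη1 1 φ ν (q := fun _ => 0) (e := e) hg hgi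
      hρ (fun _ _ => le_rfl) (fun _ _ => by simpa using hη1) ?_ (fun h => absurd h he) hD hε
    intro j a c hk hej
    omega

theorem eventually_dyadicTail_lt_top (hr : 1 < r) (hC0 : 0 < C)
    (hC : IsMartingaleTypeConst B μ r C) (k : ℕ) :
    ∀ {q : ℕ → ℝ} {e : ℕ} {ρ τ : ℝ}, 0 < ρ → (∀ j, 0 ≤ q j) → q 1 < r →
      ExponentCondPos r (k + 1) e ρ τ q →
      ∀ᶠ η in 𝓝[>] (0 : ℝ), ∀ {F Y : Type u} [MeasurableSpace F] [Unique F] [MeasurableSpace Y]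
      (φ : Measure F) [IsProbabilityMeasure φ] (ν : Measure Y) [IsProbabilityMeasure ν]
      {g : F × Y × (Fin (k + 1) → S) → B} {ε : ℝ},
      Measurable g → Integrable g (jointLaw μ φ ν (k + 1)) →
      (e ≤ k + 1 → ∀ J, J.Nonempty → MomentCond r μ φ ν q g J) → DegenerateCond μ φ ν e g → 0 < ε →
      dyadicTail r η μ φ ν ρ τ g ε < ∞ := by
  induction k with
  | zero => exact fun hρ hq hqr hE =>
      eventually_dyadicTail_order_one_lt_top hr hC0 hC hρ (hq 1) hqr hE
  | succ k ih =>
    intro q e ρ τ hρ hq hqr hE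
    have hsmall : ∀ᶠ η in 𝓝[>] (0 : ℝ), ∀ j ∈ Finset.range (k + 2), η * 2 ^ q (j + 1) < 1 :=
      (Finset.eventually_all _).2 fun j _ => eventually_nhdsGT_zero_mul_lt_one _
    filter_upwards [self_mem_nhdsWithin, eventually_nhdsGT_zero_mul_lt_one 1, hsmall,
      ih hρ hq hqr hE.normFirst, ih hρ hq hqr hE.averageFirst]
      with η hη hη1 hηq hnorm haverage
    replace hη : 0 < η := hη
    rw [mul_one] at hη1
    intro F Y _ _ _ φ _ ν _ g ε hg hgi hM hD hε
    obtain ⟨δ, hδ, hδ4, hδη⟩ := exists_mul_rpow_two_mul_le (C := C) (one_pos.trans hr) hC0 hη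
    refine (dyadicTail_le hr hC0 hC hη hη1 hδ hδ4 hδη hg hgi ρ τ hε).trans_lt ?_
    refine ENNReal.mul_lt_top ENNReal.ofNat_lt_top
      (ENNReal.add_lt_top.2 ⟨ENNReal.add_lt_top.2 ⟨?_, ?_⟩, ?_⟩)
    · exact dyadicTail_lt_top_of_momentCond hr hC0 hC hη hη1 (k + 1) (φ.prod μ) ν
        (measurable_freezeFirst hg) (integrable_freezeFirst hgi) (by linarith)
        (fun j _ => hq (j + 1)) (fun j hj => hηq j (Finset.mem_range.2 (by omega))) hE.freezeFirst
        (fun he J => (hM (by omega) _ (Finset.insert_nonempty _ _)).freezeFirst hg)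
        (hD.freezeFirst hg) (by positivity)
    · exact hnorm φ (ν.prod μ) (measurable_normFirst hg) (integrable_normFirst hgi)
        (fun he J hJ => (hM (by omega) _ hJ.map).normFirst hg) (hD.normFirst hg) (by positivity)
    · exact haverage φ ν (measurable_averageFirst μ hg) (integrable_averageFirst hgi)
        (fun he J hJ => (hM (by omega) _ hJ.map).averageFirst hr.le hg (hq _))
        (hD.averageFirst hg hgi) (by positivity)

end LowMoments

/-! ### Transfer from the sample to its law -/

section Coordinates

variable {S : Type*} {m : ℕ}

/-- The indices of the first `j` coordinates of a vector of length `m`. -/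
def firstIndices (m j : ℕ) : Finset (Fin m) := Finset.univ.filter fun i => (i : ℕ) < j

theorem mem_firstIndices {j : ℕ} {i : Fin m} : i ∈ firstIndices m j ↔ (i : ℕ) < j := by
  simp [firstIndices]

theorem card_firstIndices {j : ℕ} (hj : j ≤ m) : (firstIndices m j).card = j := by
  rw [firstIndices, Fin.card_filter_val_lt, min_eq_right hj]

theorem exists_perm_mem_firstIndices (J : Finset (Fin m)) :
    ∃ σ : Equiv.Perm (Fin m), ∀ i, i ∈ J ↔ σ i ∈ firstIndices m J.card := by
  have hcard : Fintype.card {x // x ∈ J} = Fintype.card {x // x ∈ firstIndices m J.card} := by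
    rw [Fintype.card_coe, Fintype.card_coe, card_firstIndices (card_finset_fin_le J)]
  let e := Fintype.equivOfCardEq hcard
  exact ⟨e.extendSubtype, fun i => ⟨e.extendSubtype_mem i,
    not_imp_not.1 (e.extendSubtype_not_mem i)⟩⟩

variable [MeasurableSpace S] (μ : Measure S) [IsProbabilityMeasure μ]

theorem measurePreserving_perm (σ : Equiv.Perm (Fin m)) :
    MeasurePreserving (fun (x : Fin m → S) i => x (σ i)) (vecLaw μ m) (vecLaw μ m) :=
  ⟨by fun_prop, by
    rw [vecLaw, ← Measure.infinitePi_eq_pi,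
      Measure.map_infinitePi_infinitePi_of_inj σ.injective]⟩

theorem measurePreserving_piecewise (J : Finset (Fin m)) :
    MeasurePreserving (fun p : (Fin m → S) × (Fin m → S) => J.piecewise p.1 p.2)
      ((vecLaw μ m).prod (vecLaw μ m)) (vecLaw μ m) := by
  have hmeas : Measurable fun p : (Fin m → S) × (Fin m → S) => J.piecewise p.1 p.2 := by fun_prop
  refine ⟨hmeas, (Measure.pi_eq fun s hs => ?_).symm⟩
  have hpreimage : (fun p : (Fin m → S) × (Fin m → S) => J.piecewise p.1 p.2) ⁻¹' Set.univ.pi s =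
      (Set.univ.pi fun i => if i ∈ J then s i else Set.univ) ×ˢ
        (Set.univ.pi fun i => if i ∈ J then Set.univ else s i) := by
    ext ⟨x, y⟩
    simp only [Set.mem_preimage, Set.mem_pi, Set.mem_univ, true_imp_iff, Set.mem_prod,
      Finset.piecewise, ← forall_and]
    refine forall_congr' fun i => ?_
    by_cases hi : i ∈ J <;> simp [hi]
  rw [Measure.map_apply hmeas (MeasurableSet.univ_pi hs), hpreimage, Measure.prod_prod,
    Measure.pi_pi, Measure.pi_pi, ← Finset.prod_mul_distrib]
  refine Finset.prod_congr rfl fun i _ => ?_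
  by_cases hi : i ∈ J <;> simp [hi]

end Coordinates

section FrozenMoment

variable {S B : Type*} [MeasurableSpace S] [NormedAddCommGroup B] {m : ℕ}

/-- The `r`-th moment of the kernel when the variables with index in `J` are frozen at `x`. -/
noncomputable def frozenMoment (r : ℝ) (μ : Measure S) (h : (Fin m → S) → B) (J : Finset (Fin m))
    (x : Fin m → S) : ℝ≥0∞ :=
  ∫⁻ x', ‖h (J.piecewise x x')‖ₑ ^ r ∂(vecLaw μ m)

variable [MeasurableSpace B] [BorelSpace B] (r : ℝ) (μ : Measure S) [IsProbabilityMeasure μ]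
  {h : (Fin m → S) → B}

theorem measurable_frozenMoment (hh : Measurable h) (J : Finset (Fin m)) :
    Measurable (frozenMoment r μ h J) := by
  have hjoint : Measurable fun p : (Fin m → S) × (Fin m → S) =>
      ‖h (J.piecewise p.1 p.2)‖ₑ ^ r := by fun_prop
  exact hjoint.lintegral_prod_right'

theorem frozenMoment_perm (hh : Measurable h) (hs : IsSymmKernel h) {J J' : Finset (Fin m)}
    {σ : Equiv.Perm (Fin m)} (hσ : ∀ i, i ∈ J ↔ σ i ∈ J') (x : Fin m → S) :
    frozenMoment r μ h J (fun i => x (σ i)) = frozenMoment r μ h J' x := by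
  unfold frozenMoment
  rw [← (measurePreserving_perm μ σ).lintegral_comp (by fun_prop)]
  refine lintegral_congr fun y => ?_
  rw [← hs σ (J'.piecewise x y)]
  congr 3
  ext i
  simp only [Finset.piecewise, hσ i]

theorem lintegral_frozenMoment_rpow_eq_firstIndices (hh : Measurable h) (hs : IsSymmKernel h)
    (J : Finset (Fin m)) (q : ℝ) :
    ∫⁻ x, frozenMoment r μ h J x ^ q ∂(vecLaw μ m) =
      ∫⁻ x, frozenMoment r μ h (firstIndices m J.card) x ^ q ∂(vecLaw μ m) := by
  obtain ⟨σ, hσ⟩ := exists_perm_mem_firstIndices J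
  have hmeas := measurable_frozenMoment r μ hh J
  rw [← (measurePreserving_perm μ σ).lintegral_comp (by fun_prop)]
  simp only [frozenMoment_perm r μ hh hs hσ]

theorem setLIntegral_frozenMoment (hh : Measurable h) (J : Finset (Fin m)) {A : Set (Fin m → S)}
    (hA : MeasurableSet A) (hAJ : ∀ x y, (∀ i ∈ J, x i = y i) → (x ∈ A ↔ y ∈ A)) :
    ∫⁻ x in A, frozenMoment r μ h J x ∂(vecLaw μ m) = ∫⁻ x in A, ‖h x‖ₑ ^ r ∂(vecLaw μ m) := by
  have hmeas : Measurable fun x => A.indicator (fun x => ‖h x‖ₑ ^ r) x :=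
    Measurable.indicator (by fun_prop) hA
  rw [← lintegral_indicator hA, ← lintegral_indicator hA,
    ← (measurePreserving_piecewise μ J).lintegral_comp hmeas, lintegral_prod _ (by fun_prop)]
  refine lintegral_congr fun x => ?_
  have hmem : ∀ y, (J.piecewise x y ∈ A ↔ x ∈ A) := fun y =>
    hAJ _ _ fun i hi => J.piecewise_eq_of_mem _ _ hi
  by_cases hx : x ∈ A
  · simp [hx, hmem, frozenMoment, Set.indicator]
  · simp [hx, hmem, Set.indicator]

end FrozenMoment

section Transfer

variable {Ω S B : Type*} [MeasurableSpace S] {ξ : ℕ → Ω → S} {m : ℕ}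

theorem measurable_sigmaInitial_comp {β : Type*} [MeasurableSpace β] {f : (Fin m → S) → β}
    (hf : Measurable f) {j : ℕ} (hfj : ∀ x y, (∀ i ∈ firstIndices m j, x i = y i) → f x = f y) :
    Measurable[sigmaInitial ξ j] fun ω => f (initial ξ m ω) := by
  rcases isEmpty_or_nonempty Ω with hΩ | ⟨⟨ω₀⟩⟩
  · exact @measurable_of_empty _ _ (sigmaInitial ξ j) _ _ _
  let extend : (Fin j → S) → Fin m → S := fun v i =>
    if hi : (i : ℕ) < j then v ⟨i, hi⟩ else ξ 0 ω₀
  have hextend : Measurable extend := by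
    refine measurable_pi_iff.2 fun i => ?_
    by_cases hi : (i : ℕ) < j
    · simp only [extend, dif_pos hi]; fun_prop
    · simp only [extend, dif_neg hi]; fun_prop
  have hfactor : (fun ω => f (initial ξ m ω)) = fun ω => f (extend (initial ξ j ω)) := by
    ext ω
    refine hfj _ _ fun i hi => ?_
    rw [mem_firstIndices] at hi
    simp [extend, hi, initial]
  rw [hfactor]
  exact (hf.comp hextend).comp (comap_measurable _)

theorem exists_initial_preimage_eq {j : ℕ} (hj : j ≤ m) {s : Set Ω}
    (hs : MeasurableSet[sigmaInitial ξ j] s) :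
    ∃ A : Set (Fin m → S), MeasurableSet A ∧ initial ξ m ⁻¹' A = s ∧
      ∀ x y, (∀ i ∈ firstIndices m j, x i = y i) → (x ∈ A ↔ y ∈ A) := by
  obtain ⟨C, hC, rfl⟩ := hs
  have hrestrict : Measurable fun (x : Fin m → S) (i : Fin j) => x (Fin.castLE hj i) := by fun_prop
  refine ⟨_, hrestrict hC, rfl, fun x y hxy => ?_⟩
  have heq : (fun i : Fin j => x (Fin.castLE hj i)) = fun i => y (Fin.castLE hj i) :=
    funext fun i => hxy _ (mem_firstIndices.2 i.2)
  simp only [Set.mem_preimage, heq]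

variable [MeasurableSpace Ω] {P : Measure Ω}

theorem measurePreserving_sample (hξ : ∀ i, Measurable (ξ i))
    (hind : iIndepFun ξ P) (hid : ∀ i, IdentDistrib (ξ i) (ξ 0) P P) :
    MeasurePreserving (fun ω i => ξ i ω) P (seqLaw (P.map (ξ 0))) := by
  refine ⟨by fun_prop, ?_⟩
  rw [hind.map_fun_eq_infinitePi_map₀' fun i => (hξ i).aemeasurable]
  simp only [(hid _).map_eq]

variable {μ : Measure S} [IsProbabilityMeasure μ]

theorem measurePreserving_initial (hξ : MeasurePreserving (fun ω i => ξ i ω) P (seqLaw μ))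
    (j : ℕ) : MeasurePreserving (initial ξ j) P (vecLaw μ j) :=
  (measurePreserving_seq_comp μ Fin.val_injective).comp hξ

variable [NormedAddCommGroup B] [MeasurableSpace B] [BorelSpace B] {h : (Fin m → S) → B}

theorem frozenMoment_initial_ae_eq [IsProbabilityMeasure P]
    (hξ : MeasurePreserving (fun ω i => ξ i ω) P (seqLaw μ)) (hh : Measurable h) (r : ℝ) {j : ℕ}
    (hj : j ≤ m) :
    (fun ω => frozenMoment r μ h (firstIndices m j) (initial ξ m ω)) =ᵐ[P]
      P⁻[fun ω => ‖h (initial ξ m ω)‖ₑ ^ r | sigmaInitial ξ j] := by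
  have hinitial := measurePreserving_initial hξ m
  have hmeas := measurable_frozenMoment r μ hh (firstIndices m j)
  refine ae_eq_condLExp (measurePreserving_initial hξ j).measurable.comap_le P _
    (measurable_sigmaInitial_comp hmeas fun x y hxy => ?_) fun s hs => ?_
  · refine lintegral_congr fun z => ?_
    rw [Finset.piecewise_congr _ hxy fun _ _ => rfl]
  · obtain ⟨A, hA, rfl, hAJ⟩ := exists_initial_preimage_eq hj hs
    rw [hinitial.setLIntegral_comp_preimage hA hmeas, setLIntegral_frozenMoment r _ hh _ hA hAJ]
    exact (hinitial.setLIntegral_comp_preimage hA (f := fun x => ‖h x‖ₑ ^ r) (by fun_prop)).symm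

theorem lintegral_frozenMoment_rpow_lt_top [IsProbabilityMeasure P]
    (hξ : MeasurePreserving (fun ω i => ξ i ω) P (seqLaw μ)) (hh : Measurable h) {r q : ℝ}
    (hq : 0 < q) {j : ℕ} (hj : j ≤ m) (hH : MemLp (condMoment P ξ h r j) (ENNReal.ofReal q) P) :
    ∫⁻ x, frozenMoment r μ h (firstIndices m j) x ^ (q / r) ∂(vecLaw μ m) < ∞ := by
  have hmeas := measurable_frozenMoment r μ hh (firstIndices m j)
  rw [← (measurePreserving_initial hξ m).lintegral_comp (by fun_prop)]
  refine (lintegral_congr_ae ?_).trans_lt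
    (lintegral_rpow_enorm_lt_top_of_eLpNorm_lt_top (by simpa using hq) (by simp) hH.2)
  filter_upwards [frozenMoment_initial_ae_eq hξ hh r hj] with ω hω
  rw [condMoment, enorm_eq_self, ENNReal.toReal_ofReal hq.le, ← ENNReal.rpow_mul, hω,
    one_div_mul_eq_div]

theorem lintegral_enorm_rpow_lt_top_of_frozenMoment (hh : Measurable h) {r q : ℝ} (hr : 0 < r)
    (hq : r ≤ q) {J : Finset (Fin m)}
    (hJ : ∫⁻ x, frozenMoment r μ h J x ^ (q / r) ∂(vecLaw μ m) < ∞) :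
    ∫⁻ x, ‖h x‖ₑ ^ r ∂(vecLaw μ m) < ∞ := by
  have hmarginal := setLIntegral_frozenMoment r μ hh J MeasurableSet.univ (by simp)
  rw [Measure.restrict_univ] at hmarginal
  rw [← hmarginal]
  calc ∫⁻ x, frozenMoment r μ h J x ∂(vecLaw μ m)
      ≤ ∫⁻ x, (1 + frozenMoment r μ h J x ^ (q / r)) ∂(vecLaw μ m) := by
        refine lintegral_mono fun x => ?_
        rcases le_total (frozenMoment r μ h J x) 1 with hx | hx
        · exact hx.trans le_self_add
        · calc frozenMoment r μ h J x = frozenMoment r μ h J x ^ (1 : ℝ) :=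
                (ENNReal.rpow_one _).symm
            _ ≤ frozenMoment r μ h J x ^ (q / r) :=
                ENNReal.rpow_le_rpow_of_exponent_le hx ((one_le_div hr).2 hq)
            _ ≤ _ := le_add_self
    _ < ∞ := by
        rw [lintegral_add_left measurable_const]
        simpa using hJ

variable [NormedSpace ℝ B] [CompleteSpace B] [TopologicalSpace.SeparableSpace B]

theorem setIntegral_eq_zero_of_condExp_initial_eq_zero [IsFiniteMeasure P]
    (hξ : MeasurePreserving (fun ω i => ξ i ω) P (seqLaw μ)) (hh : Measurable h)
    (hi : Integrable (fun ω => h (initial ξ m ω)) P) {j : ℕ}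
    (h0 : P[fun ω => h (initial ξ m ω) | sigmaInitial ξ j] =ᵐ[P] 0) {A : Set (Fin m → S)}
    (hA : MeasurableSet A)
    (hAj : ∀ x y, (∀ i ∈ firstIndices m j, x i = y i) → (x ∈ A ↔ y ∈ A)) :
    ∫ x in A, h x ∂(vecLaw μ m) = 0 := by
  have hinitial := measurePreserving_initial hξ m
  have hpreimage : MeasurableSet[sigmaInitial ξ j] (initial ξ m ⁻¹' A) :=
    @Measurable.setOf _ (sigmaInitial ξ j) _
      (measurable_sigmaInitial_comp hA.mem fun x y hxy => propext (hAj x y hxy))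
  rw [← hinitial.map_eq, setIntegral_map hA hh.stronglyMeasurable.aestronglyMeasurable
    hinitial.aemeasurable, ← setIntegral_condExp
      (measurePreserving_initial hξ j).measurable.comap_le hi hpreimage,
    integral_congr_ae (ae_restrict_of_ae h0)]
  simp

theorem IsSymmKernel.setIntegral_eq_zero_of_condExp_initial_eq_zero [IsFiniteMeasure P]
    (hs : IsSymmKernel h) (hξ : MeasurePreserving (fun ω i => ξ i ω) P (seqLaw μ))
    (hh : Measurable h) (hi : Integrable (fun ω => h (initial ξ m ω)) P) {j : ℕ}
    (h0 : P[fun ω => h (initial ξ m ω) | sigmaInitial ξ j] =ᵐ[P] 0) {T : Finset (Fin m)}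
    (hT : T.card ≤ j) {A : Set (Fin m → S)} (hA : MeasurableSet A)
    (hAT : ∀ x y, (∀ i ∈ T, x i = y i) → (x ∈ A ↔ y ∈ A)) :
    ∫ x in A, h x ∂(vecLaw μ m) = 0 := by
  obtain ⟨σ, hσ⟩ := exists_perm_mem_firstIndices T
  have hperm := measurePreserving_perm (m := m) μ σ
  rw [← hperm.map_eq, setIntegral_map hA hh.stronglyMeasurable.aestronglyMeasurable
    hperm.aemeasurable]
  simp only [hs σ]
  refine UStat.setIntegral_eq_zero_of_condExp_initial_eq_zero hξ hh hi h0 (hperm.measurable hA)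
    fun x y hxy => hAT _ _ fun i hi => hxy _ ?_
  exact mem_firstIndices.2 ((mem_firstIndices.1 ((hσ i).1 hi)).trans_le hT)

end Transfer

section PointKernel

universe u v

variable {S : Type u} {B : Type v} {m : ℕ}

/-- A kernel of the variables alone, regarded as a kernel with trivial parameter spaces. -/
def pointKernel (h : (Fin m → S) → B) : PUnit.{u + 1} × PUnit.{u + 1} × (Fin m → S) → B :=
  fun p => h p.2.2

variable [MeasurableSpace S]

theorem measurable_pointKernel [MeasurableSpace B] {h : (Fin m → S) → B} (hh : Measurable h) :
    Measurable (pointKernel h) :=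
  hh.comp (measurable_snd.comp measurable_snd)

variable {μ : Measure S} [NormedAddCommGroup B] {h : (Fin m → S) → B}

theorem momentCond_pointKernel_iff {r : ℝ} {q : ℕ → ℝ} {J : Finset (Fin m)} :
    MomentCond r μ (Measure.dirac PUnit.unit) (Measure.dirac PUnit.unit) q (pointKernel h) J ↔
      ∫⁻ x, frozenMoment r μ h J x ^ (q J.card / r) ∂(vecLaw μ m) < ∞ := by
  simp only [MomentCond, lintegral_dirac, pointKernel, frozenMoment]

variable [IsProbabilityMeasure μ]

theorem measurePreserving_forget_parameters :
    MeasurePreserving (fun p : PUnit.{u + 1} × PUnit.{u + 1} × (Fin m → S) => p.2.2)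
      (jointLaw μ (Measure.dirac PUnit.unit) (Measure.dirac PUnit.unit) m) (vecLaw μ m) :=
  measurePreserving_snd.comp measurePreserving_snd

theorem momentCond_pointKernel_empty {r : ℝ} {q : ℕ → ℝ} (hr : 0 ≤ r) (hq : 0 ≤ q 0)
    (hi : ∫⁻ x, ‖h x‖ₑ ^ r ∂(vecLaw μ m) < ∞) :
    MomentCond r μ (Measure.dirac PUnit.unit) (Measure.dirac PUnit.unit) q (pointKernel h) ∅ := by
  simp only [momentCond_pointKernel_iff, frozenMoment, Finset.piecewise_empty, Finset.card_empty,
    lintegral_const, measure_univ, mul_one]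
  exact ENNReal.rpow_lt_top_of_nonneg (by positivity) hi.ne

variable [MeasurableSpace B] [BorelSpace B] {Ω : Type*} [MeasurableSpace Ω] {P : Measure Ω}
  {ξ : ℕ → Ω → S}

theorem momentCond_pointKernel_of_memLp [IsProbabilityMeasure P]
    (hξ : MeasurePreserving (fun ω i => ξ i ω) P (seqLaw μ)) (hh : Measurable h)
    (hs : IsSymmKernel h) {r : ℝ} {q : ℕ → ℝ} {J : Finset (Fin m)} (hq : 0 < q J.card)
    (hH : MemLp (condMoment P ξ h r J.card) (ENNReal.ofReal (q J.card)) P) :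
    MomentCond r μ (Measure.dirac PUnit.unit) (Measure.dirac PUnit.unit) q (pointKernel h) J := by
  rw [momentCond_pointKernel_iff, lintegral_frozenMoment_rpow_eq_firstIndices r μ hh hs]
  exact lintegral_frozenMoment_rpow_lt_top hξ hh hq (card_finset_fin_le J) hH

variable [TopologicalSpace.SeparableSpace B]

theorem integrable_pointKernel (hξ : MeasurePreserving (fun ω i => ξ i ω) P (seqLaw μ))
    (hh : Measurable h) (hi : Integrable (fun ω => h (initial ξ m ω)) P) :
    Integrable (pointKernel h)
      (jointLaw μ (Measure.dirac PUnit.unit) (Measure.dirac PUnit.unit) m) :=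
  measurePreserving_forget_parameters.integrable_comp_of_integrable
    (((measurePreserving_initial hξ m).integrable_comp
      hh.stronglyMeasurable.aestronglyMeasurable).1 hi)

theorem degenerateCond_pointKernel [NormedSpace ℝ B] [CompleteSpace B] [IsFiniteMeasure P]
    (hξ : MeasurePreserving (fun ω i => ξ i ω) P (seqLaw μ)) (hh : Measurable h)
    (hs : IsSymmKernel h) (hi : Integrable (fun ω => h (initial ξ m ω)) P) {d : ℕ}
    (h0 : P[fun ω => h (initial ξ m ω) | sigmaInitial ξ (d - 1)] =ᵐ[P] 0) :
    DegenerateCond μ (Measure.dirac PUnit.unit) (Measure.dirac PUnit.unit) d (pointKernel h) := by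
  intro T hT A hA hAT
  have hforget := measurePreserving_forget_parameters (m := m) (μ := μ)
  have hsection : Measurable fun x : Fin m → S => ((PUnit.unit, PUnit.unit, x) :
    PUnit.{u + 1} × PUnit.{u + 1} × (Fin m → S)) := by fun_prop
  have hzero := hs.setIntegral_eq_zero_of_condExp_initial_eq_zero hξ hh hi h0
    (Nat.le_sub_one_of_lt hT) (hsection hA) (hAT PUnit.unit PUnit.unit)
  rwa [← hforget.map_eq, setIntegral_map (hsection hA)
    hh.stronglyMeasurable.aestronglyMeasurable hforget.aemeasurable] at hzero

end PointKernel

/-! ### Reduction of the series to dyadic blocks -/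

section Estimates

theorem pow_le_pow_self_mul_choose {m n : ℕ} (h : m ≤ n) : n ^ m ≤ m ^ m * n.choose m := by
  induction m generalizing n with
  | zero => simp
  | succ m ih =>
    obtain ⟨n, rfl⟩ := Nat.exists_eq_add_of_le' (Nat.succ_pos m |>.trans_le h)
    have hmn : m ≤ n := Nat.succ_le_succ_iff.1 h
    have hpow : (n + 1) ^ m ≤ (m + 1) ^ m * n.choose m := by
      refine Nat.le_of_mul_le_mul_left ?_ (Nat.pow_self_pos (n := m))
      calc m ^ m * (n + 1) ^ m = (m * (n + 1)) ^ m := (mul_pow _ _ _).symm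
        _ ≤ ((m + 1) * n) ^ m := Nat.pow_le_pow_left (by nlinarith) m
        _ = (m + 1) ^ m * n ^ m := mul_pow _ _ _
        _ ≤ (m + 1) ^ m * (m ^ m * n.choose m) := Nat.mul_le_mul_left _ (ih hmn)
        _ = m ^ m * ((m + 1) ^ m * n.choose m) := by ring
    calc (n + 1) ^ (m + 1) = (n + 1) * (n + 1) ^ m := by ring
      _ ≤ (n + 1) * ((m + 1) ^ m * n.choose m) := Nat.mul_le_mul_left _ hpow
      _ = (m + 1) ^ m * ((n + 1) * n.choose m) := by ring
      _ = (m + 1) ^ (m + 1) * (n + 1).choose (m + 1) := by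
          rw [Nat.add_one_mul_choose_eq]; ring

theorem rpow_add_one_le_sub_of_nonpos {γ : ℝ} (hγ : -1 < γ) (hγ0 : γ ≤ 0) (M : ℕ) :
    (M : ℝ) ^ (γ + 1) ≤ (M + 1 : ℝ) ^ (γ + 1) - (γ + 1) * (M + 1 : ℝ) ^ γ := by
  have hM : (0 : ℝ) < M + 1 := by positivity
  have hstep : (-1 : ℝ) ≤ -1 / (M + 1) := by
    rw [le_div_iff₀ hM]
    linarith [(Nat.cast_nonneg M : (0 : ℝ) ≤ M)]
  calc (M : ℝ) ^ (γ + 1) = ((M + 1) * (1 + -1 / (M + 1))) ^ (γ + 1) := by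
        congr 1
        field_simp
        ring
    _ = (M + 1 : ℝ) ^ (γ + 1) * (1 + -1 / (M + 1)) ^ (γ + 1) :=
        Real.mul_rpow hM.le (by linarith)
    _ ≤ (M + 1 : ℝ) ^ (γ + 1) * (1 + (γ + 1) * (-1 / (M + 1))) := by
        gcongr
        exact rpow_one_add_le_one_add_mul_self hstep (by linarith) (by linarith)
    _ = _ := by
        rw [Real.rpow_add_one hM.ne']
        field_simp
        ring

theorem exists_sum_range_rpow_le {γ : ℝ} (hγ : -1 < γ) :
    ∃ K : ℝ, 0 < K ∧
      ∀ M : ℕ, ∑ N ∈ Finset.range M, ((N + 1 : ℕ) : ℝ) ^ γ ≤ K * (M : ℝ) ^ (γ + 1) := by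
  have hp : 0 < γ + 1 := by linarith
  rcases le_total 0 γ with hγ0 | hγ0
  · refine ⟨1, one_pos, fun M => ?_⟩
    calc ∑ N ∈ Finset.range M, ((N + 1 : ℕ) : ℝ) ^ γ ≤ ∑ _ ∈ Finset.range M, (M : ℝ) ^ γ := by
          gcongr with N hN
          exact Nat.succ_le_of_lt (Finset.mem_range.1 hN)
      _ = M * (M : ℝ) ^ γ := by simp
      _ = 1 * (M : ℝ) ^ (γ + 1) := by
          rw [Real.rpow_add_one' (by positivity) hp.ne', one_mul, mul_comm]
  · refine ⟨1 / (γ + 1), by positivity, fun M => ?_⟩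
    induction M with
    | zero => simp [Real.zero_rpow hp.ne']
    | succ M ih =>
      rw [Finset.sum_range_succ]
      push_cast at ih ⊢
      calc _ ≤ 1 / (γ + 1) * (M : ℝ) ^ (γ + 1) + (M + 1 : ℝ) ^ γ := by gcongr
        _ ≤ 1 / (γ + 1) * ((M + 1 : ℝ) ^ (γ + 1) - (γ + 1) * (M + 1 : ℝ) ^ γ)
            + (M + 1 : ℝ) ^ γ := by
            gcongr
            exact rpow_add_one_le_sub_of_nonpos hγ hγ0 M
        _ = _ := by field_simp; ring

theorem mul_rpow_sub_lt_of_lt_rpow_div_choose_mul {α ε u : ℝ} {m n : ℕ} (hn : 0 < n) (hmn : m ≤ n)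
    (hu : 0 ≤ u) (h : ε < (n : ℝ) ^ α * (1 / (n.choose m : ℝ)) * u) :
    ε * (n : ℝ) ^ ((m : ℝ) - α) < (m : ℝ) ^ m * u := by
  have hn' : (0 : ℝ) < n := by exact_mod_cast hn
  have hchoose : (0 : ℝ) < n.choose m := by exact_mod_cast Nat.choose_pos hmn
  have hpow : (n : ℝ) ^ m ≤ (m : ℝ) ^ m * n.choose m := by
    exact_mod_cast pow_le_pow_self_mul_choose hmn
  rw [Real.rpow_sub hn', Real.rpow_natCast]
  calc ε * ((n : ℝ) ^ m / (n : ℝ) ^ α)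
      < ((n : ℝ) ^ α * (1 / (n.choose m : ℝ)) * u) * ((n : ℝ) ^ m / (n : ℝ) ^ α) := by gcongr
    _ = ((n : ℝ) ^ m / n.choose m) * u := by field_simp
    _ ≤ (m : ℝ) ^ m * u := by
        gcongr
        rwa [div_le_iff₀ hchoose]

theorem two_rpow_log_add_one_mul_le {s : ℝ} (hs : 0 ≤ s) {n : ℕ} (hn : n ≠ 0) :
    (2 : ℝ) ^ (((Nat.log 2 n + 1 : ℕ) : ℝ) * s) ≤ 2 ^ s * (n : ℝ) ^ s := by
  have hlog : (2 : ℝ) ^ Nat.log 2 n ≤ n := by exact_mod_cast Nat.pow_log_le_self 2 hn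
  push_cast
  rw [add_mul, one_mul, Real.rpow_add two_pos, mul_comm, Real.rpow_mul two_pos.le,
    Real.rpow_natCast]
  gcongr

theorem exists_tsum_rpow_indicator_le {γ : ℝ} (hγ : -1 < γ) :
    ∃ K : ℝ, 0 < K ∧ ∀ c : ℕ, ∑' N : ℕ, ENNReal.ofReal (((N + 1 : ℕ) : ℝ) ^ γ) *
      (if N + 1 < 2 ^ c then 1 else 0) ≤ ENNReal.ofReal (K * 2 ^ (c * (γ + 1))) := by
  obtain ⟨K, hK, hsum⟩ := exists_sum_range_rpow_le hγ
  refine ⟨K, hK, fun c => ?_⟩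
  calc ∑' N : ℕ, ENNReal.ofReal (((N + 1 : ℕ) : ℝ) ^ γ) * (if N + 1 < 2 ^ c then 1 else 0)
      = ∑ N ∈ Finset.range (2 ^ c), ENNReal.ofReal (((N + 1 : ℕ) : ℝ) ^ γ) *
        (if N + 1 < 2 ^ c then 1 else 0) := tsum_eq_sum fun N hN => by
          rw [if_neg fun h => hN (Finset.mem_range.2 (by omega)), mul_zero]
    _ ≤ ∑ N ∈ Finset.range (2 ^ c), ENNReal.ofReal (((N + 1 : ℕ) : ℝ) ^ γ) :=
        Finset.sum_le_sum fun N _ => mul_le_of_le_one_right' (by split_ifs <;> simp)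
    _ = ENNReal.ofReal (∑ N ∈ Finset.range (2 ^ c), ((N + 1 : ℕ) : ℝ) ^ γ) :=
        (ENNReal.ofReal_sum_of_nonneg fun _ _ => by positivity).symm
    _ ≤ ENNReal.ofReal (K * 2 ^ (c * (γ + 1))) := by
        gcongr
        have h2c := hsum (2 ^ c)
        rwa [Nat.cast_pow, Nat.cast_ofNat, ← Real.rpow_natCast, ← Real.rpow_mul two_pos.le] at h2c

theorem exists_tsum_rpow_mul_le_tsum_dyadic {γ : ℝ} (hγ : -1 < γ) :
    ∃ K : ℝ, ∀ p t : ℕ → ℝ≥0∞, (∀ N, p N ≤ ∑' c : ℕ, if N + 1 < 2 ^ c then t c else 0) →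
      ∑' N : ℕ, ENNReal.ofReal (((N + 1 : ℕ) : ℝ) ^ γ) * p N ≤
        ENNReal.ofReal K * ∑' c : ℕ, ENNReal.ofReal (2 ^ (c * (γ + 1))) * t c := by
  obtain ⟨K, hK, hblock⟩ := exists_tsum_rpow_indicator_le hγ
  refine ⟨K, fun p t hp => ?_⟩
  calc ∑' N : ℕ, ENNReal.ofReal (((N + 1 : ℕ) : ℝ) ^ γ) * p N
      ≤ ∑' N : ℕ, ∑' c : ℕ, ENNReal.ofReal (((N + 1 : ℕ) : ℝ) ^ γ) *
          (if N + 1 < 2 ^ c then 1 else 0) * t c := by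
        refine ENNReal.tsum_le_tsum fun N => ?_
        simp only [mul_assoc, ite_mul, one_mul, zero_mul, ENNReal.tsum_mul_left]
        gcongr
        exact hp N
    _ = ∑' c : ℕ, (∑' N : ℕ, ENNReal.ofReal (((N + 1 : ℕ) : ℝ) ^ γ) *
          (if N + 1 < 2 ^ c then 1 else 0)) * t c := by
        rw [ENNReal.tsum_comm]
        simp only [ENNReal.tsum_mul_right]
    _ ≤ ∑' c : ℕ, ENNReal.ofReal K * (ENNReal.ofReal (2 ^ (c * (γ + 1))) * t c) := by
        refine ENNReal.tsum_le_tsum fun c => ?_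
        rw [← mul_assoc, ← ENNReal.ofReal_mul hK.le]
        gcongr
        exact hblock c
    _ = _ := ENNReal.tsum_mul_left

end Estimates

section Sample

variable {Ω S B : Type*} [NormedAddCommGroup B] {ξ : ℕ → Ω → S} {m : ℕ} {h : (Fin m → S) → B}

theorem IsSymmKernel.uStat_eq_kernelSum (hs : IsSymmKernel h) (n : ℕ) (ω : Ω) :
    uStat ξ h n ω = kernelSum h n fun i => ξ i ω := by
  unfold uStat kernelSum
  refine Finset.sum_bij (fun i _ l => (i (Fin.rev l) : ℕ)) ?_ ?_ ?_ ?_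
  · intro i hi
    have hmono : StrictMono i := by simpa [incIndices] using hi
    exact mem_decIndices.2 ⟨fun l => (i _).2, fun a b hab => hmono (Fin.rev_lt_rev.2 hab)⟩
  · intro i _ i' _ hii'
    ext l
    simpa using congrFun hii' (Fin.rev l)
  · intro I hI
    rw [mem_decIndices] at hI
    refine ⟨fun l => ⟨I (Fin.rev l), hI.1 _⟩, ?_, ?_⟩
    · simp only [incIndices, Finset.mem_filter, Finset.mem_univ, true_and]
      exact fun a b hab => hI.2 (Fin.rev_lt_rev.2 hab)
    · ext l
      simp
  · intro i _
    exact (hs Fin.revPerm fun l => ξ (i l) ω).symm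

theorem exists_dyadic_of_lt_iSup_uStat {α ε : ℝ} (hαm : α ≤ m) (hε : 0 ≤ ε) {N : ℕ} {ω : Ω}
    (hω : ENNReal.ofReal ε < ⨆ n : ℕ, ⨆ _ : max (N + 1) m ≤ n,
      ENNReal.ofReal ((n : ℝ) ^ α * (1 / (n.choose m : ℝ)) * ‖uStat ξ h n ω‖)) :
    ∃ c : ℕ, N + 1 < 2 ^ c ∧ ∃ n ≤ 2 ^ c,
      ENNReal.ofReal (ε / ((m : ℝ) ^ m * 2 ^ (m - α)) * 2 ^ (c * (m - α))) <
        ‖uStat ξ h n ω‖ₑ := by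
  simp only [lt_iSup_iff] at hω
  obtain ⟨n, hn, hlt⟩ := hω
  have hNn : N + 1 ≤ n := (le_max_left _ _).trans hn
  have hn0 : 0 < n := Nat.succ_pos N |>.trans_le hNn
  have hnlog : n < 2 ^ (Nat.log 2 n + 1) := Nat.lt_pow_succ_log_self one_lt_two n
  have hmm : (0 : ℝ) < (m : ℝ) ^ m := by exact_mod_cast Nat.pow_self_pos
  refine ⟨Nat.log 2 n + 1, hNn.trans_lt hnlog, n, hnlog.le, ?_⟩
  rw [← ofReal_norm, ENNReal.ofReal_lt_ofReal_iff_of_nonneg (by positivity)]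
  calc ε / ((m : ℝ) ^ m * 2 ^ ((m : ℝ) - α)) * 2 ^ (((Nat.log 2 n + 1 : ℕ) : ℝ) * (m - α))
      ≤ ε / ((m : ℝ) ^ m * 2 ^ ((m : ℝ) - α)) *
        (2 ^ ((m : ℝ) - α) * (n : ℝ) ^ ((m : ℝ) - α)) := by
        gcongr
        exact two_rpow_log_add_one_mul_le (sub_nonneg.2 hαm) hn0.ne'
    _ = (ε * (n : ℝ) ^ ((m : ℝ) - α)) / (m : ℝ) ^ m := by field_simp
    _ < ‖uStat ξ h n ω‖ := by
        rw [div_lt_iff₀' hmm]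
        exact mul_rpow_sub_lt_of_lt_rpow_div_choose_mul hn0 ((le_max_right _ _).trans hn)
          (norm_nonneg _) ((ENNReal.ofReal_lt_ofReal_iff_of_nonneg hε).1 hlt)

end Sample

section Reduction

universe u v w

theorem maxTail_le_geomTail {S B F Y : Type*} [MeasurableSpace S] [NormedAddCommGroup B]
    [MeasurableSpace F] [MeasurableSpace Y] (r η : ℝ) (μ : Measure S)
    (φ : Measure F) (ν : Measure Y) {k : ℕ} (g : F × Y × (Fin k → S) → B) (N : ℕ) (t : ℝ) :
    maxTail r μ φ ν g N t ≤ geomTail r η μ φ ν g N t := by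
  simpa [geomTail] using ENNReal.le_tsum (f := fun l : ℕ => ENNReal.ofReal (η ^ l) *
    maxTail r μ φ ν g N (t / 2 ^ l)) 0

variable {Ω : Type w} {S : Type u} {B : Type v} [MeasurableSpace Ω] [MeasurableSpace S]
  [NormedAddCommGroup B] [TopologicalSpace.SeparableSpace B] [MeasurableSpace B] [BorelSpace B]
  {P : Measure Ω} {ξ : ℕ → Ω → S} {m : ℕ} {h : (Fin m → S) → B} {μ : Measure S}
  [IsProbabilityMeasure μ]

theorem measure_exists_lt_uStat_eq_maxTail
    (hξ : MeasurePreserving (fun ω i => ξ i ω) P (seqLaw μ)) (hh : Measurable h)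
    (hs : IsSymmKernel h) {r : ℝ} (hr : 0 < r) (M : ℕ) (t : ℝ) :
    P {ω | ∃ n ≤ M, ENNReal.ofReal t < ‖uStat ξ h n ω‖ₑ} =
      maxTail r μ (Measure.dirac PUnit.unit) (Measure.dirac PUnit.unit) (pointKernel h) M t := by
  have hpair : MeasurePreserving (fun ω => (PUnit.unit.{u + 1}, fun i => ξ i ω)) P
      ((Measure.dirac PUnit.unit).prod (seqLaw μ)) :=
    MeasurePreserving.comp ⟨by fun_prop, (Measure.dirac_prod _).symm⟩ hξ
  have huNorm : ∀ n ω, uNorm r (Measure.dirac PUnit.unit) (pointKernel.{u} h) n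
      (PUnit.unit, fun i => ξ i ω) = ‖uStat ξ h n ω‖ₑ := by
    intro n ω
    simp [uNorm, pointKernel, eLpNorm'_const _ hr, hs.uStat_eq_kernelSum]
  rw [maxTail, ← hpair.measure_preimage
    (measurableSet_exists_lt_uNorm r _ (measurable_pointKernel hh) M t).nullMeasurableSet]
  simp only [Set.preimage_ofPred_eq, huNorm]

theorem exists_tsum_measure_lt_iSup_uStat_le_dyadicTail
    (hξ : MeasurePreserving (fun ω i => ξ i ω) P (seqLaw μ)) (hh : Measurable h)
    (hs : IsSymmKernel h) {r α γ ε : ℝ} (hr : 0 < r) (hαm : α ≤ m) (hγ : -1 < γ) (hε : 0 < ε) :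
    ∃ K δ : ℝ, 0 < δ ∧ ∀ η : ℝ, ∑' N : ℕ, ENNReal.ofReal (((N + 1 : ℕ) : ℝ) ^ γ) *
      P {ω | ENNReal.ofReal ε < ⨆ n : ℕ, ⨆ _ : max (N + 1) m ≤ n,
          ENNReal.ofReal ((n : ℝ) ^ α * (1 / (n.choose m : ℝ)) * ‖uStat ξ h n ω‖)} ≤
      ENNReal.ofReal K * dyadicTail r η μ (Measure.dirac PUnit.unit) (Measure.dirac PUnit.unit)
        (γ + 1) (m - α) (pointKernel h) δ := by
  obtain ⟨K, hsum⟩ := exists_tsum_rpow_mul_le_tsum_dyadic hγ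
  have hmm : (0 : ℝ) < (m : ℝ) ^ m := by exact_mod_cast Nat.pow_self_pos
  set δ : ℝ := ε / ((m : ℝ) ^ m * 2 ^ ((m : ℝ) - α))
  refine ⟨K, δ, by positivity, fun η => ?_⟩
  refine (hsum _ (fun c => P {ω | ∃ n ≤ 2 ^ c,
    ENNReal.ofReal (δ * 2 ^ (c * ((m : ℝ) - α))) < ‖uStat ξ h n ω‖ₑ}) fun N => ?_).trans ?_
  · calc P {ω | ENNReal.ofReal ε < ⨆ n : ℕ, ⨆ _ : max (N + 1) m ≤ n,
          ENNReal.ofReal ((n : ℝ) ^ α * (1 / (n.choose m : ℝ)) * ‖uStat ξ h n ω‖)}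
        ≤ P (⋃ c : ℕ, {ω | N + 1 < 2 ^ c ∧ ∃ n ≤ 2 ^ c,
          ENNReal.ofReal (δ * 2 ^ (c * ((m : ℝ) - α))) < ‖uStat ξ h n ω‖ₑ}) :=
          measure_mono fun ω hω => Set.mem_iUnion.2 (exists_dyadic_of_lt_iSup_uStat hαm hε.le hω)
      _ ≤ _ := by
          refine (measure_iUnion_le _).trans (ENNReal.tsum_le_tsum fun c => ?_)
          split_ifs with hc <;> simp [hc]
  · unfold dyadicTail
    gcongr with c
    rw [measure_exists_lt_uStat_eq_maxTail hξ hh hs hr]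
    exact maxTail_le_geomTail _ _ _ _ _ _ _ _

end Reduction

section Exponents

variable {α γ r : ℝ} {m d : ℕ}

theorem momentExponent_denominator_pos (hr : 1 < r) (hαd : α < (r - 1) * d / r) (j : ℕ) :
    0 < (max d j : ℕ) * ((r - 1) / r) - α + j / r := by
  have hr0 : 0 ≤ r := by linarith
  have hmax : (d : ℝ) * ((r - 1) / r) ≤ (max d j : ℕ) * ((r - 1) / r) :=
    mul_le_mul_of_nonneg_right (by exact_mod_cast le_max_left d j)
      (div_nonneg (by linarith) hr0)
  have hα : (r - 1) * d / r = d * ((r - 1) / r) := by ring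
  have hj : (0 : ℝ) ≤ j / r := div_nonneg (Nat.cast_nonneg j) hr0
  linarith

theorem momentExponent_pos (hr : 1 < r) (hαd : α < (r - 1) * d / r) (hγ : -1 < γ) (j : ℕ) :
    0 < momentExponent α d j γ r :=
  div_pos (by linarith [(Nat.cast_nonneg j : (0 : ℝ) ≤ j)])
    (momentExponent_denominator_pos hr hαd j)

theorem exponentCond_momentExponent (hr : 1 < r) (hαd : α < (r - 1) * d / r) (hγ : -1 < γ) :
    ExponentCond r m d (γ + 1) (m - α) fun j => momentExponent α d j γ r := by
  intro j a c hm he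
  have hden := momentExponent_denominator_pos hr hαd j
  have hle : (max d j : ℕ) * ((r - 1) / r) - α + j / r ≤ m - α - a / r - c := by
    have hmax : ((max d j : ℕ) : ℝ) * ((r - 1) / r) ≤ (a + j : ℕ) * ((r - 1) / r) :=
      mul_le_mul_of_nonneg_right (by exact_mod_cast max_le he (Nat.le_add_left j a))
        (div_nonneg (by linarith) (by linarith))
    have hsum : (m : ℝ) = j + a + c := by exact_mod_cast hm.symm
    have hsplit : ((a + j : ℕ) : ℝ) * ((r - 1) / r) = a + j - a / r - j / r := by
      push_cast
      field_simp
      ring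
    linarith
  refine ⟨hden.trans_le hle, ?_⟩
  calc γ + 1 + j = momentExponent α d j γ r *
        ((max d j : ℕ) * ((r - 1) / r) - α + j / r) := by
        rw [momentExponent, div_mul_cancel₀ _ hden.ne']
        ring
    _ ≤ _ := by
        gcongr
        exact (momentExponent_pos hr hαd hγ j).le

end Exponents

section Convergence

universe u v

open scoped Topology

theorem exists_dyadicTail_lt_top {S F Y : Type u} {B : Type v} [MeasurableSpace S]
    [NormedAddCommGroup B] [NormedSpace ℝ B] [CompleteSpace B] [TopologicalSpace.SeparableSpace B]
    [MeasurableSpace B] [BorelSpace B] [MeasurableSpace F] [Unique F] [MeasurableSpace Y]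
    {μ : Measure S} [IsProbabilityMeasure μ] {φ : Measure F} [IsProbabilityMeasure φ]
    {ν : Measure Y} [IsProbabilityMeasure ν] {r C : ℝ} (hr : 1 < r) (hC0 : 0 < C)
    (hC : IsMartingaleTypeConst B μ r C) {k e : ℕ} {g : F × Y × (Fin (k + 1) → S) → B}
    {q : ℕ → ℝ} {ρ τ : ℝ} (hg : Measurable g) (hgi : Integrable g (jointLaw μ φ ν (k + 1)))
    (hρ : 0 < ρ) (hq : ∀ j, 0 ≤ q j) (hE : ExponentCond r (k + 1) e ρ τ q)
    (hM : ∀ J, J.Nonempty → MomentCond r μ φ ν q g J) (hM0 : r ≤ q 1 → MomentCond r μ φ ν q g ∅)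
    (hD : DegenerateCond μ φ ν e g) :
    ∃ η, ∀ ε, 0 < ε → dyadicTail r η μ φ ν ρ τ g ε < ∞ := by
  rcases le_or_gt r (q 1) with hqr | hqr
  · have hsmall : ∀ᶠ η in 𝓝[>] (0 : ℝ), ∀ j ∈ Finset.range (k + 2), η * 2 ^ q j < 1 :=
      (Finset.eventually_all _).2 fun j _ => eventually_nhdsGT_zero_mul_lt_one _
    obtain ⟨η, ⟨hηq, hη1⟩, hη⟩ :=
      ((hsmall.and (eventually_nhdsGT_zero_mul_lt_one 1)).and self_mem_nhdsWithin).exists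
    rw [mul_one] at hη1
    exact ⟨η, fun ε hε => dyadicTail_lt_top_of_momentCond hr hC0 hC hη hη1 (k + 1) φ ν hg hgi hρ
      (fun j _ => hq j) (fun j hj => hηq j (Finset.mem_range.2 (by omega))) hE
      (fun _ J => J.eq_empty_or_nonempty.elim (fun hJ => hJ ▸ hM0 hqr) (hM J)) hD hε⟩
  · obtain ⟨η, hη⟩ := (eventually_dyadicTail_lt_top hr hC0 hC k hρ hq hqr fun j a c hk he =>
      (hE j a c hk he).imp_right fun h _ => h).exists
    exact ⟨η, fun ε hε => hη φ ν hg hgi (fun _ => hM) hD hε⟩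

end Convergence

end UStat

theorem mainTheorem6_general
    {Ω S B : Type*} [MeasurableSpace Ω] [MeasurableSpace S]
    [NormedAddCommGroup B] [NormedSpace ℝ B] [CompleteSpace B]
    [TopologicalSpace.SeparableSpace B] [MeasurableSpace B] [BorelSpace B]
    (P : Measure Ω) [IsProbabilityMeasure P]
    (r : ℝ) (hB : UStat.IsSmoothSpace B r)
    (ξ : ℕ → Ω → S) (hξ_meas : ∀ i, Measurable (ξ i)) (hξ_indep : iIndepFun ξ P)
    (hξ_ident : ∀ i, IdentDistrib (ξ i) (ξ 0) P P)
    (m : ℕ) (d : ℕ) (hd : 1 ≤ d) (hdm : d ≤ m)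
    (h : (Fin m → S) → B) (hh_meas : Measurable h) (hh_symm : UStat.IsSymmKernel h)
    (hh_int : Integrable (fun ω => h (UStat.initial ξ m ω)) P)
    (hh_zero : P[fun ω => h (UStat.initial ξ m ω) | UStat.sigmaInitial ξ (d - 1)] =ᵐ[P] 0)
    (α : ℝ) (hαd : α < (r - 1) * d / r)
    (γ : ℝ) (hγ : -1 < γ)
    (hH : ∀ j : ℕ, 1 ≤ j → j ≤ m →
      MemLp (UStat.condMoment P ξ h r j)
        (ENNReal.ofReal (UStat.momentExponent α d j γ r)) P)
    (ε : ℝ) (hε : 0 < ε) :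
    ∑' N : ℕ, ENNReal.ofReal (((N + 1 : ℕ) : ℝ) ^ γ) *
      P {ω | ENNReal.ofReal ε <
        ⨆ n : ℕ, ⨆ _ : max (N + 1) m ≤ n,
          ENNReal.ofReal ((n : ℝ) ^ α * (1 / (n.choose m : ℝ)) * ‖UStat.uStat ξ h n ω‖)}
      < ⊤ := by
  obtain ⟨k, rfl⟩ := Nat.exists_eq_add_of_le' (hd.trans hdm)
  have hr : 1 < r := hB.1
  have hr0 : 0 < r := by linarith
  have := Measure.isProbabilityMeasure_map (μ := P) (hξ_meas 0).aemeasurable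
  have hξ := UStat.measurePreserving_sample hξ_meas hξ_indep hξ_ident
  have hq := UStat.momentExponent_pos (d := d) hr hαd hγ
  have hE := UStat.exponentCond_momentExponent (m := k + 1) hr hαd hγ
  have hαm : α ≤ (k + 1 : ℕ) := by simpa using (hE (k + 1) 0 0 (by simp) (by simpa)).1.le
  obtain ⟨C, hC0, hC⟩ := hB.exists_isMartingaleTypeConst (P.map (ξ 0))
  obtain ⟨K, δ, hδ, hK⟩ := UStat.exists_tsum_measure_lt_iSup_uStat_le_dyadicTail hξ hh_meas
    hh_symm hr0 hαm hγ hε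
  have hρ : 0 < γ + 1 := by linarith
  obtain ⟨η, hη⟩ := UStat.exists_dyadicTail_lt_top hr hC0 hC
    (UStat.measurable_pointKernel hh_meas) (UStat.integrable_pointKernel hξ hh_meas hh_int)
    hρ (fun j => (hq j).le) hE
    (fun J hJ => UStat.momentCond_pointKernel_of_memLp hξ hh_meas hh_symm (hq J.card)
      (hH J.card hJ.card_pos (card_finset_fin_le J)))
    (fun hqr => UStat.momentCond_pointKernel_empty hr0.le (hq 0).le
      (UStat.lintegral_enorm_rpow_lt_top_of_frozenMoment hh_meas hr0 hqr
        (UStat.lintegral_frozenMoment_rpow_lt_top hξ hh_meas (hq 1) (by omega)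
          (hH 1 le_rfl (by omega)))))
    (UStat.degenerateCond_pointKernel hξ hh_meas hh_symm hh_int hh_zero)
  exact (hK η).trans_lt (ENNReal.mul_lt_top ENNReal.ofReal_lt_top (hη δ hδ))

theorem mainTheorem6
    {Ω S B : Type*} [MeasurableSpace Ω] [MeasurableSpace S]
    [NormedAddCommGroup B] [NormedSpace ℝ B] [CompleteSpace B]
    [TopologicalSpace.SeparableSpace B] [MeasurableSpace B] [BorelSpace B]
    (P : Measure Ω) [IsProbabilityMeasure P]
    (r : ℝ) (hB : UStat.IsSmoothSpace B r)
    (ξ : ℕ → Ω → S) (hξ_meas : ∀ i, Measurable (ξ i)) (hξ_indep : iIndepFun ξ P)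
    (hξ_ident : ∀ i, IdentDistrib (ξ i) (ξ 0) P P)
    (m : ℕ) (hm : 2 ≤ m) (d : ℕ) (hd : 1 ≤ d) (hdm : d ≤ m)
    (h : (Fin m → S) → B) (hh_meas : Measurable h) (hh_symm : UStat.IsSymmKernel h)
    (hh_deg : UStat.IsDegenerateOfOrder P ξ h d)
    (α : ℝ) (hα : 0 < α) (hαd : α < (r - 1) * d / r)
    (γ : ℝ) (hγ : -1 < γ)
    (hH : ∀ j : ℕ, 1 ≤ j → j ≤ m →
      MemLp (UStat.condMoment P ξ h r j)
        (ENNReal.ofReal (UStat.momentExponent α d j γ r)) P)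
    (ε : ℝ) (hε : 0 < ε) :
    ∑' N : ℕ, ENNReal.ofReal (((N + 1 : ℕ) : ℝ) ^ γ) *
      P {ω | ENNReal.ofReal ε <
        ⨆ n : ℕ, ⨆ _ : max (N + 1) m ≤ n,
          ENNReal.ofReal ((n : ℝ) ^ α * (1 / (n.choose m : ℝ)) * ‖UStat.uStat ξ h n ω‖)}
      < ⊤ :=
  mainTheorem6_general P r hB ξ hξ_meas hξ_indep hξ_ident m d hd hdm h hh_meas hh_symm hh_deg.1
    hh_deg.2.1 α hαd γ hγ hH ε hε
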